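/- **Data structure.** Vertex keys are integers. A *vnode* has fields $val$, $vnext$, $EdgeHead$, $EdgeTail$, $marked$, $lock$; an *enode* has fields $val$, $enext$, $marked$, $lock$. $\mathrm{new}\ vnode(k)$ has $val=k$, $vnext=null$, $marked=false$, a free lock and two new sentinel enodes $EdgeHead$ (value $-\infty$) and $EdgeTail$ (value $+\infty$) with $EdgeHead.enext=EdgeTail$; $\mathrm{new}\ enode(k)$ has $val=k$, $enext=null$, $marked=false$ and a free lock. Initially the vertex list consists of two sentinels $VertexHead\to VertexTail$ with values $-\infty,+\infty$. Nodes are never deallocated. Any set of threads runs asynchronously; an idle thread may invoke any method with any arguments, and an execution is a finite interleaving of atomic steps (a read or write of one shared field, the creation of a node, acquiring or releasing a lock, an invocation, a response). The history of an execution is its sequence of invocation and response events. The methods are as follows. * $LocateVertex(k)$: repeat: $v_1:=VertexHead$, $v_2:=v_1.vnext$; while $v_2.val<k$ do $v_1:=v_2$, $v_2:=v_2.vnext$; lock $v_1$, then $v_2$; if $v_1.marked=false$ and $v_2.marked=false$ and $v_1.vnext=v_2$, return $(v_1,v_2)$; otherwise unlock $v_1$, $v_2$ and try again. * $AddVertex(k)$: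 $(v_1,v_2):=LocateVertex(k)$; if $v_2.val\ne k$: $v_3:=\mathrm{new}\ vnode(k)$, $v_3.vnext:=v_2$, $v_1.vnext:=v_3$. Unlock $v_1,v_2$; return true. * $RemoveVertex(k)$: $(v_1,v_2):=LocateVertex(k)$; if $v_2.val=k$: $v_2.marked:=true$, $v_1.vnext:=v_2.vnext$, unlock $v_1,v_2$, run $RemoveIncomingEdge(k)$, return true. Otherwise unlock $v_1,v_2$ and return false. * $EdgeSearch(w,k)$ (in the edge list of a vnode $w$): repeat: $e_1:=w.EdgeHead$, $e_2:=e_1.enext$; while $e_2.val<k$ do $e_1:=e_2$, $e_2:=e_2.enext$; lock $e_1$, then $e_2$; if $e_1.marked=false$ and $e_2.marked=false$ and $e_1.enext=e_2$, return $(e_1,e_2)$; otherwise unlock $e_1,e_2$ and try again. * $RemoveIncomingEdge(k)$: $temp:=VertexHead$; while $temp.vnext\neq null$: $(e_1,e_2):=EdgeSearch(temp,k)$; if $e_2.val=k$: $e_2.marked:=true$, $e_1.enext:=e_2.enext$; unlock $e_1,e_2$; $temp:=temp.vnext$. * $HelpSearchEdge(k_1,k_2)$: let $(a,b)=(k_1,k_2)$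 if $k_1<k_2$ and $(a,b)=(k_2,k_1)$ otherwise. $x:=VertexHead$; while $x.val<a$ do $x:=x.vnext$; fail if $x.val\ne a$ or $x.marked$. Then $y:=x.vnext$; while $y.val<b$ do $y:=y.vnext$; fail if $y.val\ne b$ or $y.marked$. Otherwise return as $v_1,v_2$ the nodes found for $k_1,k_2$. * $LocateEdge(k_1,k_2)$: run $HelpSearchEdge(k_1,k_2)$; fail if it fails, or if now $v_1.marked$ or $v_2.marked$; otherwise return $EdgeSearch(v_1,k_2)$. * $AddEdge(k_1,k_2)$: return false if $LocateEdge(k_1,k_2)$ fails; otherwise with its result $(e_1,e_2)$: if $e_2.val\ne k_2$: $e_3:=\mathrm{new}\ enode(k_2)$, $e_3.enext:=e_2$, $e_1.enext:=e_3$. Unlock $e_1,e_2$; return true. * $RemoveEdge(k_1,k_2)$: return false if $LocateEdge(k_1,k_2)$ fails; otherwise with its result $(e_1,e_2)$: if $e_2.val=k_2$: $e_2.marked:=true$, $e_1.enext:=e_2.enext$. Unlock $e_1,e_2$; return true. * $ContainsVertex(k)$: $v:=VertexHead$; while $v.val<k$ do $v:=v.vnext$; return true iff $v.val=k$ and $v.marked=false$.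 * $ContainsEdge(k_1,k_2)$: return false if $HelpSearchEdge(k_1,k_2)$ fails; otherwise $e:=v_1.EdgeHead$; while $e.val<k_2$ do $e:=e.enext$; return true iff $e.val=k_2$ and $e.marked=false$. **Sequential specification.** The state is a directed graph $(V,E)$, initially empty. $AddVertex(u)$ requires $u\notin V$, adds $u$ to $V$ and returns true (it never returns false). $RemoveVertex(u)$ returns true if $u\in V$, deleting $u$ and all edges incident to $u$; it returns false and changes nothing if $u\notin V$. $AddEdge(u,v)$ returns true if $u,v\in V$, after which $(u,v)\in E$; $RemoveEdge(u,v)$ returns true if $u,v\in V$, after which $(u,v)\notin E$; both return false and change nothing if $u\notin V$ or $v\notin V$. $ContainsVertex(u)$ returns whether $u\in V$, $ContainsEdge(u,v)$ whether $u,v\in V$ and $(u,v)\in E$; both change nothing. Nothing else changes in any of these cases. **Linearizability.** A history $H$ is linearizable if there are a completion $\overline H$ of $H$ (some pending invocations receive a matching response, appended at the end, and the other pending invocations are discarded) and a sequential history $S$ such that $S$ is equivalent to $\overline H$ (every thread has the same events in the same order in both), $S$ respects the real-time order of $\overline H$ (if the response of a call precedes the invocation of another call in $\overline H$, then also in $S$),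 and $S$ is legal, i.e. obeys the sequential specification starting from the empty graph. **Lemma.** Let $H$ be a history generated by an interleaving of the methods $AddVertex$, $RemoveVertex$, $AddEdge$, $RemoveEdge$, $ContainsVertex$, $ContainsEdge$ of the concurrent graph, started in the initial state. Assume that vertex keys are unique, i.e. no key is the argument of two invocations of $AddVertex$ in $H$, and that $AddEdge(u,v)$ and $RemoveEdge(u,v)$ are invoked in $H$ only with $u\neq v$. Then $H$ is linearizable. -/

import Mathlib

namespace ConcGraph

/-! ## Methods, events, histories -/

/-- A method of the graph object together with its arguments (vertex keys are integers). -/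
inductive Method where
  | addVertex (u : ℤ)
  | removeVertex (u : ℤ)
  | addEdge (u v : ℤ)
  | removeEdge (u v : ℤ)
  | containsVertex (u : ℤ)
  | containsEdge (u v : ℤ)

/-- Invocation and response events; `T` is the type of threads. -/
inductive Event (T : Type*) where
  | inv (t : T) (m : Method)
  | rsp (t : T) (m : Method) (b : Bool)

/-- A history is a finite sequence of invocation and response events. -/
abbrev History (T : Type*) := List (Event T)

section Histories

variable {T : Type*}

def Event.thread : Event T → T
  | .inv t _ => t
  | .rsp t _ _ => t

def Event.isInv : Event T → Bool
  | .inv _ _ => true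
  | .rsp _ _ _ => false

/-- A sequential history: every invocation, except possibly the last event, is immediately
followed by the matching response. -/
def IsSequential : History T → Prop
  | [] => True
  | [.inv _ _] => True
  | .inv t m :: .rsp t' m' _ :: H => t = t' ∧ m = m' ∧ IsSequential H
  | _ => False

variable [DecidableEq T]

/-- The subhistory `H | t` of the events of thread `t`. -/
def restrict (t : T) (H : History T) : History T :=
  H.filter fun e => e.thread = t

def WellFormed (H : History T) : Prop :=
  ∀ t, IsSequential (restrict t H)

/-- Delete the pending invocations.  In a well-formed history an invocation is pending exactly
when it is the last event of its thread. -/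
def dropPending : History T → History T
  | [] => []
  | e :: H =>
    if e.isInv ∧ ∀ e' ∈ H, e'.thread ≠ e.thread then dropPending H else e :: dropPending H

/-- `H'` is a completion of `H`: some pending invocations of `H` receive a response, appended at
the end, and the other pending invocations are discarded. -/
def IsCompletion (H H' : History T) : Prop :=
  ∃ R : History T, (∀ e ∈ R, e.isInv = false) ∧ WellFormed (H ++ R) ∧ H' = dropPending (H ++ R)

/-- Two histories are equivalent if every thread performs the same events in the same order. -/
def Equivalent (H S : History T) : Prop :=
  ∀ t, restrict t H = restrict t S

/-- Real-time order.  Method calls are named by pairs `(t, k)`, the `k`-th call (counted from `0`)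
of thread `t`.  Call `a` precedes call `b` in `H` if the response of `a` comes before the
invocation of `b`: after the first `n` events of `H`, for some `n`, call `a` has responded and
call `b`, which does occur in `H`, has not been invoked yet. -/
def Precedes (H : History T) (a b : T × ℕ) : Prop :=
  ∃ n, a.2 < (H.take n).countP (fun e => e.thread = a.1 ∧ e.isInv = false) ∧
    (H.take n).countP (fun e => e.thread = b.1 ∧ e.isInv = true) ≤ b.2 ∧
    b.2 < H.countP (fun e => e.thread = b.1 ∧ e.isInv = true)

end Histories

/-! ## Sequential specification -/

/-- The abstract graph: the set of vertices and the set of directed edges. -/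
structure AbsGraph where
  verts : Set ℤ
  edges : Set (ℤ × ℤ)

/-- `Spec G m b G'`: executed alone in the abstract graph `G`, the method `m` may return `b` and
leave the abstract graph `G'`. -/
def Spec (G : AbsGraph) : Method → Bool → AbsGraph → Prop
  | .addVertex u, true, G' => u ∉ G.verts ∧ G' = ⟨insert u G.verts, G.edges⟩
  | .addVertex _, false, _ => False
  | .removeVertex u, true, G' =>
      u ∈ G.verts ∧ G' = ⟨G.verts \ {u}, {e ∈ G.edges | e.1 ≠ u ∧ e.2 ≠ u}⟩
  | .removeVertex u, false, G' => u ∉ G.verts ∧ G' = G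
  | .addEdge u v, true, G' =>
      (u ∈ G.verts ∧ v ∈ G.verts) ∧ G' = ⟨G.verts, insert (u, v) G.edges⟩
  | .addEdge u v, false, G' => (u ∉ G.verts ∨ v ∉ G.verts) ∧ G' = G
  | .removeEdge u v, true, G' =>
      (u ∈ G.verts ∧ v ∈ G.verts) ∧ G' = ⟨G.verts, G.edges \ {(u, v)}⟩
  | .removeEdge u v, false, G' => (u ∉ G.verts ∨ v ∉ G.verts) ∧ G' = G
  | .containsVertex u, true, G' => u ∈ G.verts ∧ G' = G
  | .containsVertex u, false, G' => u ∉ G.verts ∧ G' = G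
  | .containsEdge u v, true, G' =>
      (u ∈ G.verts ∧ v ∈ G.verts ∧ (u, v) ∈ G.edges) ∧ G' = G
  | .containsEdge u v, false, G' =>
      (u ∉ G.verts ∨ v ∉ G.verts ∨ (u, v) ∉ G.edges) ∧ G' = G

/-- The sequential history obeys the specification when it is started in the abstract graph
`G`. -/
def LegalFrom {T : Type*} (G : AbsGraph) : History T → Prop
  | [] => True
  | [.inv _ _] => True
  | .inv _ m :: .rsp _ _ b :: S => ∃ G', Spec G m b G' ∧ LegalFrom G' S
  | _ => False

/-- Legal sequential histories; the graph is initially empty. -/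
def Legal {T : Type*} (S : History T) : Prop :=
  IsSequential S ∧ LegalFrom ⟨∅, ∅⟩ S

/-- Linearizability: some completion of `H` is equivalent to a legal sequential history that
respects its real-time order. -/
def Linearizable {T : Type*} [DecidableEq T] (H : History T) : Prop :=
  ∃ H' S : History T, IsCompletion H H' ∧ Equivalent H' S ∧
    (∀ a b, Precedes H' a b → Precedes S a b) ∧ Legal S

/-! ## Shared memory -/

/-- Node keys: integers, `⊥ = -∞` for head sentinels and `⊤ = +∞` for tail sentinels. -/
abbrev NodeKey := WithBot (WithTop ℤ)

def toKey (k : ℤ) : NodeKey := ((k : WithTop ℤ) : NodeKey)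

/-- References to vertex nodes and to edge nodes; `none : Option VRef` is the null reference. -/
abbrev VRef := ℕ
abbrev ERef := ℕ

/-- Vertex nodes.  A lock is `none` if it is free and `some t` if thread `t` holds it. -/
structure VNode (T : Type*) where
  val : NodeKey
  vnext : Option VRef
  edgeHead : ERef
  edgeTail : ERef
  marked : Bool
  lock : Option T

structure ENode (T : Type*) where
  val : NodeKey
  enext : Option ERef
  marked : Bool
  lock : Option T

/-- The shared memory.  The references below `vcount` and `ecount` are the allocated ones; nodes
are never deallocated. -/
structure Mem (T : Type*) where
  vnode : VRef → VNode T
  enode : ERef → ENode T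
  vcount : ℕ
  ecount : ℕ

section Memory

variable {T : Type*}

/-- A freshly constructed edge node. -/
def newENode (k : NodeKey) (next : Option ERef) : ENode T := ⟨k, next, false, none⟩

/-- The sentinels of the vertex list. -/
def vertexHead : VRef := 0
def vertexTail : VRef := 1

/-- The initial memory: the vertex list consists of its two sentinels, each with an edge list that
consists of two sentinels. -/
def initMem : Mem T where
  vnode v := if v = vertexHead then ⟨⊥, some vertexTail, 0, 1, false, none⟩
    else ⟨⊤, none, 2, 3, false, none⟩
  enode e := if e = 0 then newENode ⊥ (some 1) else if e = 1 then newENode ⊤ none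
    else if e = 2 then newENode ⊥ (some 3) else newENode ⊤ none
  vcount := 2
  ecount := 4

def Mem.setV (μ : Mem T) (v : VRef) (f : VNode T → VNode T) : Mem T :=
  { μ with vnode := Function.update μ.vnode v (f (μ.vnode v)) }

def Mem.setE (μ : Mem T) (e : ERef) (f : ENode T → ENode T) : Mem T :=
  { μ with enode := Function.update μ.enode e (f (μ.enode e)) }

/-- `new vnode(k)`: the new node has reference `μ.vcount`; its edge list consists of two new
sentinels. -/
def Mem.allocV (μ : Mem T) (k : ℤ) : Mem T where
  vnode := Function.update μ.vnode μ.vcount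
    ⟨toKey k, none, μ.ecount, μ.ecount + 1, false, none⟩
  enode := Function.update (Function.update μ.enode μ.ecount (newENode ⊥ (some (μ.ecount + 1))))
    (μ.ecount + 1) (newENode ⊤ none)
  vcount := μ.vcount + 1
  ecount := μ.ecount + 2

/-- `new enode(k)`: the new node has reference `μ.ecount`. -/
def Mem.allocE (μ : Mem T) (k : ℤ) : Mem T where
  vnode := μ.vnode
  enode := Function.update μ.enode μ.ecount (newENode (toKey k) none)
  vcount := μ.vcount
  ecount := μ.ecount + 1

end Memory

/-! ## The code of the methods -/

/-- Where a thread continues after it has released two vertex locks: search again, return, or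
remove the incoming edges. -/
inductive VExit where
  | retry
  | ret (b : Bool)
  | scan

/-- Program points, with the values of the local variables.  The instruction at a program point is
given by `step`. -/
inductive Pc where
  -- `LocateVertex`, with `ValidateVertex`
  | lvHead
  | lvNext (v₁ : VRef)
  | lvTest (v₁ v₂ : VRef)
  | lvLock1 (v₁ v₂ : VRef)
  | lvLock2 (v₁ v₂ : VRef)
  | lvValid1 (v₁ v₂ : VRef)
  | lvValid2 (v₁ v₂ : VRef)
  | lvValid3 (v₁ v₂ : VRef)
  -- `AddVertex` and `RemoveVertex` after `LocateVertex`
  | vTest (v₁ v₂ : VRef)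
  | avNew (v₁ v₂ : VRef)
  | avSet (v₁ v₂ v₃ : VRef)
  | avLink (v₁ v₂ v₃ : VRef)
  | rvMark (v₁ v₂ : VRef)
  | rvRead (v₁ v₂ : VRef)
  | rvUnlink (v₁ v₂ : VRef) (w : Option VRef)
  | vRel1 (v₁ v₂ : VRef) (x : VExit)
  | vRel2 (v₂ : VRef) (x : VExit)
  -- the loop of `RemoveIncomingEdge` over the vertex list
  | riHead
  | riTest (temp : VRef)
  | riNext (temp : VRef)
  -- `HelpSearchEdge`
  | hsHead
  | hsTest1 (x : VRef)
  | hsNext1 (x : VRef)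
  | hsVal1 (x : VRef)
  | hsMark1 (x : VRef)
  | hsTest2 (x y : VRef)
  | hsNext2 (x y : VRef)
  | hsVal2 (x y : VRef)
  | hsMark2 (x y : VRef)
  -- `LocateEdge` after `HelpSearchEdge`: the second check of the marks
  | leMark1 (v₁ v₂ : VRef)
  | leMark2 (v₁ v₂ : VRef)
  -- locating an edge node in the edge list of `w`, with `ValidateEdge`
  | leHead (w : VRef)
  | leNext (w : VRef) (e₁ : ERef)
  | leTest (w : VRef) (e₁ e₂ : ERef)
  | leLock1 (w : VRef) (e₁ e₂ : ERef)
  | leLock2 (w : VRef) (e₁ e₂ : ERef)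
  | leValid1 (w : VRef) (e₁ e₂ : ERef)
  | leValid2 (w : VRef) (e₁ e₂ : ERef)
  | leValid3 (w : VRef) (e₁ e₂ : ERef)
  -- updating the edge list of `w` after an edge node has been located
  | eTest (w : VRef) (e₁ e₂ : ERef)
  | aeNew (w : VRef) (e₁ e₂ : ERef)
  | aeSet (w : VRef) (e₁ e₂ e₃ : ERef)
  | aeLink (w : VRef) (e₁ e₂ e₃ : ERef)
  | reMark (w : VRef) (e₁ e₂ : ERef)
  | reRead (w : VRef) (e₁ e₂ : ERef)
  | reUnlink (w : VRef) (e₁ e₂ : ERef) (f : Option ERef)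
  | eRel1 (w : VRef) (e₁ e₂ : ERef) (done : Bool)
  | eRel2 (w : VRef) (e₂ : ERef) (done : Bool)
  -- `ContainsVertex`
  | cvHead
  | cvTest (v : VRef)
  | cvNext (v : VRef)
  | cvVal (v : VRef)
  | cvMark (v : VRef)
  -- `ContainsEdge` after `HelpSearchEdge`
  | ceHead (v₁ : VRef)
  | ceTest (e : ERef)
  | ceNext (e : ERef)
  | ceVal (e : ERef)
  | ceMark (e : ERef)
  -- the method is about to return `b`
  | ret (b : Bool)

def VExit.pc : VExit → Pc
  | .retry => .lvHead
  | .ret b => .ret b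
  | .scan => .riHead

/-- The first program point of a method. -/
def Method.start : Method → Pc
  | .addVertex _ => .lvHead
  | .removeVertex _ => .lvHead
  | .addEdge _ _ => .hsHead
  | .removeEdge _ _ => .hsHead
  | .containsVertex _ => .cvHead
  | .containsEdge _ _ => .hsHead

/-- The first argument `key₁` (or the only argument `key`). -/
def Method.key₁ : Method → ℤ
  | .addVertex u => u
  | .removeVertex u => u
  | .addEdge u _ => u
  | .removeEdge u _ => u
  | .containsVertex u => u
  | .containsEdge u _ => u

/-- The key that is searched for in edge lists: the second argument of an edge method, and the
argument of `RemoveVertex`, which removes the incoming edges of that vertex. -/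
def Method.ekey : Method → ℤ
  | .addVertex u => u
  | .removeVertex u => u
  | .addEdge _ v => v
  | .removeEdge _ v => v
  | .containsVertex u => u
  | .containsEdge _ v => v

/-- `HelpSearchEdge` first looks for `key₁` and then for `key₂` if `key₁ < key₂`, and the other way
round otherwise. -/
def Method.fstKey (m : Method) : ℤ := if m.key₁ < m.ekey then m.key₁ else m.ekey
def Method.sndKey (m : Method) : ℤ := if m.key₁ < m.ekey then m.ekey else m.key₁

/-- `step t m μ p` is one atomic step of thread `t` that executes method `m` and is at program
point `p` in the shared memory `μ`: a single access to the shared memory (a read or a write of one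
field, the creation of a node, the acquisition or the release of a lock), together with the local
computation that follows it.  The value is `none` if the thread cannot move: it waits for a lock,
it would follow a null reference, it is ready to respond, or the program point does not belong to
the method.  Conditions with several reads are evaluated from left to right, and the evaluation
ends as soon as the value is known. -/
noncomputable def step {T : Type*} (t : T) (m : Method) (μ : Mem T) : Pc → Option (Mem T × Pc)
  -- LocateVertex
  | .lvHead => some (μ, .lvNext vertexHead)
  | .lvNext v₁ =>
    match (μ.vnode v₁).vnext with
    | some v₂ => some (μ, .lvTest v₁ v₂)
    | none => none
  | .lvTest v₁ v₂ =>
    some (μ, if (μ.vnode v₂).val < toKey m.key₁ then .lvNext v₂ else .lvLock1 v₁ v₂)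
  | .lvLock1 v₁ v₂ =>
    match (μ.vnode v₁).lock with
    | some _ => none
    | none => some (μ.setV v₁ fun n => { n with lock := some t }, .lvLock2 v₁ v₂)
  | .lvLock2 v₁ v₂ =>
    match (μ.vnode v₂).lock with
    | some _ => none
    | none => some (μ.setV v₂ fun n => { n with lock := some t }, .lvValid1 v₁ v₂)
  | .lvValid1 v₁ v₂ =>
    some (μ, if (μ.vnode v₁).marked = false then .lvValid2 v₁ v₂ else .vRel1 v₁ v₂ .retry)
  | .lvValid2 v₁ v₂ =>
    some (μ, if (μ.vnode v₂).marked = false then .lvValid3 v₁ v₂ else .vRel1 v₁ v₂ .retry)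
  | .lvValid3 v₁ v₂ =>
    some (μ, if (μ.vnode v₁).vnext = some v₂ then .vTest v₁ v₂ else .vRel1 v₁ v₂ .retry)
  -- AddVertex and RemoveVertex
  | .vTest v₁ v₂ =>
    match m with
    | .addVertex u =>
      some (μ, if (μ.vnode v₂).val ≠ toKey u then .avNew v₁ v₂ else .vRel1 v₁ v₂ (.ret true))
    | .removeVertex u =>
      some (μ, if (μ.vnode v₂).val = toKey u then .rvMark v₁ v₂ else .vRel1 v₁ v₂ (.ret false))
    | _ => none
  | .avNew v₁ v₂ => some (μ.allocV m.key₁, .avSet v₁ v₂ μ.vcount)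
  | .avSet v₁ v₂ v₃ => some (μ.setV v₃ fun n => { n with vnext := some v₂ }, .avLink v₁ v₂ v₃)
  | .avLink v₁ v₂ v₃ =>
    some (μ.setV v₁ fun n => { n with vnext := some v₃ }, .vRel1 v₁ v₂ (.ret true))
  | .rvMark v₁ v₂ => some (μ.setV v₂ fun n => { n with marked := true }, .rvRead v₁ v₂)
  | .rvRead v₁ v₂ => some (μ, .rvUnlink v₁ v₂ (μ.vnode v₂).vnext)
  | .rvUnlink v₁ v₂ w => some (μ.setV v₁ fun n => { n with vnext := w }, .vRel1 v₁ v₂ .scan)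
  | .vRel1 v₁ v₂ x => some (μ.setV v₁ fun n => { n with lock := none }, .vRel2 v₂ x)
  | .vRel2 v₂ x => some (μ.setV v₂ fun n => { n with lock := none }, x.pc)
  -- RemoveIncomingEdge; the work on the edge list of `temp` starts at `leHead temp`
  | .riHead => some (μ, .riTest vertexHead)
  | .riTest temp => some (μ, if (μ.vnode temp).vnext = none then .ret true else .leHead temp)
  | .riNext temp =>
    match (μ.vnode temp).vnext with
    | some v => some (μ, .riTest v)
    | none => none
  -- HelpSearchEdge; `x` is the node of the first key, `y` that of the second key
  | .hsHead => some (μ, .hsTest1 vertexHead)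
  | .hsTest1 x => some (μ, if (μ.vnode x).val < toKey m.fstKey then .hsNext1 x else .hsVal1 x)
  | .hsNext1 x =>
    match (μ.vnode x).vnext with
    | some x' => some (μ, .hsTest1 x')
    | none => none
  | .hsVal1 x => some (μ, if (μ.vnode x).val ≠ toKey m.fstKey then .ret false else .hsMark1 x)
  | .hsMark1 x => some (μ, if (μ.vnode x).marked = true then .ret false else .hsNext2 x x)
  | .hsTest2 x y =>
    some (μ, if (μ.vnode y).val < toKey m.sndKey then .hsNext2 x y else .hsVal2 x y)
  | .hsNext2 x y =>
    match (μ.vnode y).vnext with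
    | some y' => some (μ, .hsTest2 x y')
    | none => none
  | .hsVal2 x y => some (μ, if (μ.vnode y).val ≠ toKey m.sndKey then .ret false else .hsMark2 x y)
  | .hsMark2 x y =>
    if (μ.vnode y).marked = true then some (μ, .ret false) else
    match m with
    | .addEdge u v => some (μ, if u < v then .leMark1 x y else .leMark1 y x)
    | .removeEdge u v => some (μ, if u < v then .leMark1 x y else .leMark1 y x)
    | .containsEdge u v => some (μ, if u < v then .ceHead x else .ceHead y)
    | _ => none
  -- LocateEdge
  | .leMark1 v₁ v₂ => some (μ, if (μ.vnode v₁).marked = true then .ret false else .leMark2 v₁ v₂)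
  | .leMark2 v₁ v₂ => some (μ, if (μ.vnode v₂).marked = true then .ret false else .leHead v₁)
  | .leHead w => some (μ, .leNext w (μ.vnode w).edgeHead)
  | .leNext w e₁ =>
    match (μ.enode e₁).enext with
    | some e₂ => some (μ, .leTest w e₁ e₂)
    | none => none
  | .leTest w e₁ e₂ =>
    some (μ, if (μ.enode e₂).val < toKey m.ekey then .leNext w e₂ else .leLock1 w e₁ e₂)
  | .leLock1 w e₁ e₂ =>
    match (μ.enode e₁).lock with
    | some _ => none
    | none => some (μ.setE e₁ fun n => { n with lock := some t }, .leLock2 w e₁ e₂)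
  | .leLock2 w e₁ e₂ =>
    match (μ.enode e₂).lock with
    | some _ => none
    | none => some (μ.setE e₂ fun n => { n with lock := some t }, .leValid1 w e₁ e₂)
  | .leValid1 w e₁ e₂ =>
    some (μ, if (μ.enode e₁).marked = false then .leValid2 w e₁ e₂ else .eRel1 w e₁ e₂ false)
  | .leValid2 w e₁ e₂ =>
    some (μ, if (μ.enode e₂).marked = false then .leValid3 w e₁ e₂ else .eRel1 w e₁ e₂ false)
  | .leValid3 w e₁ e₂ =>
    some (μ, if (μ.enode e₁).enext = some e₂ then .eTest w e₁ e₂ else .eRel1 w e₁ e₂ false)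
  -- AddEdge, RemoveEdge, and RemoveIncomingEdge within RemoveVertex
  | .eTest w e₁ e₂ =>
    match m with
    | .addEdge _ v =>
      some (μ, if (μ.enode e₂).val ≠ toKey v then .aeNew w e₁ e₂ else .eRel1 w e₁ e₂ true)
    | .removeEdge _ v =>
      some (μ, if (μ.enode e₂).val = toKey v then .reMark w e₁ e₂ else .eRel1 w e₁ e₂ true)
    | .removeVertex v =>
      some (μ, if (μ.enode e₂).val = toKey v then .reMark w e₁ e₂ else .eRel1 w e₁ e₂ true)
    | _ => none
  | .aeNew w e₁ e₂ => some (μ.allocE m.ekey, .aeSet w e₁ e₂ μ.ecount)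
  | .aeSet w e₁ e₂ e₃ =>
    some (μ.setE e₃ fun n => { n with enext := some e₂ }, .aeLink w e₁ e₂ e₃)
  | .aeLink w e₁ e₂ e₃ =>
    some (μ.setE e₁ fun n => { n with enext := some e₃ }, .eRel1 w e₁ e₂ true)
  | .reMark w e₁ e₂ => some (μ.setE e₂ fun n => { n with marked := true }, .reRead w e₁ e₂)
  | .reRead w e₁ e₂ => some (μ, .reUnlink w e₁ e₂ (μ.enode e₂).enext)
  | .reUnlink w e₁ e₂ f => some (μ.setE e₁ fun n => { n with enext := f }, .eRel1 w e₁ e₂ true)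
  | .eRel1 w e₁ e₂ done => some (μ.setE e₁ fun n => { n with lock := none }, .eRel2 w e₂ done)
  | .eRel2 w e₂ done =>
    some (μ.setE e₂ fun n => { n with lock := none },
      if done = false then .leHead w else
      match m with
      | .removeVertex _ => .riNext w
      | _ => .ret true)
  -- ContainsVertex
  | .cvHead => some (μ, .cvTest vertexHead)
  | .cvTest v => some (μ, if (μ.vnode v).val < toKey m.key₁ then .cvNext v else .cvVal v)
  | .cvNext v =>
    match (μ.vnode v).vnext with
    | some v' => some (μ, .cvTest v')
    | none => none
  | .cvVal v => some (μ, if (μ.vnode v).val ≠ toKey m.key₁ then .ret false else .cvMark v)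
  | .cvMark v => some (μ, if (μ.vnode v).marked = true then .ret false else .ret true)
  -- ContainsEdge
  | .ceHead v₁ => some (μ, .ceTest (μ.vnode v₁).edgeHead)
  | .ceTest e => some (μ, if (μ.enode e).val < toKey m.ekey then .ceNext e else .ceVal e)
  | .ceNext e =>
    match (μ.enode e).enext with
    | some e' => some (μ, .ceTest e')
    | none => none
  | .ceVal e => some (μ, if (μ.enode e).val ≠ toKey m.ekey then .ret false else .ceMark e)
  | .ceMark e => some (μ, if (μ.enode e).marked = true then .ret false else .ret true)
  | .ret _ => none

/-! ## Executions -/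

/-- A global state: the shared memory, and for each thread either `none` (no method is active) or
the active method with the current program point. -/
structure Config (T : Type*) where
  mem : Mem T
  loc : T → Option (Method × Pc)

def initConfig {T : Type*} : Config T := ⟨initMem, fun _ => none⟩

/-- `Run c H`: some finite interleaved execution from the initial global state ends in `c` and has
the history `H`.  At any time an idle thread may invoke any method with any arguments, an active
thread may execute its next atomic step, and a thread whose method has ended may respond. -/
inductive Run {T : Type*} [DecidableEq T] : Config T → History T → Prop
  | init : Run initConfig []
  | invoke {c : Config T} {H : History T} (t : T) (m : Method) :
      Run c H → c.loc t = none →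
      Run ⟨c.mem, Function.update c.loc t (some (m, m.start))⟩ (H ++ [.inv t m])
  | internal {c : Config T} {H : History T} (t : T) (m : Method) (p p' : Pc) (μ' : Mem T) :
      Run c H → c.loc t = some (m, p) → step t m c.mem p = some (μ', p') →
      Run ⟨μ', Function.update c.loc t (some (m, p'))⟩ H
  | respond {c : Config T} {H : History T} (t : T) (m : Method) (b : Bool) :
      Run c H → c.loc t = some (m, .ret b) →
      Run ⟨c.mem, Function.update c.loc t none⟩ (H ++ [.rsp t m b])

/-- `H` is generated by interleaving the methods of the concurrent graph. -/
def Generated {T : Type*} [DecidableEq T] (H : History T) : Prop :=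
  ∃ c : Config T, Run c H

/-- Vertex keys are unique: no key is the argument of two invocations of `AddVertex`. -/
def UniqueVertexKeys {T : Type*} (H : History T) : Prop :=
  ∀ (i j : Fin H.length) (t t' : T) (u : ℤ),
    H.get i = .inv t (.addVertex u) → H.get j = .inv t' (.addVertex u) → i = j

/-- No thread asks for the addition or the removal of a self-loop. -/
def NoSelfLoops {T : Type*} (H : History T) : Prop :=
  ∀ (t : T) (u v : ℤ),
    Event.inv t (.addEdge u v) ∈ H ∨ Event.inv t (.removeEdge u v) ∈ H → u ≠ v

end ConcGraph

set_option linter.unusedSectionVars false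

/-! The history is enriched to a log in which every call that has taken effect carries a
linearization point between its invocation and its response. A log is valid when each thread runs
through invocation, linearization point, response in this order and the linearization points obey
the specification. `ValidLog.linearizable` turns a valid log into a linearization: calls that have
taken effect are answered, the other pending calls are erased, and the linearization points in log
order form the sequential history. It remains to build a valid log along every execution.

This is a rely-guarantee argument. A global invariant `State.Inv` relates memory and log, an
assertion `State.At` is attached to each program point, and `State.Inv.step` shows that every atomic
step keeps the invariant, establishes the next assertion and respects what the other threads rely on
(`State.Guar`, `State.Rely`, `State.At.rely`). `Run.exists_simulates` is the resulting induction
over executions.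

The linearization points are as follows. `AddVertex` takes effect at the link write and a successful
`RemoveVertex` at the marking; a failing `RemoveVertex` takes effect in its validated window. Calls
that leave the graph unchanged may be linearized in the past, at any moment of the call when their
answer was right (`exists_logStep_of_cand`). `AddEdge(u, v)` and `RemoveEdge(u, v)` know only that
`u` and `v` were both present at some moment of the call. If both still are, the point goes to the
end of the log; otherwise it goes immediately before the first later removal of an endpoint, which
wipes out every trace of `(u, v)`, so that all later abstract graphs are unchanged
(`exists_logStep_edge`). `Insertable` isolates what makes such insertions into the past harmless.

Two facts justify the answers of the unlocked traversals. First, the lists are sorted, nodes keep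
their references after removal, and no step destroys a path to a node that stays unmarked. So a
search either still has its target ahead of it or witnesses a moment of the call when the key was
absent (`State.TravV`, `State.TravE`). Second, an unmarked edge node does not prove that its edge is
present now, because edges vanish abstractly as soon as an endpoint is marked. It proves only that
the edge is present or was present just before an endpoint was removed (`EdgeEver`). Since keys are
unique, removed vertices never return; as both endpoints were seen alive during the call, that
moment cannot precede the call, or else the edge was present at a moment inside it as well
(`Cand₂.edge`). -/

namespace ConcGraph

variable {T : Type*}

/-! ## Logs: histories with linearization points -/

/-- An entry of a log: an event of the history, or the linearization point of a call. -/
inductive Entry (T : Type*) where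
  | ev (e : Event T)
  | lin (t : T) (m : Method) (b : Bool)

/-- The status of the last call of a thread. -/
inductive CallState where
  | idle
  | pend (m : Method)
  | done (m : Method) (b : Bool)

def Entry.thread : Entry T → T
  | .ev e => e.thread
  | .lin t _ _ => t

/-- The status of the last call after the entry. -/
def Entry.post : Entry T → CallState
  | .ev (.inv _ m) => .pend m
  | .ev (.rsp _ _ _) => .idle
  | .lin _ m b => .done m b

/-- The status of the last call that the entry requires. -/
def Entry.pre : Entry T → CallState
  | .ev (.inv _ _) => .idle
  | .ev (.rsp _ m b) => .done m b
  | .lin _ m _ => .pend m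

/-- A log; the newest entry comes first. -/
abbrev Log (T : Type*) := List (Entry T)

/-- The history of a log, the oldest event first. -/
def evs : Log T → History T
  | [] => []
  | .ev e :: L => evs L ++ [e]
  | .lin _ _ _ :: L => evs L

def Method.effect (m : Method) (b : Bool) (G : AbsGraph) : AbsGraph :=
  match m, b with
  | .addVertex u, true => ⟨insert u G.verts, G.edges⟩
  | .removeVertex u, true => ⟨G.verts \ {u}, {e ∈ G.edges | e.1 ≠ u ∧ e.2 ≠ u}⟩
  | .addEdge u v, true => ⟨G.verts, insert (u, v) G.edges⟩
  | .removeEdge u v, true => ⟨G.verts, G.edges \ {(u, v)}⟩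
  | _, _ => G

/-- The abstract graph after a log. -/
def graph : Log T → AbsGraph
  | [] => ⟨∅, ∅⟩
  | .ev _ :: L => graph L
  | .lin _ m b :: L => m.effect b (graph L)

/-! ### Valid logs and insertion into the past of a log. -/

section
variable [DecidableEq T]

def callState (t : T) : Log T → CallState
  | [] => .idle
  | x :: L => if x.thread = t then x.post else callState t L

/-- An entry is legal after a log.  Vertices that have been removed are never added again. -/
def Entry.Legal (x : Entry T) (L : Log T) : Prop :=
  callState x.thread L = x.pre ∧
  match x with
  | .ev _ => True
  | .lin _ m b => Spec (graph L) m b (m.effect b (graph L)) ∧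
      (∀ z, m = .addVertex z → ∀ A, A <:+ L → z ∉ (graph A).verts) ∧
      (∀ u v, m = .addEdge u v → u ≠ v)

def ValidLog : Log T → Prop
  | [] => True
  | x :: L => x.Legal L ∧ ValidLog L

/-- No entry belongs to the thread `t`. -/
def Quiet (t : T) (B : Log T) : Prop := ∀ x ∈ B, x.thread ≠ t

/-- During the current call of `t` the abstract graph satisfied first `P` and then `Q`. -/
def Cand₂ (L : Log T) (t : T) (P Q : AbsGraph → Prop) : Prop :=
  ∃ C B A, L = C ++ (B ++ A) ∧ Quiet t C ∧ Quiet t B ∧ P (graph A) ∧ Q (graph (B ++ A))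

/-- During the current call of `t` the abstract graph satisfied `P`. -/
def Cand (L : Log T) (t : T) (P : AbsGraph → Prop) : Prop :=
  ∃ B A, L = B ++ A ∧ Quiet t B ∧ P (graph A)

/-- The entry is the removal of `u` or `v`. -/
def Entry.Kills (x : Entry T) (u v : ℤ) : Prop :=
  ∃ t z, x = .lin t (.removeVertex z) true ∧ (z = u ∨ z = v)

/-- The edge is present now, or it was present when one of its endpoints was removed. -/
def EdgeEver (L : Log T) (u v : ℤ) : Prop :=
  ∃ B A, L = B ++ A ∧ (u, v) ∈ (graph A).edges ∧
    (B = [] ∨ ∃ B' r, B = B' ++ [r] ∧ r.Kills u v)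

/-- The entry `x` may be inserted between `B` and `A`: it is inserted at the end, or it does not
change the abstract graph, or its effect is undone by the next entry. -/
def Insertable (B : Log T) (x : Entry T) (A : Log T) : Prop :=
  B = [] ∨ graph (x :: A) = graph A ∨
    ((graph (x :: A)).verts = (graph A).verts ∧
      ∃ B' t z, B = B' ++ [.lin t (.removeVertex z) true] ∧
        graph (.lin t (.removeVertex z) true :: x :: A) =
          graph (.lin t (.removeVertex z) true :: A))

theorem Quiet.nil (t : T) : Quiet t [] := by simp [Quiet]

theorem Quiet.append {t : T} {A B : Log T} : Quiet t (A ++ B) ↔ Quiet t A ∧ Quiet t B := by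
  simp [Quiet, or_imp, forall_and]

theorem Quiet.cons {t : T} {x : Entry T} {B : Log T} :
    Quiet t (x :: B) ↔ x.thread ≠ t ∧ Quiet t B := by
  simp [Quiet]

theorem callState_append {t : T} {B A : Log T} (h : Quiet t B) :
    callState t (B ++ A) = callState t A := by
  induction B with
  | nil => rfl
  | cons x B ih =>
    rw [Quiet.cons] at h
    simp [callState, h.1, ih h.2]

theorem callState_insert {t : T} {x : Entry T} (hx : x.thread ≠ t) (B A : Log T) :
    callState t (B ++ x :: A) = callState t (B ++ A) := by
  induction B with
  | nil => simp [callState, hx]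
  | cons y B ih => simp [callState, ih]

theorem graph_append_congr (C : Log T) {A A' : Log T} (h : graph A = graph A') :
    graph (C ++ A) = graph (C ++ A') := by
  induction C with
  | nil => exact h
  | cons y C ih => cases y <;> simp [graph, ih]

theorem evs_insert_lin (t : T) (m : Method) (b : Bool) (B A : Log T) :
    evs (B ++ .lin t m b :: A) = evs (B ++ A) := by
  induction B with
  | nil => rfl
  | cons y B ih => cases y <;> simp [evs, ih]

theorem ValidLog.of_append {B A : Log T} (h : ValidLog (B ++ A)) : ValidLog A := by
  induction B with
  | nil => exact h
  | cons y B ih => exact ih h.2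

theorem ValidLog.of_suffix {A L : Log T} (h : ValidLog L) (hA : A <:+ L) : ValidLog A := by
  obtain ⟨B, rfl⟩ := hA
  exact h.of_append

/-- Edges join distinct vertices. -/
theorem ValidLog.edges {L : Log T} (h : ValidLog L) {u v : ℤ} (he : (u, v) ∈ (graph L).edges) :
    u ∈ (graph L).verts ∧ v ∈ (graph L).verts ∧ u ≠ v := by
  induction L with
  | nil => simp [graph] at he
  | cons x L ih =>
    have ih := ih h.2
    rcases x with e | ⟨t, m, b⟩
    · exact ih he
    · have h1 := h.1.2
      cases b <;> rcases m with a | a | ⟨a, c⟩ | ⟨a, c⟩ | a | ⟨a, c⟩ <;>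
        simp only [graph, Method.effect] at he ⊢ <;> try exact ih he
      · exact ⟨.inr (ih he).1, .inr (ih he).2.1, (ih he).2.2⟩
      · have := ih he.1
        exact ⟨⟨this.1, he.2.1⟩, ⟨this.2.1, he.2.2⟩, this.2.2⟩
      · rcases he with he | he
        · obtain ⟨rfl, rfl⟩ := Prod.mk.inj he
          exact ⟨h1.1.1.1, h1.1.1.2, h1.2.2 _ _ rfl⟩
        · exact ih he
      · exact ih he.1

/-- A vertex that has disappeared does not come back. -/
theorem ValidLog.not_mem_verts {B C A : Log T} (h : ValidLog (C ++ (B ++ A))) {z : ℤ}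
    (hA : z ∈ (graph A).verts) (hB : z ∉ (graph (B ++ A)).verts) :
    z ∉ (graph (C ++ (B ++ A))).verts := by
  induction C with
  | nil => exact hB
  | cons x C ih =>
    have ih := ih h.2
    rcases x with e | ⟨t, m, b⟩
    · exact ih
    · have h1 := h.1.2
      cases b <;> rcases m with a | a | ⟨a, c⟩ | ⟨a, c⟩ | a | ⟨a, c⟩ <;>
        simp only [List.cons_append, graph, Method.effect] <;> try exact ih
      · rintro (rfl | h2)
        -- Only an `AddVertex` could bring the key back, and it is legal only for a key that no
        -- earlier graph contained.
        · exact h1.2.1 _ rfl A ⟨C ++ B, by simp⟩ hA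
        · exact ih h2
      · exact fun h2 => ih h2.1

/-- The inserted entry is either neutral or erased by the entry right after it, so the graphs agree
from that entry on. The graph exactly at the insertion point may differ, hence `C ≠ []`. -/
theorem Insertable.graph_eq {B A : Log T} {x : Entry T} (h : Insertable B x A) {D C : Log T}
    (hB : B = D ++ C) (hC : C ≠ []) : graph (C ++ x :: A) = graph (C ++ A) := by
  rcases h with h | h | ⟨-, B', t, z, h, h'⟩
  · simp_all
  · exact graph_append_congr C h
  · rw [h] at hB
    obtain ⟨C', y, rfl⟩ := List.eq_nil_or_concat C |>.resolve_left hC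
    rw [List.concat_eq_append, ← List.append_assoc] at hB
    obtain ⟨-, hy⟩ := List.append_inj' hB rfl
    obtain rfl := List.singleton_inj.1 hy
    simpa using graph_append_congr C' h'

theorem Insertable.of_append {B C A : Log T} {x : Entry T} (h : Insertable (B ++ C) x A)
    (hC : C ≠ []) : Insertable C x A := by
  rcases h with h | h | ⟨hv, B', t, z, h, h'⟩
  · simp_all
  · exact .inr (.inl h)
  · refine .inr (.inr ⟨hv, ?_⟩)
    obtain ⟨C', y, rfl⟩ := List.eq_nil_or_concat C |>.resolve_left hC
    rw [List.concat_eq_append, ← List.append_assoc] at h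
    obtain ⟨-, hy⟩ := List.append_inj' h rfl
    obtain rfl := List.singleton_inj.1 hy
    exact ⟨C', t, z, by simp, h'⟩

theorem Insertable.verts_eq {B A : Log T} {x : Entry T} (h : Insertable B x A) (hB : B ≠ []) :
    (graph (x :: A)).verts = (graph A).verts := by
  rcases h with h | h | h
  · exact absurd h hB
  · rw [h]
  · exact h.1

/-- Two ways to split the log: `A` ends before or after `A₀`. -/
theorem append_eq_cases {B₀ A₀ B A : Log T} (h : B₀ ++ A₀ = B ++ A) :
    (∃ C, B = B₀ ++ C ∧ A₀ = C ++ A) ∨ (∃ C, C ≠ [] ∧ B₀ = B ++ C ∧ A = C ++ A₀) := by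
  rw [List.append_eq_append_iff] at h
  rcases h with ⟨C, h1, h2⟩ | ⟨C, h1, h2⟩
  · exact .inl ⟨C, h1, h2⟩
  · rcases eq_or_ne C [] with rfl | hC
    · exact .inl ⟨[], by simpa using h1.symm, by simpa using h2.symm⟩
    · exact .inr ⟨C, hC, h1, h2⟩

/-- The abstract graphs of the suffixes survive an insertion. -/
theorem Insertable.verts_suffix {B A D : Log T} {x : Entry T} (h : Insertable B x A)
    (hB : B ≠ []) (hD : D <:+ B ++ x :: A) :
    ∃ D', D' <:+ B ++ A ∧ (graph D).verts = (graph D').verts := by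
  obtain ⟨E, hE⟩ := hD
  rcases append_eq_cases hE.symm with ⟨C, rfl, h2⟩ | ⟨C, hC, h1, h2⟩
  · rcases C with _ | ⟨y, C⟩
    · refine ⟨A, ⟨B, rfl⟩, ?_⟩
      rw [← h.verts_eq hB, h2]; rfl
    · simp only [List.cons_append, List.cons.injEq] at h2
      exact ⟨D, ⟨B ++ C, by simp [h2.2]⟩, rfl⟩
  · exact ⟨C ++ A, ⟨E, by simp [h1]⟩, by rw [h2, h.graph_eq h1 hC]⟩

/-- Later entries see the same graphs as before, with the possible exception of the entry directly
after `x`. The prohibition on re-adding keys concerns vertex sets only, and `x` does not change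
these if anything follows it. -/
theorem ValidLog.insert {B A : Log T} {x : Entry T} (h : ValidLog (B ++ A))
    (hB : Insertable B x A) (hx : x.Legal A) (hq : Quiet x.thread B) :
    ValidLog (B ++ x :: A) := by
  induction B with
  | nil => exact ⟨hx, h⟩
  | cons y B ih =>
    rw [Quiet.cons] at hq
    rw [List.cons_append] at h ⊢
    have hB' : Insertable B x A := by
      rcases eq_or_ne B [] with rfl | hn
      · exact .inl rfl
      · exact hB.of_append (B := [y]) hn
    refine ⟨?_, ih h.2 hB' hq.2⟩
    obtain ⟨h1, h2⟩ := h.1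
    refine ⟨by rw [callState_insert (Ne.symm hq.1)]; exact h1, ?_⟩
    rcases y with e | ⟨t, m, b⟩
    · trivial
    · simp only at h2 ⊢
      obtain ⟨h2, h3, h4⟩ := h2
      refine ⟨?_, fun z hz D hD => ?_, h4⟩
      · rcases eq_or_ne B [] with rfl | hn
        · rcases hB with hB | hB | ⟨hv, B', t', z, hB, hB'⟩
          · simp at hB
          · simpa only [List.nil_append, hB] using h2
          -- The entry right after `x` is the removal that absorbs `x`. Its precondition speaks of
          -- vertices alone, which `x` leaves unchanged.
          · have hB2 : B' = [] := by
              have := congrArg List.length hB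
              simpa using this
            subst hB2
            simp only [List.nil_append, List.cons.injEq, Entry.lin.injEq, and_true] at hB
            obtain ⟨rfl, rfl, rfl⟩ := hB
            simp only [List.nil_append, Spec] at h2 ⊢
            refine ⟨by rw [hv]; exact h2.1, ?_⟩
            rfl
        · rw [hB'.graph_eq (D := []) rfl hn]; exact h2
      · rcases eq_or_ne B [] with rfl | hn
        · obtain ⟨E, hE⟩ := hD
          rcases E with _ | ⟨y, E⟩
          · obtain rfl : D = x :: A := hE
            rw [hB.verts_eq (by simp)]
            exact h3 z hz A List.suffix_rfl
          · simp only [List.nil_append, List.cons_append, List.cons.injEq] at hE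
            exact h3 z hz D ⟨E, hE.2⟩
        · obtain ⟨D', hD', he⟩ := hB'.verts_suffix hn hD
          rw [he]
          exact h3 z hz D' hD'

/-- The insertion point lies after, between or before the two witnessing moments. The graph at a
witnessing moment is never affected: the new entry is either placed after that moment, or separated
from it by at least one older entry of `B`, where its effect is already gone. -/
theorem Cand₂.insert {B A : Log T} {x : Entry T} (hB : Insertable B x A) {t : T}
    (hx : x.thread ≠ t) {P Q : AbsGraph → Prop} (h : Cand₂ (B ++ A) t P Q) :
    Cand₂ (B ++ x :: A) t P Q := by
  obtain ⟨C', B', A', h, hC', hB', hP, hQ⟩ := h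
  rcases append_eq_cases h with ⟨C, rfl, hA⟩ | ⟨C, hC, rfl, hA⟩
  · refine ⟨B ++ x :: C, B', A', by simp [hA], ?_, hB', hP, hQ⟩
    rw [Quiet.append] at hC'
    simp only [Quiet.append, Quiet.cons]
    exact ⟨hC'.1, hx, hC'.2⟩
  · rcases append_eq_cases hA.symm with ⟨E, rfl, hE⟩ | ⟨E, hE, rfl, rfl⟩
    · refine ⟨C', C ++ x :: E, A', by simp [hE], hC', ?_, hP, ?_⟩
      · rw [Quiet.append] at hB'
        simp only [Quiet.append, Quiet.cons]
        exact ⟨hB'.1, hx, hB'.2⟩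
      · rw [List.append_assoc, ← hE] at hQ
        have := hB.graph_eq rfl hC
        rw [← this] at hQ
        simpa [hE] using hQ
    · refine ⟨C', B', E ++ x :: A, by simp, hC', hB', ?_, ?_⟩
      · rw [hB.graph_eq (D := C' ++ B') (by simp) hE]; exact hP
      · rw [← List.append_assoc, hB.graph_eq rfl hC]; simpa using hQ

theorem cand_iff_cand₂ {L : Log T} {t : T} {P : AbsGraph → Prop} :
    Cand L t P ↔ Cand₂ L t P fun _ => True := by
  constructor
  · rintro ⟨B, A, rfl, hB, hP⟩
    exact ⟨[], B, A, rfl, Quiet.nil t, hB, hP, trivial⟩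
  · rintro ⟨C, B, A, rfl, hC, hB, hP, -⟩
    exact ⟨C ++ B, A, by simp, Quiet.append.2 ⟨hC, hB⟩, hP⟩

theorem Cand.now {L : Log T} {t : T} {P : AbsGraph → Prop} (h : P (graph L)) : Cand L t P :=
  ⟨[], L, rfl, Quiet.nil t, h⟩

theorem Cand.mono {L : Log T} {t : T} {P Q : AbsGraph → Prop} (h : Cand L t P)
    (hPQ : ∀ G, P G → Q G) : Cand L t Q := by
  obtain ⟨B, A, h1, h2, h3⟩ := h
  exact ⟨B, A, h1, h2, hPQ _ h3⟩

theorem Cand.and_now {L : Log T} {t : T} {P Q : AbsGraph → Prop} (h : Cand L t P)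
    (hQ : Q (graph L)) : Cand₂ L t P Q := by
  obtain ⟨B, A, rfl, h2, h3⟩ := h
  exact ⟨[], B, A, rfl, Quiet.nil t, h2, h3, hQ⟩

/-- The delicate case is an insertion exactly at the witnessing moment. If the new entry destroys
the edge there, it is itself the removal of an endpoint, and the old moment is now the one just
before that removal. -/
theorem EdgeEver.insert {B A : Log T} {x : Entry T} (hB : Insertable B x A) {u v : ℤ}
    (hx : (u, v) ∈ (graph A).edges →
      (u, v) ∈ (graph (x :: A)).edges ∨ B = [] ∧ x.Kills u v)
    (h : EdgeEver (B ++ A) u v) : EdgeEver (B ++ x :: A) u v := by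
  obtain ⟨B', A', h, he, hl⟩ := h
  rcases append_eq_cases h with ⟨C, rfl, rfl⟩ | ⟨C, hC, rfl, rfl⟩
  · rcases List.eq_nil_or_concat C with rfl | ⟨C', y, rfl⟩
    · rcases hx he with hx | ⟨rfl, hk⟩
      · exact ⟨B, x :: A', rfl, hx, by simpa using hl⟩
      · exact ⟨[x], A', by simp, he, .inr ⟨[], x, rfl, hk⟩⟩
    · refine ⟨B ++ x :: C'.concat y, A', by simp, he, .inr ?_⟩
      rcases hl with hl | ⟨B', r, hr, hl⟩
      · simp at hl
      · rw [List.concat_eq_append, ← List.append_assoc] at hr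
        obtain ⟨-, hr⟩ := List.append_inj' hr rfl
        obtain rfl := List.singleton_inj.1 hr
        exact ⟨B ++ x :: C', y, by simp, hl⟩
  · exact ⟨B', C ++ x :: A, by simp, by rw [hB.graph_eq rfl hC]; exact he, hl⟩

/-- If both `u` and `v` have been present, then they still are, or there is a last moment before the
removal of one of them. -/
theorem exists_kill {B A : Log T} {u v : ℤ}
    (hu : u ∈ (graph A).verts) (hv : v ∈ (graph A).verts)
    (hn : ¬ (u ∈ (graph (B ++ A)).verts ∧ v ∈ (graph (B ++ A)).verts)) :
    ∃ B' C t z, B = B' ++ .lin t (.removeVertex z) true :: C ∧ (z = u ∨ z = v) ∧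
      u ∈ (graph (C ++ A)).verts ∧ v ∈ (graph (C ++ A)).verts := by
  induction B with
  | nil => exact absurd ⟨hu, hv⟩ hn
  | cons x B ih =>
    by_cases h : u ∈ (graph (B ++ A)).verts ∧ v ∈ (graph (B ++ A)).verts
    · rcases x with e | ⟨t, m, b⟩
      · exact absurd h hn
      · cases b <;> rcases m with a | a | ⟨a, c⟩ | ⟨a, c⟩ | a | ⟨a, c⟩ <;>
          simp only [List.cons_append, graph, Method.effect] at hn <;> try exact absurd h hn
        · exact absurd ⟨.inr h.1, .inr h.2⟩ hn
        · refine ⟨[], B, t, a, rfl, ?_, h⟩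
          -- A removal of some other vertex would have left both endpoints in place.
          by_contra hc
          push Not at hc
          exact hn ⟨⟨h.1, fun h => hc.1 h.symm⟩, ⟨h.2, fun h => hc.2 h.symm⟩⟩
    · obtain ⟨B', C, t, z, rfl, h1, h2⟩ := ih h
      exact ⟨x :: B', C, t, z, rfl, h1, h2⟩

/-- Both endpoints have been alive one after the other during the call, and the edge has existed:
then the edge was present at some time during the call. -/
theorem Cand₂.edge {L : Log T} (hL : ValidLog L) {t : T} {u v a b : ℤ}
    (hab : a = u ∧ b = v ∨ a = v ∧ b = u)
    (h : Cand₂ L t (fun G => a ∈ G.verts) (fun G => b ∈ G.verts)) (he : EdgeEver L u v) :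
    Cand L t fun G => (u, v) ∈ G.edges := by
  obtain ⟨B₀, A₀, rfl, he, hl⟩ := he
  obtain ⟨C, B, A, h, hC, hB, ha, hb⟩ := h
  have hE := (hL.of_append).edges he
  rw [← List.append_assoc] at h
  rcases append_eq_cases h with ⟨D, hD, rfl⟩ | ⟨D, hD, rfl, rfl⟩
  -- The moment when the edge was present is not older than the first sighting, so it belongs to the
  -- call.
  · refine ⟨B₀, D ++ A, rfl, ?_, he⟩
    have : Quiet t (C ++ B) := Quiet.append.2 ⟨hC, hB⟩
    rw [hD, Quiet.append] at this
    exact this.1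
  -- Otherwise an endpoint was removed immediately after that moment, before the first sighting, and
  -- could not have been alive at its sighting. The endpoint `b` is sighted only later, but as it
  -- never returns, it was already alive at the first sighting.
  · exfalso
    rcases hl with hl | ⟨B', r, hr, s, z, rfl, hz⟩
    · simp_all
    have hbA : b ∈ (graph (D ++ A₀)).verts := by
      by_contra hn
      have hL' : ValidLog (B ++ (D ++ A₀)) := by
        rw [List.append_assoc, List.append_assoc] at hL
        exact hL.of_append
      refine hL'.not_mem_verts ?_ hn hb
      rcases hab with ⟨-, rfl⟩ | ⟨-, rfl⟩
      · exact hE.2.1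
      · exact hE.1
    have hzA : z ∈ (graph (D ++ A₀)).verts := by
      rcases hab with ⟨rfl, rfl⟩ | ⟨rfl, rfl⟩ <;> rcases hz with rfl | rfl <;> assumption
    obtain ⟨D', y, rfl⟩ := (List.eq_nil_or_concat D).resolve_left hD
    rw [List.concat_eq_append, ← List.append_assoc] at hr
    obtain ⟨-, hy⟩ := List.append_inj' hr rfl
    obtain rfl := List.singleton_inj.1 hy
    have hL' : ValidLog (D' ++ ([.lin s (.removeVertex z) true] ++ A₀)) := by
      have : ValidLog ((C ++ B) ++ (D' ++ ([.lin s (.removeVertex z) true] ++ A₀))) := by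
        simpa using hL
      exact this.of_append
    refine hL'.not_mem_verts (z := z) ?_ ?_ (by simpa using hzA)
    · rcases hz with rfl | rfl
      · exact hE.1
      · exact hE.2.1
    · simp [graph, Method.effect]

/-- Used to trace the key of a newly created vertex node back to an invocation in the history. -/
theorem callState_mem {t : T} {L : Log T} {m : Method} (hL : ValidLog L)
    (h : callState t L = .pend m ∨ ∃ b, callState t L = .done m b) : Event.inv t m ∈ evs L := by
  induction L with
  | nil => simp [callState] at h
  | cons x L ih =>
    have ih := ih hL.2
    have h1 := hL.1.1
    by_cases hx : x.thread = t
    · subst hx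
      simp only [callState, if_true] at h
      rcases x with (⟨s, m'⟩ | ⟨s, m', b⟩) | ⟨s, m', b⟩ <;>
        simp only [Entry.post, reduceCtorEq, CallState.pend.injEq, CallState.done.injEq,
          exists_false, or_false, false_or] at h
      · subst h; simp [evs, Entry.thread, Event.thread]
      · obtain ⟨_, rfl, rfl⟩ := h
        exact ih (.inl h1)
    · simp only [callState, hx, if_false] at h
      have := ih h
      cases x <;> simp [evs, this]

end

end ConcGraph

namespace ConcGraph

/-! ## Sorted linked lists with lazy deletion -/

/-- `Reach S next a b`: the node `b` is reached from `a` by following references of nodes in `S`. -/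
def Reach (S : ℕ → Prop) (next : ℕ → Option ℕ) : ℕ → ℕ → Prop :=
  Relation.ReflTransGen fun a b => S a ∧ next a = some b

/-- The nodes in `S` are sorted along the references, and the unmarked ones are reachable from the
head `h`. -/
structure SortedList (S : ℕ → Prop) (val : ℕ → NodeKey) (next : ℕ → Option ℕ) (mk : ℕ → Bool)
    (h : ℕ) : Prop where
  head_mem : S h
  head_val : val h = ⊥
  next_mem : ∀ x y, S x → next x = some y → S y ∧ val x < val y
  reach : ∀ z, S z → mk z = false → Reach S next h z

namespace SortedList

variable {S S' : ℕ → Prop} {val val' : ℕ → NodeKey} {next next' : ℕ → Option ℕ} {mk mk' : ℕ → Bool}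
  {h a b z x y n : ℕ}

theorem reach_val (H : SortedList S val next mk h) (ha : S a) (hr : Reach S next a z) :
    S z ∧ (a = z ∨ val a < val z) := by
  induction hr with
  | refl => exact ⟨ha, .inl rfl⟩
  | tail _ hs ih =>
    obtain ⟨h1, h2⟩ := H.next_mem _ _ hs.1 hs.2
    refine ⟨h1, .inr ?_⟩
    rcases ih.2 with rfl | h3
    · exact h2
    · exact h3.trans h2

/-- Both nodes lie on the path from the head, and this path is unique because each node has at most
one successor. -/
theorem reach_total (H : SortedList S val next mk h) (ha : S a) (hz : S z) (hma : mk a = false)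
    (hmz : mk z = false) : Reach S next a z ∨ Reach S next z a := by
  refine Relation.ReflTransGen.total_of_right_unique ?_ (H.reach a ha hma) (H.reach z hz hmz)
  intro a b c h1 h2
  exact Option.some.inj (h1.2.symm.trans h2.2)

theorem reach_of_lt (H : SortedList S val next mk h) (ha : S a) (hz : S z) (hma : mk a = false)
    (hmz : mk z = false) (hlt : val a < val z) : Reach S next a z := by
  rcases H.reach_total ha hz hma hmz with h1 | h1
  · exact h1
  · rcases (H.reach_val hz h1).2 with rfl | h2
    · exact absurd hlt (lt_irrefl _)
    · exact absurd hlt h2.asymm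

theorem eq_of_val_eq (H : SortedList S val next mk h) (ha : S a) (hz : S z) (hma : mk a = false)
    (hmz : mk z = false) (he : val a = val z) : a = z := by
  rcases H.reach_total ha hz hma hmz with h1 | h1
  · exact (H.reach_val ha h1).2.resolve_right he.not_lt
  · exact ((H.reach_val hz h1).2.resolve_right he.not_gt).symm

/-- This is how a traversal moves on without losing its target. -/
theorem reach_next (hr : Reach S next a z) (hne : a ≠ z)
    (hn : next a = some b) : Reach S next b z := by
  rcases Relation.ReflTransGen.cases_head hr with rfl | ⟨c, hc, hr⟩
  · exact absurd rfl hne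
  · obtain rfl := Option.some.inj (hc.2.symm.trans hn)
    exact hr

/-- There is no unmarked node strictly between an unmarked node and its successor. -/
theorem eq_of_between (H : SortedList S val next mk h) (ha : S a) (hma : mk a = false)
    (hn : next a = some b) (hz : S z) (hmz : mk z = false) (h1 : val a < val z)
    (h2 : val z ≤ val b) : z = b := by
  have hr := reach_next (H.reach_of_lt ha hz hma hmz h1) (by rintro rfl; exact lt_irrefl _ h1) hn
  rcases (H.reach_val (H.next_mem _ _ ha hn).1 hr).2 with rfl | h3
  · rfl
  · exact absurd h3 h2.not_gt

/-- Marking some nodes. -/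
theorem marked (H : SortedList S val next mk h) (hv : ∀ a, S a → val' a = val a)
    (hn : ∀ a, S a → next' a = next a) (hS : ∀ a, S' a ↔ S a)
    (hm : ∀ a, S a → mk' a = false → mk a = false) :
    SortedList S' val' next' mk' h ∧ (∀ a z, Reach S next a z → Reach S' next' a z) := by
  have key : ∀ a z, Reach S next a z → Reach S' next' a z := fun a z hr =>
    Relation.ReflTransGen.mono (fun x _ hxy => ⟨(hS x).2 hxy.1, (hn x hxy.1).trans hxy.2⟩) a z hr
  refine ⟨⟨(hS _).2 H.head_mem, ?_, ?_, ?_⟩, key⟩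
  · rw [hv _ H.head_mem, H.head_val]
  · intro x y hx hxy
    rw [hS] at hx
    rw [hn _ hx] at hxy
    obtain ⟨h1, h2⟩ := H.next_mem _ _ hx hxy
    exact ⟨(hS _).2 h1, by rwa [hv _ hx, hv _ h1]⟩
  · intro z hz hmz
    rw [hS] at hz
    exact key _ _ (H.reach z hz (hm z hz hmz))

/-- Linking the new node `n` between `x` and `y`. -/
theorem linked (H : SortedList S val next mk h) (hv : ∀ a, S a → val' a = val a)
    (hS : ∀ a, S' a ↔ S a ∨ a = n) (hx : S x) (hmx : mk x = false) (hxy : next x = some y)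
    (hnS : ¬ S n) (hn : ∀ a, S a → a ≠ x → next' a = next a)
    (hx' : next' x = some n) (hn' : next' n = some y) (h1 : val x < val' n) (h2 : val' n < val y)
    (hm : ∀ a, S a → mk' a = mk a) :
    SortedList S' val' next' mk' h ∧ (∀ a z, Reach S next a z → Reach S' next' a z) := by
  have key : ∀ a z, Reach S next a z → Reach S' next' a z := by
    -- Every old edge survives, except that the edge from `x` to `y` becomes a path of two edges
    -- through `n`.
    refine fun a z hr => Relation.reflTransGen_closed (fun a b hab => ?_) a z hr
    rcases eq_or_ne a x with rfl | hax
    · obtain rfl := Option.some.inj (hab.2.symm.trans hxy)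
      exact (Relation.ReflTransGen.single ⟨(hS _).2 (.inl hx), hx'⟩).tail
        ⟨(hS _).2 (.inr rfl), hn'⟩
    · exact .single ⟨(hS _).2 (.inl hab.1), (hn a hab.1 hax).trans hab.2⟩
  have hy := H.next_mem _ _ hx hxy
  refine ⟨⟨(hS _).2 (.inl H.head_mem), ?_, ?_, ?_⟩, key⟩
  · rw [hv _ H.head_mem, H.head_val]
  · intro a b ha hab
    rcases (hS a).1 ha with ha | rfl
    · rcases eq_or_ne a x with rfl | hax
      · obtain rfl := Option.some.inj (hx'.symm.trans hab)
        exact ⟨(hS _).2 (.inr rfl), by rwa [hv _ ha]⟩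
      · rw [hn a ha hax] at hab
        have := H.next_mem _ _ ha hab
        exact ⟨(hS _).2 (.inl this.1), by rw [hv _ ha, hv _ this.1]; exact this.2⟩
    · obtain rfl := Option.some.inj (hn'.symm.trans hab)
      exact ⟨(hS _).2 (.inl hy.1), by rwa [hv _ hy.1]⟩
  · intro z hz hmz
    rcases (hS z).1 hz with hz | rfl
    · exact key _ _ (H.reach z hz (by rwa [← hm z hz]))
    · exact (key _ _ (H.reach x hx hmx)).tail ⟨(hS _).2 (.inl hx), hx'⟩

/-- Unlinking the marked node `y` behind `x`. -/
theorem unlinked (H : SortedList S val next mk h) (hv : ∀ a, S a → val' a = val a)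
    (hS : ∀ a, S' a ↔ S a) (hx : S x) (hxy : next x = some y) (hmy : mk y = true)
    (hn : ∀ a, S a → a ≠ x → next' a = next a) (hx' : next' x = next y)
    (hm : ∀ a, S a → mk' a = mk a) :
    SortedList S' val' next' mk' h ∧
      (∀ a z, mk z = false → Reach S next a z → Reach S' next' a z) := by
  have hy := H.next_mem _ _ hx hxy
  have hyx : y ≠ x := by rintro rfl; exact lt_irrefl _ hy.2
  have key : ∀ a z, mk z = false → Reach S next a z → Reach S' next' a z := by
    intro a z hz hr
    have hzy : y ≠ z := by rintro rfl; simp [hz] at hmy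
    induction hr using Relation.ReflTransGen.head_induction_on with
    | refl => exact .refl
    | @head a b hab hr ih =>
      rcases eq_or_ne a x with rfl | hax
      · obtain rfl := Option.some.inj (hab.2.symm.trans hxy)
        -- A path through `x` used to continue with `y`. The target is unmarked, hence not `y`, so
        -- the path goes on to the successor of `y`, to which `x` now points directly.
        rcases Relation.ReflTransGen.cases_head ih with rfl | ⟨c, hc, hr'⟩
        · exact absurd rfl hzy
        · rw [hn b hy.1 hyx, ← hx'] at hc
          exact .head ⟨(hS _).2 hx, hc.2⟩ hr'
      · exact .head ⟨(hS _).2 hab.1, (hn a hab.1 hax).trans hab.2⟩ ih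
  refine ⟨⟨(hS _).2 H.head_mem, ?_, ?_, ?_⟩, key⟩
  · rw [hv _ H.head_mem, H.head_val]
  · intro a b ha hab
    rw [hS] at ha
    rcases eq_or_ne a x with rfl | hax
    · rw [hx'] at hab
      have := H.next_mem _ _ hy.1 hab
      exact ⟨(hS _).2 this.1, by rw [hv _ ha, hv _ this.1]; exact hy.2.trans this.2⟩
    · rw [hn a ha hax] at hab
      have := H.next_mem _ _ ha hab
      exact ⟨(hS _).2 this.1, by rw [hv _ ha, hv _ this.1]; exact this.2⟩
  · intro z hz hmz
    rw [hS] at hz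
    rw [hm z hz] at hmz
    exact key _ _ hmz (H.reach z hz hmz)

end SortedList

end ConcGraph

namespace ConcGraph

variable {T : Type*}

/-! ## Instrumented states -/

/-- The status of a vertex node: unallocated, known to its creator only, or linked into the vertex
list at some time. -/
inductive VStat (T : Type*) where
  | free
  | priv (t : T)
  | linked

/-- The status of an edge node; a linked node has been linked into the edge list of a vertex
node. -/
inductive EStat (T : Type*) where
  | free
  | priv (t : T)
  | linked (w : VRef)

/-- The shared memory with the log and the status of the nodes. -/
structure State (T : Type*) where
  mem : Mem T
  log : Log T
  vs : VRef → VStat T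
  es : ERef → EStat T

namespace State

abbrev vval (σ : State T) (v : VRef) : NodeKey := (σ.mem.vnode v).val
abbrev vnxt (σ : State T) (v : VRef) : Option VRef := (σ.mem.vnode v).vnext
abbrev vmk (σ : State T) (v : VRef) : Bool := (σ.mem.vnode v).marked
abbrev vlk (σ : State T) (v : VRef) : Option T := (σ.mem.vnode v).lock
abbrev vhd (σ : State T) (v : VRef) : ERef := (σ.mem.vnode v).edgeHead
abbrev enval (σ : State T) (e : ERef) : NodeKey := (σ.mem.enode e).val
abbrev enxt (σ : State T) (e : ERef) : Option ERef := (σ.mem.enode e).enext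
abbrev emk (σ : State T) (e : ERef) : Bool := (σ.mem.enode e).marked
abbrev elk (σ : State T) (e : ERef) : Option T := (σ.mem.enode e).lock

abbrev VReach (σ : State T) : VRef → VRef → Prop :=
  Reach (fun v => σ.vs v = .linked) σ.vnxt

abbrev EReach (σ : State T) (w : VRef) : ERef → ERef → Prop :=
  Reach (fun e => σ.es e = .linked w) σ.enxt

variable [DecidableEq T]

/-- The global invariant. -/
structure Inv (σ : State T) : Prop where
  valid : ValidLog σ.log
  vfree : ∀ v, σ.vs v = .free ↔ σ.mem.vcount ≤ v
  efree : ∀ e, σ.es e = .free ↔ σ.mem.ecount ≤ e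
  eowner : ∀ e w, σ.es e = .linked w → σ.vs w ≠ .free
  -- Keys are unique among all allocated vertex nodes, including marked ones and those not linked
  -- yet. This is where the uniqueness hypothesis is stored; `vsrc` is what allows it to be
  -- re-established at each `AddVertex`.
  vkey : ∀ x y, σ.vs x ≠ .free → σ.vs y ≠ .free → σ.vval x = σ.vval y → x = y
  vsrc : ∀ x k, σ.vs x ≠ .free → σ.vval x = toKey k → ∃ t, .inv t (.addVertex k) ∈ evs σ.log
  vlist : SortedList (fun v => σ.vs v = .linked) σ.vval σ.vnxt σ.vmk vertexHead
  elist : ∀ w, σ.vs w ≠ .free →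
    SortedList (fun e => σ.es e = .linked w) σ.enval σ.enxt σ.emk (σ.vhd w)
  verts : ∀ z, z ∈ (graph σ.log).verts ↔
    ∃ x, σ.vs x = .linked ∧ σ.vmk x = false ∧ σ.vval x = toKey z
  ever : ∀ A, A <:+ σ.log → ∀ z ∈ (graph A).verts, ∃ x, σ.vs x = .linked ∧ σ.vval x = toKey z
  -- Memory and abstract edges are related by two weaker clauses instead of an equivalence: an
  -- unmarked edge node may outlive its abstract edge once an endpoint is removed, but each abstract
  -- edge has an unmarked node.
  edge_ever : ∀ x e u v, σ.es e = .linked x → σ.emk e = false → σ.vval x = toKey u →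
    σ.enval e = toKey v → EdgeEver σ.log u v
  edge_mem : ∀ u v, (u, v) ∈ (graph σ.log).edges → ∃ x e, σ.vs x = .linked ∧
    σ.vval x = toKey u ∧ σ.es e = .linked x ∧ σ.emk e = false ∧ σ.enval e = toKey v

/-- A traversal of the vertex list that looks for `k` is at `v`: all is well if `k` was absent at
some time during the call, or if the node of `k` can be reached from `v`. -/
def TravV (σ : State T) (t : T) (k : ℤ) (v : VRef) : Prop :=
  Cand σ.log t (fun G => k ∉ G.verts) ∨
    ∀ z, σ.vs z = .linked → σ.vmk z = false → σ.vval z = toKey k → σ.VReach v z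

/-- The analogue of `TravV` for the edge list of the node `w` of the vertex `u`. -/
def TravE (σ : State T) (t : T) (w : VRef) (u k : ℤ) (e : ERef) : Prop :=
  Cand σ.log t (fun G => (u, k) ∉ G.edges) ∨
    ∀ z, σ.es z = .linked w → σ.emk z = false → σ.enval z = toKey k → σ.EReach w e z

/-- What a thread `t` that executes `m` may rely on when other threads move. -/
structure Rely (t : T) (m : Method) (σ σ' : State T) : Prop where
  call : callState t σ'.log = callState t σ.log
  cand₂ : ∀ P Q, Cand₂ σ.log t P Q → Cand₂ σ'.log t P Q
  vlinked : ∀ v, σ.vs v = .linked → σ'.vs v = .linked ∧ σ'.vval v = σ.vval v ∧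
    (σ.vmk v = true → σ'.vmk v = true) ∧
    (σ.vlk v = some t → σ'.vlk v = some t ∧ σ'.vmk v = σ.vmk v ∧ σ'.vnxt v = σ.vnxt v)
  elinked : ∀ e w, σ.es e = .linked w → σ'.es e = .linked w ∧ σ'.enval e = σ.enval e ∧
    (σ.emk e = true → σ'.emk e = true) ∧
    (σ.elk e = some t → σ'.elk e = some t ∧ σ'.emk e = σ.emk e ∧ σ'.enxt e = σ.enxt e)
  vpriv : ∀ v, σ.vs v = .priv t → σ'.vs v = .priv t ∧ σ'.mem.vnode v = σ.mem.vnode v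
  epriv : ∀ e, σ.es e = .priv t → σ'.es e = .priv t ∧ σ'.mem.enode e = σ.mem.enode e
  fresh : ∀ k, m = .addVertex k → (∀ x, σ.vs x ≠ .free → σ.vval x ≠ toKey k) →
    ∀ x, σ'.vs x ≠ .free → σ'.vval x ≠ toKey k
  travV : ∀ k v, σ.vs v = .linked → σ.TravV t k v → σ'.TravV t k v
  travE : ∀ w u k e, σ.vs w = .linked → σ.vval w = toKey u → σ.es e = .linked w →
    σ.TravE t w u k e → σ'.TravE t w u k e

/-- A step of the thread `t` that executes `m` preserves the invariant, the history, and what the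
other threads rely on. -/
structure Guar (t : T) (m : Method) (σ σ' : State T) : Prop where
  inv : σ'.Inv
  evs : evs σ'.log = evs σ.log
  -- The second condition excludes two concurrent `AddVertex` calls with one key: creating the node
  -- would break the freshness on which the other call relies.
  rely : ∀ t' m', t' ≠ t → (∀ k, m = .addVertex k → m' ≠ .addVertex k) → Rely t' m' σ σ'

/-! ## Assertions at the program points -/

def V (σ : State T) (v : VRef) (P : NodeKey → Prop) : Prop := σ.vs v = .linked ∧ P (σ.vval v)

/-- The node `v` is locked by `t`. -/
def VL (σ : State T) (t : T) (v : VRef) (Q : Bool → Option VRef → Prop) : Prop :=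
  σ.vs v = .linked ∧ σ.vlk v = some t ∧ Q (σ.vmk v) (σ.vnxt v)

def VP (σ : State T) (t : T) (v : VRef) (Q : NodeKey → Bool → Option VRef → Prop) : Prop :=
  σ.vs v = .priv t ∧ Q (σ.vval v) (σ.vmk v) (σ.vnxt v)

def E (σ : State T) (w : VRef) (e : ERef) (P : NodeKey → Prop) : Prop :=
  σ.es e = .linked w ∧ P (σ.enval e)

/-- The node `e` is locked by `t`. -/
def EL (σ : State T) (t : T) (w : VRef) (e : ERef) (Q : Bool → Option ERef → Prop) : Prop :=
  σ.es e = .linked w ∧ σ.elk e = some t ∧ Q (σ.emk e) (σ.enxt e)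

def EP (σ : State T) (t : T) (e : ERef) (Q : NodeKey → Bool → Option ERef → Prop) : Prop :=
  σ.es e = .priv t ∧ Q (σ.enval e) (σ.emk e) (σ.enxt e)

/-- The vertex `k` has been removed. -/
def Dead (σ : State T) (k : ℤ) : Prop :=
  ∃ v, σ.vs v = .linked ∧ σ.vmk v = true ∧ σ.vval v = toKey k

def Marked (σ : State T) (v : VRef) : Prop := σ.vs v = .linked ∧ σ.vmk v = true

def Call (σ : State T) (t : T) (c : CallState) : Prop := callState t σ.log = c

def Fresh (σ : State T) (m : Method) : Prop :=
  ∀ k, m = .addVertex k → ∀ x, σ.vs x ≠ .free → σ.vval x ≠ toKey k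

/-- A vertex method before its linearization point. -/
def VPre (σ : State T) (t : T) (m : Method) : Prop :=
  σ.Call t (.pend m) ∧ σ.Fresh m ∧ (m = .addVertex m.key₁ ∨ m = .removeVertex m.key₁)

/-- A validated window of the vertex list. -/
def VWin (σ : State T) (t : T) (m : Method) (v₁ v₂ : VRef) : Prop :=
  σ.V v₁ (· < toKey m.key₁) ∧ σ.V v₂ (toKey m.key₁ ≤ ·) ∧
    σ.VL t v₁ (fun mk nx => mk = false ∧ nx = some v₂) ∧ σ.VL t v₂ (fun mk _ => mk = false)

/-- A validated window of the edge list of `w`. -/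
def EWin (σ : State T) (t : T) (m : Method) (w : VRef) (e₁ e₂ : ERef) : Prop :=
  σ.E w e₁ (· < toKey m.ekey) ∧ σ.E w e₂ (toKey m.ekey ≤ ·) ∧
    σ.EL t w e₁ (fun mk nx => mk = false ∧ nx = some e₂) ∧ σ.EL t w e₂ (fun mk _ => mk = false)

/-- `RemoveVertex` has already taken effect here. What remains is cleaning up, which is invisible in
the abstract graph because the key is dead. -/
def Scan (σ : State T) (t : T) (m : Method) : Prop :=
  σ.Call t (.done m true) ∧ m = .removeVertex m.ekey ∧ σ.Dead m.ekey

def XA (σ : State T) (t : T) (m : Method) : VExit → Prop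
  | .retry => σ.VPre t m
  | .ret b => σ.Call t (.done m b)
  | .scan => σ.Scan t m

/-- The update of an edge list by `AddEdge` or `RemoveEdge` before its linearization point. -/
def EPre (σ : State T) (t : T) (m : Method) (w : VRef) : Prop :=
  σ.Call t (.pend m) ∧ (m = .addEdge m.key₁ m.ekey ∨ m = .removeEdge m.key₁ m.ekey) ∧
    m.key₁ ≠ m.ekey ∧ σ.V w (· = toKey m.key₁) ∧
    Cand σ.log t (fun G => m.key₁ ∈ G.verts ∧ m.ekey ∈ G.verts)

/-- The code that locates an edge node is shared: it serves an edge method before its linearization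
point and a `RemoveVertex` after it. -/
def EOp (σ : State T) (t : T) (m : Method) (w : VRef) : Prop :=
  σ.EPre t m w ∨ σ.Scan t m ∧ σ.V w (fun _ => True)

def EDone (σ : State T) (t : T) (m : Method) (w : VRef) : Prop :=
  σ.Call t (.done m true) ∧ σ.V w (fun _ => True) ∧
    ((m = .addEdge m.key₁ m.ekey ∨ m = .removeEdge m.key₁ m.ekey) ∨ σ.Scan t m)

/-- Distinct keys are available for the update methods only; `ContainsEdge` may be asked for a
self-loop. -/
def HPre (σ : State T) (t : T) (m : Method) : Prop :=
  σ.Call t (.pend m) ∧ ((m = .addEdge m.key₁ m.ekey ∨ m = .removeEdge m.key₁ m.ekey) ∧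
    m.key₁ ≠ m.ekey ∨ m = .containsEdge m.key₁ m.ekey)

/-- The traversal for the second key, which starts at the node `x` of the first key. -/
def HSnd (σ : State T) (t : T) (m : Method) (x : VRef) : Prop :=
  σ.HPre t m ∧ σ.V x (· = toKey m.fstKey) ∧ Cand σ.log t (fun G => m.fstKey ∈ G.verts)

/-- The second traversal is at `y`. -/
def HTrav (σ : State T) (t : T) (m : Method) (y : VRef) (P : NodeKey → Prop) : Prop :=
  σ.V y P ∧ (m.fstKey < m.sndKey → σ.TravV t m.sndKey y)

def LPre (σ : State T) (t : T) (m : Method) (v₁ v₂ : VRef) : Prop :=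
  σ.Call t (.pend m) ∧ (m = .addEdge m.key₁ m.ekey ∨ m = .removeEdge m.key₁ m.ekey) ∧
    m.key₁ ≠ m.ekey ∧ σ.V v₁ (· = toKey m.key₁) ∧ σ.V v₂ (· = toKey m.ekey)

/-- `HelpSearchEdge` sees the two endpoints alive at different times, which is too weak for an
update. When the first mark is reread as unset, either the other node is unmarked as well, so that
both keys are present at once, or it is marked for good and the next check fails. -/
def LCheck (σ : State T) (t : T) (m : Method) (v₂ : VRef) : Prop :=
  σ.Marked v₂ ∨ Cand σ.log t (fun G => m.key₁ ∈ G.verts ∧ m.ekey ∈ G.verts)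

def CVPre (σ : State T) (t : T) (m : Method) : Prop :=
  σ.Call t (.pend m) ∧ m = .containsVertex m.key₁

/-- `ContainsEdge` does not recheck the marks, so the endpoints are known to be alive only one after
the other. -/
def CEPre (σ : State T) (t : T) (m : Method) : Prop :=
  σ.Call t (.pend m) ∧ m = .containsEdge m.key₁ m.ekey ∧
    Cand₂ σ.log t (fun G => m.fstKey ∈ G.verts) (fun G => m.sndKey ∈ G.verts)

/-- A traversal of an edge list by `ContainsEdge`. -/
def CTrav (σ : State T) (t : T) (m : Method) (e : ERef) (P : NodeKey → Prop) : Prop :=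
  ∃ w, σ.V w (· = toKey m.key₁) ∧ σ.E w e P ∧ σ.TravE t w m.key₁ m.ekey e

/-- A traversal of the vertex list that looks for `k`. -/
def VTrav (σ : State T) (t : T) (k : ℤ) (v : VRef) (P : NodeKey → Prop) : Prop :=
  σ.V v P ∧ σ.TravV t k v

/-- The assertion at a program point of a thread `t` that executes `m`. -/
def At (σ : State T) (t : T) (m : Method) : Pc → Prop
  | .lvHead => σ.VPre t m
  | .lvNext v₁ => σ.VPre t m ∧ σ.V v₁ (· < toKey m.key₁)
  | .lvTest v₁ v₂ => σ.VPre t m ∧ σ.V v₁ (· < toKey m.key₁) ∧ σ.V v₂ (fun _ => True)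
  | .lvLock1 v₁ v₂ => σ.VPre t m ∧ σ.V v₁ (· < toKey m.key₁) ∧ σ.V v₂ (toKey m.key₁ ≤ ·)
  | .lvLock2 v₁ v₂ => σ.VPre t m ∧ σ.V v₁ (· < toKey m.key₁) ∧ σ.V v₂ (toKey m.key₁ ≤ ·) ∧
      σ.VL t v₁ (fun _ _ => True)
  | .lvValid1 v₁ v₂ => σ.VPre t m ∧ σ.V v₁ (· < toKey m.key₁) ∧ σ.V v₂ (toKey m.key₁ ≤ ·) ∧
      σ.VL t v₁ (fun _ _ => True) ∧ σ.VL t v₂ (fun _ _ => True)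
  | .lvValid2 v₁ v₂ => σ.VPre t m ∧ σ.V v₁ (· < toKey m.key₁) ∧ σ.V v₂ (toKey m.key₁ ≤ ·) ∧
      σ.VL t v₁ (fun mk _ => mk = false) ∧ σ.VL t v₂ (fun _ _ => True)
  | .lvValid3 v₁ v₂ => σ.VPre t m ∧ σ.V v₁ (· < toKey m.key₁) ∧ σ.V v₂ (toKey m.key₁ ≤ ·) ∧
      σ.VL t v₁ (fun mk _ => mk = false) ∧ σ.VL t v₂ (fun mk _ => mk = false)
  | .vTest v₁ v₂ => σ.VPre t m ∧ σ.VWin t m v₁ v₂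
  | .avNew v₁ v₂ => σ.VPre t m ∧ m = .addVertex m.key₁ ∧ σ.VWin t m v₁ v₂
  -- From here on `VPre` is no longer available: its freshness clause fails once the node with this
  -- key exists.
  | .avSet v₁ v₂ v₃ => σ.Call t (.pend m) ∧ m = .addVertex m.key₁ ∧ σ.VWin t m v₁ v₂ ∧
      σ.V v₂ (toKey m.key₁ < ·) ∧ σ.VP t v₃ (fun k mk _ => k = toKey m.key₁ ∧ mk = false)
  | .avLink v₁ v₂ v₃ => σ.Call t (.pend m) ∧ m = .addVertex m.key₁ ∧ σ.VWin t m v₁ v₂ ∧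
      σ.V v₂ (toKey m.key₁ < ·) ∧
      σ.VP t v₃ (fun k mk nx => k = toKey m.key₁ ∧ mk = false ∧ nx = some v₂)
  | .rvMark v₁ v₂ => σ.Call t (.pend m) ∧ m = .removeVertex m.key₁ ∧ σ.VWin t m v₁ v₂ ∧
      σ.V v₂ (· = toKey m.key₁)
  | .rvRead v₁ v₂ => σ.Scan t m ∧ v₁ ≠ v₂ ∧
      σ.VL t v₁ (fun mk nx => mk = false ∧ nx = some v₂) ∧ σ.VL t v₂ (fun mk _ => mk = true)
  | .rvUnlink v₁ v₂ w => σ.Scan t m ∧ v₁ ≠ v₂ ∧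
      σ.VL t v₁ (fun mk nx => mk = false ∧ nx = some v₂) ∧
      σ.VL t v₂ (fun mk nx => mk = true ∧ nx = w)
  | .vRel1 v₁ v₂ x => σ.XA t m x ∧ v₁ ≠ v₂ ∧ σ.VL t v₁ (fun _ _ => True) ∧
      σ.VL t v₂ (fun _ _ => True)
  | .vRel2 v₂ x => σ.XA t m x ∧ σ.VL t v₂ (fun _ _ => True)
  | .riHead => σ.Scan t m
  | .riTest v => σ.Scan t m ∧ σ.V v (fun _ => True)
  | .riNext v => σ.Scan t m ∧ σ.V v (fun _ => True)
  | .hsHead => σ.HPre t m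
  | .hsTest1 x => σ.HPre t m ∧ σ.VTrav t m.fstKey x (fun _ => True)
  | .hsNext1 x => σ.HPre t m ∧ σ.VTrav t m.fstKey x (· < toKey m.fstKey)
  | .hsVal1 x => σ.HPre t m ∧ σ.VTrav t m.fstKey x (toKey m.fstKey ≤ ·)
  | .hsMark1 x => σ.HPre t m ∧ σ.VTrav t m.fstKey x (· = toKey m.fstKey)
  -- If the two keys are equal, the second traversal starts behind the node of that key and cannot
  -- find it. The claims about the second key are therefore conditional on the keys being different.
  | .hsNext2 x y => σ.HSnd t m x ∧
      σ.HTrav t m y (fun k => toKey m.fstKey ≤ k ∧ (m.fstKey < m.sndKey → k < toKey m.sndKey))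
  | .hsTest2 x y => σ.HSnd t m x ∧ σ.HTrav t m y (toKey m.fstKey < ·)
  | .hsVal2 x y => σ.HSnd t m x ∧
      σ.HTrav t m y (fun k => toKey m.fstKey < k ∧ toKey m.sndKey ≤ k)
  | .hsMark2 x y => σ.HSnd t m x ∧ m.fstKey < m.sndKey ∧
      σ.HTrav t m y (fun k => k = toKey m.sndKey)
  | .leMark1 v₁ v₂ => σ.LPre t m v₁ v₂
  | .leMark2 v₁ v₂ => σ.LPre t m v₁ v₂ ∧ σ.LCheck t m v₂
  | .leHead w => σ.EOp t m w
  | .leNext w e₁ => σ.EOp t m w ∧ σ.E w e₁ (· < toKey m.ekey)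
  | .leTest w e₁ e₂ => σ.EOp t m w ∧ σ.E w e₁ (· < toKey m.ekey) ∧ σ.E w e₂ (fun _ => True)
  | .leLock1 w e₁ e₂ => σ.EOp t m w ∧ σ.E w e₁ (· < toKey m.ekey) ∧ σ.E w e₂ (toKey m.ekey ≤ ·)
  | .leLock2 w e₁ e₂ => σ.EOp t m w ∧ σ.E w e₁ (· < toKey m.ekey) ∧
      σ.E w e₂ (toKey m.ekey ≤ ·) ∧ σ.EL t w e₁ (fun _ _ => True)
  | .leValid1 w e₁ e₂ => σ.EOp t m w ∧ σ.E w e₁ (· < toKey m.ekey) ∧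
      σ.E w e₂ (toKey m.ekey ≤ ·) ∧ σ.EL t w e₁ (fun _ _ => True) ∧ σ.EL t w e₂ (fun _ _ => True)
  | .leValid2 w e₁ e₂ => σ.EOp t m w ∧ σ.E w e₁ (· < toKey m.ekey) ∧
      σ.E w e₂ (toKey m.ekey ≤ ·) ∧ σ.EL t w e₁ (fun mk _ => mk = false) ∧
      σ.EL t w e₂ (fun _ _ => True)
  | .leValid3 w e₁ e₂ => σ.EOp t m w ∧ σ.E w e₁ (· < toKey m.ekey) ∧
      σ.E w e₂ (toKey m.ekey ≤ ·) ∧ σ.EL t w e₁ (fun mk _ => mk = false) ∧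
      σ.EL t w e₂ (fun mk _ => mk = false)
  | .eTest w e₁ e₂ => σ.EOp t m w ∧ σ.EWin t m w e₁ e₂
  | .aeNew w e₁ e₂ => σ.EPre t m w ∧ m = .addEdge m.key₁ m.ekey ∧ σ.EWin t m w e₁ e₂ ∧
      σ.E w e₂ (toKey m.ekey < ·)
  | .aeSet w e₁ e₂ e₃ => σ.EPre t m w ∧ m = .addEdge m.key₁ m.ekey ∧ σ.EWin t m w e₁ e₂ ∧
      σ.E w e₂ (toKey m.ekey < ·) ∧ σ.EP t e₃ (fun k mk _ => k = toKey m.ekey ∧ mk = false)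
  | .aeLink w e₁ e₂ e₃ => σ.EPre t m w ∧ m = .addEdge m.key₁ m.ekey ∧ σ.EWin t m w e₁ e₂ ∧
      σ.E w e₂ (toKey m.ekey < ·) ∧
      σ.EP t e₃ (fun k mk nx => k = toKey m.ekey ∧ mk = false ∧ nx = some e₂)
  | .reMark w e₁ e₂ => σ.EOp t m w ∧ m ≠ .addEdge m.key₁ m.ekey ∧ σ.EWin t m w e₁ e₂ ∧
      σ.E w e₂ (· = toKey m.ekey)
  | .reRead w e₁ e₂ => σ.EDone t m w ∧ e₁ ≠ e₂ ∧
      σ.EL t w e₁ (fun mk nx => mk = false ∧ nx = some e₂) ∧ σ.EL t w e₂ (fun mk _ => mk = true)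
  | .reUnlink w e₁ e₂ f => σ.EDone t m w ∧ e₁ ≠ e₂ ∧
      σ.EL t w e₁ (fun mk nx => mk = false ∧ nx = some e₂) ∧
      σ.EL t w e₂ (fun mk nx => mk = true ∧ nx = f)
  | .eRel1 w e₁ e₂ d => (d = false → σ.EOp t m w) ∧ (d = true → σ.EDone t m w) ∧ e₁ ≠ e₂ ∧
      σ.EL t w e₁ (fun _ _ => True) ∧ σ.EL t w e₂ (fun _ _ => True)
  | .eRel2 w e₂ d => (d = false → σ.EOp t m w) ∧ (d = true → σ.EDone t m w) ∧
      σ.EL t w e₂ (fun _ _ => True)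
  | .cvHead => σ.CVPre t m
  | .cvTest v => σ.CVPre t m ∧ σ.VTrav t m.key₁ v (fun _ => True)
  | .cvNext v => σ.CVPre t m ∧ σ.VTrav t m.key₁ v (· < toKey m.key₁)
  | .cvVal v => σ.CVPre t m ∧ σ.VTrav t m.key₁ v (toKey m.key₁ ≤ ·)
  | .cvMark v => σ.CVPre t m ∧ σ.VTrav t m.key₁ v (· = toKey m.key₁)
  | .ceHead v₁ => σ.CEPre t m ∧ σ.V v₁ (· = toKey m.key₁)
  | .ceTest e => σ.CEPre t m ∧ σ.CTrav t m e (fun _ => True)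
  | .ceNext e => σ.CEPre t m ∧ σ.CTrav t m e (· < toKey m.ekey)
  | .ceVal e => σ.CEPre t m ∧ σ.CTrav t m e (toKey m.ekey ≤ ·)
  | .ceMark e => σ.CEPre t m ∧ σ.CTrav t m e (· = toKey m.ekey)
  | .ret b => σ.Call t (.done m b)

/-! ## Stability of the assertions -/

section Stability

variable {t : T} {m : Method} {σ σ' : State T}

theorem Rely.cand (R : Rely t m σ σ') {P : AbsGraph → Prop} (h : Cand σ.log t P) :
    Cand σ'.log t P := by
  rw [cand_iff_cand₂] at h ⊢
  exact R.cand₂ _ _ h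

theorem V.rely (R : Rely t m σ σ') {v : VRef} {P : NodeKey → Prop} (h : σ.V v P) : σ'.V v P := by
  have := R.vlinked v h.1
  exact ⟨this.1, by rw [this.2.1]; exact h.2⟩

theorem VL.rely (R : Rely t m σ σ') {v : VRef} {Q : Bool → Option VRef → Prop}
    (h : σ.VL t v Q) : σ'.VL t v Q := by
  have := R.vlinked v h.1
  have h2 := this.2.2.2 h.2.1
  exact ⟨this.1, h2.1, by rw [h2.2.1, h2.2.2]; exact h.2.2⟩

theorem VP.rely (R : Rely t m σ σ') {v : VRef} {Q : NodeKey → Bool → Option VRef → Prop}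
    (h : σ.VP t v Q) : σ'.VP t v Q := by
  have := R.vpriv v h.1
  exact ⟨this.1, by simpa only [vval, vmk, vnxt, this.2] using h.2⟩

theorem E.rely (R : Rely t m σ σ') {w : VRef} {e : ERef} {P : NodeKey → Prop} (h : σ.E w e P) :
    σ'.E w e P := by
  have := R.elinked e w h.1
  exact ⟨this.1, by rw [this.2.1]; exact h.2⟩

theorem EL.rely (R : Rely t m σ σ') {w : VRef} {e : ERef} {Q : Bool → Option ERef → Prop}
    (h : σ.EL t w e Q) : σ'.EL t w e Q := by
  have := R.elinked e w h.1
  have h2 := this.2.2.2 h.2.1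
  exact ⟨this.1, h2.1, by rw [h2.2.1, h2.2.2]; exact h.2.2⟩

theorem EP.rely (R : Rely t m σ σ') {e : ERef} {Q : NodeKey → Bool → Option ERef → Prop}
    (h : σ.EP t e Q) : σ'.EP t e Q := by
  have := R.epriv e h.1
  exact ⟨this.1, by simpa only [enval, emk, enxt, this.2] using h.2⟩

theorem Marked.rely (R : Rely t m σ σ') {v : VRef} (h : σ.Marked v) : σ'.Marked v :=
  ⟨(R.vlinked v h.1).1, (R.vlinked v h.1).2.2.1 h.2⟩

theorem Dead.rely (R : Rely t m σ σ') {k : ℤ} (h : σ.Dead k) : σ'.Dead k := by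
  obtain ⟨v, h1, h2, h3⟩ := h
  have := R.vlinked v h1
  exact ⟨v, this.1, this.2.2.1 h2, by rw [this.2.1]; exact h3⟩

theorem Call.rely (R : Rely t m σ σ') {c : CallState} (h : σ.Call t c) : σ'.Call t c :=
  R.call.trans h

theorem VPre.rely (R : Rely t m σ σ') (h : σ.VPre t m) : σ'.VPre t m :=
  ⟨h.1.rely R, fun k hk => R.fresh k hk (h.2.1 k hk), h.2.2⟩

theorem VWin.rely (R : Rely t m σ σ') {v₁ v₂ : VRef} (h : σ.VWin t m v₁ v₂) :
    σ'.VWin t m v₁ v₂ :=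
  ⟨h.1.rely R, h.2.1.rely R, h.2.2.1.rely R, h.2.2.2.rely R⟩

theorem EWin.rely (R : Rely t m σ σ') {w : VRef} {e₁ e₂ : ERef} (h : σ.EWin t m w e₁ e₂) :
    σ'.EWin t m w e₁ e₂ :=
  ⟨h.1.rely R, h.2.1.rely R, h.2.2.1.rely R, h.2.2.2.rely R⟩

theorem Scan.rely (R : Rely t m σ σ') (h : σ.Scan t m) : σ'.Scan t m :=
  ⟨h.1.rely R, h.2.1, h.2.2.rely R⟩

theorem XA.rely (R : Rely t m σ σ') {x : VExit} (h : σ.XA t m x) : σ'.XA t m x := by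
  cases x
  · exact VPre.rely R h
  · exact Call.rely R h
  · exact Scan.rely R h

theorem EPre.rely (R : Rely t m σ σ') {w : VRef} (h : σ.EPre t m w) : σ'.EPre t m w :=
  ⟨h.1.rely R, h.2.1, h.2.2.1, h.2.2.2.1.rely R, R.cand h.2.2.2.2⟩

theorem EOp.rely (R : Rely t m σ σ') {w : VRef} (h : σ.EOp t m w) : σ'.EOp t m w :=
  h.imp (·.rely R) fun h => ⟨h.1.rely R, h.2.rely R⟩

theorem EDone.rely (R : Rely t m σ σ') {w : VRef} (h : σ.EDone t m w) : σ'.EDone t m w :=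
  ⟨h.1.rely R, h.2.1.rely R, h.2.2.imp_right (·.rely R)⟩

theorem HPre.rely (R : Rely t m σ σ') (h : σ.HPre t m) : σ'.HPre t m :=
  ⟨h.1.rely R, h.2⟩

theorem HSnd.rely (R : Rely t m σ σ') {x : VRef} (h : σ.HSnd t m x) : σ'.HSnd t m x :=
  ⟨h.1.rely R, h.2.1.rely R, R.cand h.2.2⟩

theorem HTrav.rely (R : Rely t m σ σ') {y : VRef} {P : NodeKey → Prop} (h : σ.HTrav t m y P) :
    σ'.HTrav t m y P :=
  ⟨h.1.rely R, fun hlt => R.travV _ _ h.1.1 (h.2 hlt)⟩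

theorem LPre.rely (R : Rely t m σ σ') {v₁ v₂ : VRef} (h : σ.LPre t m v₁ v₂) :
    σ'.LPre t m v₁ v₂ :=
  ⟨h.1.rely R, h.2.1, h.2.2.1, h.2.2.2.1.rely R, h.2.2.2.2.rely R⟩

theorem LCheck.rely (R : Rely t m σ σ') {v : VRef} (h : σ.LCheck t m v) : σ'.LCheck t m v :=
  h.imp (·.rely R) fun h => R.cand h

theorem CVPre.rely (R : Rely t m σ σ') (h : σ.CVPre t m) : σ'.CVPre t m :=
  ⟨h.1.rely R, h.2⟩

theorem CEPre.rely (R : Rely t m σ σ') (h : σ.CEPre t m) : σ'.CEPre t m :=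
  ⟨h.1.rely R, h.2.1, R.cand₂ _ _ h.2.2⟩

theorem VTrav.rely (R : Rely t m σ σ') {k : ℤ} {v : VRef} {P : NodeKey → Prop}
    (h : σ.VTrav t k v P) : σ'.VTrav t k v P :=
  ⟨h.1.rely R, R.travV _ _ h.1.1 h.2⟩

theorem CTrav.rely (R : Rely t m σ σ') {e : ERef} {P : NodeKey → Prop} (h : σ.CTrav t m e P) :
    σ'.CTrav t m e P := by
  obtain ⟨w, h1, h2, h3⟩ := h
  exact ⟨w, h1.rely R, h2.rely R, R.travE _ _ _ _ h1.1 h1.2 h2.1 h3⟩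

/-- Each assertion is a conjunction of facts about the thread's own call, permanent facts (keys,
marks that are set, moments in the past), and facts protected by its locks or by the privacy of a
node. -/
theorem At.rely (R : Rely t m σ σ') {p : Pc} (h : σ.At t m p) : σ'.At t m p := by
  cases p <;> simp only [At] at h ⊢ <;> (try casesm* _ ∧ _) <;> (try constructorm* _ ∧ _) <;>
    first
    | assumption
    | exact VPre.rely R ‹_› | exact V.rely R ‹_› | exact VL.rely R ‹_› | exact VWin.rely R ‹_›
    | exact VP.rely R ‹_› | exact Scan.rely R ‹_› | exact XA.rely R ‹_› | exact Call.rely R ‹_›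
    | exact E.rely R ‹_› | exact EL.rely R ‹_› | exact EWin.rely R ‹_› | exact EP.rely R ‹_›
    | exact EOp.rely R ‹_› | exact EDone.rely R ‹_› | exact EPre.rely R ‹_›
    | exact HPre.rely R ‹_› | exact HSnd.rely R ‹_› | exact HTrav.rely R ‹_›
    | exact VTrav.rely R ‹_› | exact LPre.rely R ‹_› | exact LCheck.rely R ‹_›
    | exact CVPre.rely R ‹_› | exact CEPre.rely R ‹_› | exact CTrav.rely R ‹_›
    | exact fun hd => EOp.rely R (‹_ = false → _› hd)
    | exact fun hd => EDone.rely R (‹_ = true → _› hd)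

end Stability

end State

end ConcGraph

namespace ConcGraph

variable {T : Type*} [DecidableEq T]

/-! ## Insertion of linearization points -/

/-- The thread `t` inserts the linearization point of its call of `m` with result `b`. -/
structure LogStep (t : T) (m : Method) (b : Bool) (L L' : Log T) : Prop where
  valid : ValidLog L'
  evs : evs L' = evs L
  done : callState t L' = .done m b
  call : ∀ t', t' ≠ t → callState t' L' = callState t' L
  cand₂ : ∀ t' P Q, t' ≠ t → Cand₂ L t' P Q → Cand₂ L' t' P Q

theorem LogStep.insert {B A : Log T} {t : T} {m : Method} {b : Bool} (h : ValidLog (B ++ A))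
    (hB : Insertable B (.lin t m b) A) (hx : Entry.Legal (.lin t m b) A) (hq : Quiet t B) :
    LogStep t m b (B ++ A) (B ++ .lin t m b :: A) where
  valid := h.insert hB hx hq
  evs := evs_insert_lin t m b B A
  done := by rw [callState_append hq]; simp [callState, Entry.thread, Entry.post]
  call t' ht := callState_insert (Ne.symm ht) B A
  cand₂ t' P Q ht := Cand₂.insert hB (Ne.symm ht)

theorem LogStep.append {L : Log T} {t : T} {m : Method} {b : Bool} (h : ValidLog L)
    (hx : Entry.Legal (.lin t m b) L) : LogStep t m b L (.lin t m b :: L) :=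
  LogStep.insert (B := []) h (.inl rfl) hx (Quiet.nil t)

/-- The linearization point of a call that does not change the abstract graph. -/
theorem exists_logStep_of_cand {L : Log T} {t : T} {m : Method} {b : Bool} (h : ValidLog L)
    (hc : callState t L = .pend m) (hC : Cand L t fun G => Spec G m b G ∧ m.effect b G = G)
    (hm₁ : ∀ z, m ≠ .addVertex z) (hm₂ : ∀ u v, m = .addEdge u v → u ≠ v) :
    ∃ L', LogStep t m b L L' ∧ graph L' = graph L ∧
      (∀ u v, EdgeEver L u v → EdgeEver L' u v) ∧
      (∀ A, A <:+ L' → ∃ A', A' <:+ L ∧ (graph A).verts = (graph A').verts) := by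
  obtain ⟨B, A, rfl, hq, hS, hE⟩ := hC
  have hg : graph (.lin t m b :: A) = graph A := hE
  have hins : Insertable B (.lin t m b) A := .inr (.inl hg)
  rw [callState_append hq] at hc
  refine ⟨_, LogStep.insert h hins ⟨hc, ?_, fun z hz => absurd hz (hm₁ z), hm₂⟩ hq,
    graph_append_congr B hg, fun u v => EdgeEver.insert hins fun he => .inl (hg ▸ he),
    fun D hD => ?_⟩
  · rw [hE]; exact hS
  · rcases eq_or_ne B [] with rfl | hB
    · obtain ⟨E, hE'⟩ := hD
      rcases E with _ | ⟨y, E⟩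
      · obtain rfl : D = .lin t m b :: A := hE'
        exact ⟨A, List.suffix_rfl, by rw [hg]⟩
      · simp only [List.nil_append, List.cons_append, List.cons.injEq] at hE'
        exact ⟨D, ⟨E, hE'.2⟩, rfl⟩
    · exact hins.verts_suffix hB hD

/-- The linearization point of `AddEdge(u, v)` or `RemoveEdge(u, v)` is inserted at the end, or
immediately before the removal of `u` or `v`. -/
theorem exists_logStep_edge {L : Log T} {t : T} {m : Method} {u v : ℤ} (h : ValidLog L)
    (hc : callState t L = .pend m) (hm : m = .addEdge u v ∨ m = .removeEdge u v) (huv : u ≠ v)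
    (hC : Cand L t fun G => u ∈ G.verts ∧ v ∈ G.verts) :
    ∃ L', LogStep t m true L L' ∧ (graph L').verts = (graph L).verts ∧
      (∀ p q, (p, q) ≠ (u, v) → EdgeEver L p q → EdgeEver L' p q) ∧
      (∀ p q, (p, q) ≠ (u, v) → (p, q) ∈ (graph L').edges → (p, q) ∈ (graph L).edges) ∧
      (m = .addEdge u v → EdgeEver L' u v) ∧
      (m = .removeEdge u v → (u, v) ∉ (graph L').edges) ∧
      (∀ A, A <:+ L' → ∃ A', A' <:+ L ∧ (graph A).verts = (graph A').verts) := by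
  have hverts : ∀ A : Log T, (graph (.lin t m true :: A)).verts = (graph A).verts := by
    intro A; rcases hm with rfl | rfl <;> rfl
  have hedges : ∀ (A : Log T) p q, (p, q) ≠ (u, v) →
      ((p, q) ∈ (graph (.lin t m true :: A)).edges ↔ (p, q) ∈ (graph A).edges) := by
    intro A p q hpq
    rcases hm with rfl | rfl
    · simp only [graph, Method.effect, Set.mem_insert_iff, hpq, false_or]
    · simp only [graph, Method.effect, Set.mem_sdiff, Set.mem_singleton_iff, hpq, not_false_eq_true,
        and_true]
  have hlegal : ∀ A : Log T, callState t A = .pend m → u ∈ (graph A).verts →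
      v ∈ (graph A).verts → Entry.Legal (.lin t m true) A := by
    intro A h1 h2 h3
    refine ⟨h1, ?_⟩
    rcases hm with rfl | rfl
    · exact ⟨⟨⟨h2, h3⟩, rfl⟩, by simp, by rintro a b h; cases h; exact huv⟩
    · exact ⟨⟨⟨h2, h3⟩, rfl⟩, by simp, by simp⟩
  -- If both endpoints are alive now, the call takes effect now. Otherwise it is placed just before
  -- the first removal of an endpoint after the moment when both were alive.
  by_cases hal : u ∈ (graph L).verts ∧ v ∈ (graph L).verts
  · refine ⟨_, LogStep.append h (hlegal L hc hal.1 hal.2), hverts L, ?_, ?_, ?_, ?_, ?_⟩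
    · exact fun p q hpq => EdgeEver.insert (B := []) (.inl rfl) fun he =>
        .inl ((hedges L p q hpq).2 he)
    · exact fun p q hpq => (hedges L p q hpq).1
    · rintro rfl
      exact ⟨[], _, rfl, by simp [graph, Method.effect], .inl rfl⟩
    · rintro rfl
      simp [graph, Method.effect]
    · rintro A ⟨E, hE⟩
      rcases E with _ | ⟨y, E⟩
      · obtain rfl : A = _ := hE
        exact ⟨L, List.suffix_rfl, hverts L⟩
      · simp only [List.cons_append, List.cons.injEq] at hE
        exact ⟨A, ⟨E, hE.2⟩, rfl⟩
  · obtain ⟨B, A, rfl, hq, hu, hv⟩ := hC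
    obtain ⟨B', C, s, z, rfl, hz, hu', hv'⟩ := exists_kill hu hv hal
    have hsplit : (B' ++ .lin s (.removeVertex z) true :: C) ++ A =
        (B' ++ [.lin s (.removeVertex z) true]) ++ (C ++ A) := by simp
    rw [hsplit] at h hc hal ⊢
    rw [Quiet.append, Quiet.cons] at hq
    have hq' : Quiet t (B' ++ [.lin s (.removeVertex z) true]) :=
      Quiet.append.2 ⟨hq.1, Quiet.cons.2 ⟨hq.2.1, Quiet.nil t⟩⟩
    -- The new entry changes at most the pair `(u, v)`, and the removal of `z`, one of its
    -- endpoints, deletes that pair in any case.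
    have hins : Insertable (B' ++ [.lin s (.removeVertex z) true]) (.lin t m true) (C ++ A) := by
      refine .inr (.inr ⟨hverts _, B', s, z, rfl, ?_⟩)
      have h1 := hverts (C ++ A)
      generalize hG : graph (.lin t m true :: (C ++ A)) = G at h1
      have h2 : ∀ p q, (p, q) ≠ (u, v) → ((p, q) ∈ G.edges ↔ (p, q) ∈ (graph (C ++ A)).edges) :=
        hG ▸ hedges (C ++ A)
      simp only [graph, Method.effect] at hG ⊢
      rw [hG, h1]
      congr 1
      ext ⟨p, q⟩
      simp only [Set.mem_ofPred_eq]
      rcases eq_or_ne (p, q) (u, v) with h3 | h3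
      · obtain ⟨rfl, rfl⟩ := Prod.mk.inj h3
        rcases hz with rfl | rfl <;> simp
      · rw [h2 p q h3]
    rw [callState_append hq'] at hc
    have hstep := LogStep.insert h hins (hlegal _ hc hu' hv') hq'
    have hne : B' ++ [Entry.lin s (.removeVertex z) true] ≠ [] := by simp
    have hg := hins.graph_eq (D := []) (List.nil_append _).symm hne
    refine ⟨_, hstep, by rw [hg], ?_, ?_, ?_, ?_, ?_⟩
    · exact fun p q hpq => EdgeEver.insert hins fun he => .inl ((hedges _ p q hpq).2 he)
    · intro p q _ he
      rwa [hg] at he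
    · rintro rfl
      -- The added edge lives only until the very next entry, the removal of an endpoint; this is
      -- exactly what `EdgeEver` allows.
      exact ⟨_, _, rfl, by simp [graph, Method.effect], .inr ⟨B', _, rfl, s, z, rfl, hz⟩⟩
    · intro _ he
      rw [hg] at he
      exact hal ⟨(h.edges he).1, (h.edges he).2.1⟩
    · exact fun D hD => hins.verts_suffix hne hD

/-! ### Transport of the rely conditions and of the invariant along writes. -/

namespace State

variable {t t' : T} {m m' : Method} {σ σ' σ'' : State T}

theorem Rely.refl : Rely t m σ σ where
  call := rfl
  cand₂ _ _ h := h
  vlinked _ h := ⟨h, rfl, id, fun h => ⟨h, rfl, rfl⟩⟩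
  elinked _ _ h := ⟨h, rfl, id, fun h => ⟨h, rfl, rfl⟩⟩
  vpriv _ h := ⟨h, rfl⟩
  epriv _ h := ⟨h, rfl⟩
  fresh _ _ h := h
  travV _ _ _ h := h
  travE _ _ _ _ _ _ _ h := h

theorem Rely.trans (R : Rely t m σ σ') (R' : Rely t m σ' σ'') : Rely t m σ σ'' where
  call := R'.call.trans R.call
  cand₂ P Q h := R'.cand₂ P Q (R.cand₂ P Q h)
  vlinked v h := by
    obtain ⟨h1, h2, h3, h4⟩ := R.vlinked v h
    obtain ⟨h1', h2', h3', h4'⟩ := R'.vlinked v h1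
    refine ⟨h1', h2'.trans h2, h3' ∘ h3, fun hl => ?_⟩
    obtain ⟨a, b, c⟩ := h4 hl
    obtain ⟨a', b', c'⟩ := h4' a
    exact ⟨a', b'.trans b, c'.trans c⟩
  elinked e w h := by
    obtain ⟨h1, h2, h3, h4⟩ := R.elinked e w h
    obtain ⟨h1', h2', h3', h4'⟩ := R'.elinked e w h1
    refine ⟨h1', h2'.trans h2, h3' ∘ h3, fun hl => ?_⟩
    obtain ⟨a, b, c⟩ := h4 hl
    obtain ⟨a', b', c'⟩ := h4' a
    exact ⟨a', b'.trans b, c'.trans c⟩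
  vpriv v h := ⟨(R'.vpriv v (R.vpriv v h).1).1,
    (R'.vpriv v (R.vpriv v h).1).2.trans (R.vpriv v h).2⟩
  epriv v h := ⟨(R'.epriv v (R.epriv v h).1).1,
    (R'.epriv v (R.epriv v h).1).2.trans (R.epriv v h).2⟩
  fresh k hk h := R'.fresh k hk (R.fresh k hk h)
  travV k v hv h := R'.travV k v (R.vlinked v hv).1 (R.travV k v hv h)
  travE w u k e hw hu he h := R'.travE w u k e (R.vlinked w hw).1
    ((R.vlinked w hw).2.1.trans hu) (R.elinked e w he).1 (R.travE w u k e hw hu he h)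

/-- With the memory fixed, the log enters what a thread relies on only through its call state and
the past moments it has witnessed. -/
theorem Rely.log {L' : Log T} (call : callState t L' = callState t σ.log)
    (cand₂ : ∀ P Q, Cand₂ σ.log t P Q → Cand₂ L' t P Q) :
    Rely t m σ ⟨σ.mem, L', σ.vs, σ.es⟩ where
  call := call
  cand₂ := cand₂
  vlinked _ h := ⟨h, rfl, id, fun h => ⟨h, rfl, rfl⟩⟩
  elinked _ _ h := ⟨h, rfl, id, fun h => ⟨h, rfl, rfl⟩⟩
  vpriv _ h := ⟨h, rfl⟩
  epriv _ h := ⟨h, rfl⟩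
  fresh _ _ h := h
  travV _ _ _ h := h.imp_left fun h => by
    rw [cand_iff_cand₂] at h ⊢
    exact cand₂ _ _ h
  travE _ _ _ _ _ _ _ h := h.imp_left fun h => by
    rw [cand_iff_cand₂] at h ⊢
    exact cand₂ _ _ h

/-- Another thread changes a vertex node that it has locked, created, or that is not locked, and
possibly links nodes that it has created. -/
theorem Rely.setV {v : VRef} {f : VNode T → VNode T} {vs' : VRef → VStat T}
    (hf : ∀ n, (f n).val = n.val)
    (hvs : ∀ x, vs' x = σ.vs x ∨ (∃ s, s ≠ t ∧ σ.vs x = .priv s) ∧ vs' x = .linked ∧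
      ∀ k, σ.vval x = toKey k → k ∉ (graph σ.log).verts)
    (hv : σ.vs v = .linked ∧ σ.vlk v ≠ some t ∧
        (σ.vmk v = true → (f (σ.mem.vnode v)).marked = true) ∨ ∃ s, s ≠ t ∧ σ.vs v = .priv s)
    (hreach : ∀ x z, σ.vs z = .linked → State.vmk ⟨σ.mem.setV v f, σ.log, vs', σ.es⟩ z = false →
      σ.VReach x z → State.VReach ⟨σ.mem.setV v f, σ.log, vs', σ.es⟩ x z) :
    Rely t m σ ⟨σ.mem.setV v f, σ.log, vs', σ.es⟩ where
  call := rfl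
  cand₂ _ _ h := h
  vlinked x hx := by
    have h' : vs' x = .linked := by
      rcases hvs x with h | ⟨⟨s, -, h⟩, -⟩
      · rw [h, hx]
      · rw [hx] at h; cases h
    rcases eq_or_ne x v with rfl | hxv
    · rcases hv with ⟨h1, h3, h4⟩ | ⟨s, hs, h1⟩
      · refine ⟨h', by simp [vval, Mem.setV, hf], by simpa [vmk, Mem.setV] using h4,
          fun h => absurd h h3⟩
      · rw [hx] at h1; cases h1
    · simp [vval, vmk, vlk, vnxt, Mem.setV, hxv, h']
  elinked e w he := ⟨he, rfl, id, fun h => ⟨h, rfl, rfl⟩⟩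
  vpriv x hx := by
    have h' : vs' x = .priv t := by
      rcases hvs x with h | ⟨⟨s, hs, h⟩, -⟩
      · rw [h, hx]
      · rw [hx] at h; cases h; exact absurd rfl hs
    rcases eq_or_ne x v with rfl | hxv
    · rcases hv with ⟨h1, h3, h4⟩ | ⟨s, hs, h1⟩
      · rw [hx] at h1; cases h1
      · rw [hx] at h1; cases h1; exact absurd rfl hs
    · simp [Mem.setV, hxv, h']
  epriv e he := ⟨he, rfl⟩
  fresh k hk h x hx := by
    have h' : σ.vs x ≠ .free := by
      rcases hvs x with h | ⟨⟨s, hs, h⟩, -⟩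
      · rw [← h]; exact hx
      · simp [h]
    rcases eq_or_ne x v with rfl | hxv
    · simpa only [vval, Mem.setV, Function.update_self, hf] using h x h'
    · simpa only [vval, Mem.setV, Function.update_of_ne hxv] using h x h'
  travV k x hx h := by
    -- If the key is absent now, the present moment is the required witness. If it is present, a
    -- node linked by this step has a different key, so the target was linked before and its path
    -- survives.
    by_cases hk : k ∈ (graph σ.log).verts
    · refine h.imp_right fun h z hz hmz hvz => ?_
      have hvz' : σ.vval z = toKey k := by
        rcases eq_or_ne z v with rfl | hzv
        · simpa only [vval, Mem.setV, Function.update_self, hf] using hvz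
        · simpa only [vval, Mem.setV, Function.update_of_ne hzv] using hvz
      have hl : σ.vs z = .linked := by
        rcases hvs z with h | ⟨-, -, h⟩
        · rw [← h]; exact hz
        · exact absurd hk (h k hvz')
      refine hreach x z hl hmz (h z hl ?_ hvz')
      rcases eq_or_ne z v with rfl | hzv
      · rcases hv with ⟨h1, h3, h4⟩ | ⟨s, hs, h1⟩
        · simp only [vmk, Mem.setV, Function.update_self] at hmz h4
          by_contra hc
          rw [h4 (by simpa using hc)] at hmz
          cases hmz
        · rw [hl] at h1; cases h1
      · simpa [vmk, Mem.setV, hzv] using hmz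
    · exact .inl (.now hk)
  travE w u k e hw hu he h := h

/-- Another thread changes an edge node that it has locked, created, or that is not locked, and
possibly links nodes that it has created. -/
theorem Rely.setE {e : ERef} {f : ENode T → ENode T} {es' : ERef → EStat T}
    (hf : ∀ n, (f n).val = n.val)
    (hes : ∀ x, es' x = σ.es x ∨ (∃ s, s ≠ t ∧ σ.es x = .priv s) ∧ ∃ w, es' x = .linked w ∧
      ∀ u k, σ.vval w = toKey u → σ.enval x = toKey k → (u, k) ∉ (graph σ.log).edges)
    (he : (∃ w, σ.es e = .linked w) ∧ σ.elk e ≠ some t ∧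
        (σ.emk e = true → (f (σ.mem.enode e)).marked = true) ∨ ∃ s, s ≠ t ∧ σ.es e = .priv s)
    (hreach : ∀ w x z, σ.es z = .linked w →
      State.emk ⟨σ.mem.setE e f, σ.log, σ.vs, es'⟩ z = false →
      σ.EReach w x z → State.EReach ⟨σ.mem.setE e f, σ.log, σ.vs, es'⟩ w x z) :
    Rely t m σ ⟨σ.mem.setE e f, σ.log, σ.vs, es'⟩ where
  call := rfl
  cand₂ _ _ h := h
  elinked x w hx := by
    have h' : es' x = .linked w := by
      rcases hes x with h | ⟨⟨s, -, h⟩, -⟩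
      · rw [h, hx]
      · rw [hx] at h; cases h
    rcases eq_or_ne x e with rfl | hxv
    · rcases he with ⟨h1, h3, h4⟩ | ⟨s, hs, h1⟩
      · refine ⟨h', by simp [enval, Mem.setE, hf], by simpa [emk, Mem.setE] using h4,
          fun h => absurd h h3⟩
      · rw [hx] at h1; cases h1
    · simp [enval, emk, elk, enxt, Mem.setE, hxv, h']
  vlinked e he := ⟨he, rfl, id, fun h => ⟨h, rfl, rfl⟩⟩
  epriv x hx := by
    have h' : es' x = .priv t := by
      rcases hes x with h | ⟨⟨s, hs, h⟩, -⟩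
      · rw [h, hx]
      · rw [hx] at h; cases h; exact absurd rfl hs
    rcases eq_or_ne x e with rfl | hxv
    · rcases he with ⟨⟨w, h1⟩, h3, h4⟩ | ⟨s, hs, h1⟩
      · rw [hx] at h1; cases h1
      · rw [hx] at h1; cases h1; exact absurd rfl hs
    · simp [Mem.setE, hxv, h']
  vpriv e he := ⟨he, rfl⟩
  fresh k hk h := h
  travV k x hx h := h
  travE w u k x hw hu hx h := by
    -- The same alternative for edges: an edge node that is just being linked cannot represent an
    -- edge that is already present.
    by_cases hk : (u, k) ∈ (graph σ.log).edges
    · refine h.imp_right fun h z hz hmz hvz => ?_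
      have hvz' : σ.enval z = toKey k := by
        rcases eq_or_ne z e with rfl | hzv
        · simpa only [enval, Mem.setE, Function.update_self, hf] using hvz
        · simpa only [enval, Mem.setE, Function.update_of_ne hzv] using hvz
      have hl : σ.es z = .linked w := by
        rcases hes z with h | ⟨-, w', h1, hnew⟩
        · rw [← h]; exact hz
        · obtain rfl : w' = w := by
            have : EStat.linked w' = .linked w := h1.symm.trans hz
            injection this
          exact absurd hk (hnew u k hu hvz')
      refine hreach w x z hl hmz (h z hl ?_ hvz')
      rcases eq_or_ne z e with rfl | hzv
      · rcases he with ⟨h1, h3, h4⟩ | ⟨s, hs, h1⟩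
        · simp only [emk, Mem.setE, Function.update_self] at hmz h4
          by_contra hc
          rw [h4 (by simpa using hc)] at hmz
          cases hmz
        · rw [hl] at h1; cases h1
      · simpa [emk, Mem.setE, hzv] using hmz
    · exact .inl (.now hk)

/-- Common part of all writes to vertex nodes. As keys and edge list heads are fixed, the edge lists
carry over, and only the vertex list and its relation to the log must be checked. For abstract edges
an inclusion suffices, since `edge_mem` asks for nothing when edges disappear. -/
theorem Inv.setV (I : σ.Inv) {v : VRef} {f : VNode T → VNode T} {vs' : VRef → VStat T}
    {L' : Log T} (hf : ∀ n, (f n).val = n.val ∧ (f n).edgeHead = n.edgeHead)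
    (hfree : ∀ x, vs' x = .free ↔ σ.vs x = .free) (hlk : ∀ x, σ.vs x = .linked → vs' x = .linked)
    (valid : ValidLog L') (hevs : evs L' = evs σ.log)
    (hever : ∀ p q, EdgeEver σ.log p q → EdgeEver L' p q)
    (hedges : (graph L').edges ⊆ (graph σ.log).edges)
    (vlist : SortedList (fun x => vs' x = .linked) σ.vval
      (State.vnxt ⟨σ.mem.setV v f, L', vs', σ.es⟩) (State.vmk ⟨σ.mem.setV v f, L', vs', σ.es⟩)
      vertexHead)
    (verts : ∀ z, z ∈ (graph L').verts ↔ ∃ x, vs' x = .linked ∧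
      State.vmk ⟨σ.mem.setV v f, L', vs', σ.es⟩ x = false ∧ σ.vval x = toKey z)
    (ever : ∀ A, A <:+ L' → ∀ z ∈ (graph A).verts, ∃ x, vs' x = .linked ∧ σ.vval x = toKey z) :
    Inv ⟨σ.mem.setV v f, L', vs', σ.es⟩ := by
  have hval : State.vval ⟨σ.mem.setV v f, L', vs', σ.es⟩ = σ.vval := by
    funext x
    rcases eq_or_ne x v with rfl | hx
    · simp [vval, Mem.setV, hf]
    · simp [vval, Mem.setV, hx]
  have hhd : State.vhd ⟨σ.mem.setV v f, L', vs', σ.es⟩ = σ.vhd := by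
    funext x
    rcases eq_or_ne x v with rfl | hx
    · simp [vhd, Mem.setV, hf]
    · simp [vhd, Mem.setV, hx]
  constructor
  · exact valid
  · exact fun x => (hfree x).trans (I.vfree x)
  · exact I.efree
  · exact fun e w he => (hfree w).not.2 (I.eowner e w he)
  · intro x y hx hy
    rw [hval]
    exact I.vkey x y ((hfree x).not.1 hx) ((hfree y).not.1 hy)
  · intro x k hx
    rw [hval, hevs]
    exact I.vsrc x k ((hfree x).not.1 hx)
  · rw [hval]; exact vlist
  · intro w hw
    rw [hhd]
    exact I.elist w ((hfree w).not.1 hw)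
  · rw [hval]; exact verts
  · rw [hval]; exact ever
  · intro x e p q he hm hx hq
    rw [hval] at hx
    exact hever p q (I.edge_ever x e p q he hm hx hq)
  · intro p q hpq
    rw [hval]
    obtain ⟨x, e, h1, h2⟩ := I.edge_mem p q (hedges hpq)
    exact ⟨x, e, hlk x h1, h2⟩

/-- Common part of all writes to edge nodes. The log may change, but only so that every vertex set
in it occurred before; the vertex half of the invariant then persists. -/
theorem Inv.setE (I : σ.Inv) {e : ERef} {f : ENode T → ENode T} {es' : ERef → EStat T}
    {L' : Log T} (hf : ∀ n, (f n).val = n.val)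
    (hfree : ∀ x, es' x = .free ↔ σ.es x = .free)
    (howner : ∀ x w, es' x = .linked w → σ.vs w ≠ .free)
    (valid : ValidLog L') (hevs : evs L' = evs σ.log)
    (hverts : (graph L').verts = (graph σ.log).verts)
    (hsuff : ∀ A, A <:+ L' → ∃ A', A' <:+ σ.log ∧ (graph A).verts = (graph A').verts)
    (elist : ∀ w, σ.vs w ≠ .free → SortedList (fun x => es' x = .linked w) σ.enval
      (State.enxt ⟨σ.mem.setE e f, L', σ.vs, es'⟩) (State.emk ⟨σ.mem.setE e f, L', σ.vs, es'⟩)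
      (σ.vhd w))
    (edge_ever : ∀ x y u v, es' y = .linked x →
      State.emk ⟨σ.mem.setE e f, L', σ.vs, es'⟩ y = false → σ.vval x = toKey u →
      σ.enval y = toKey v → EdgeEver L' u v)
    (edge_mem : ∀ u v, (u, v) ∈ (graph L').edges → ∃ x y, σ.vs x = .linked ∧
      σ.vval x = toKey u ∧ es' y = .linked x ∧
      State.emk ⟨σ.mem.setE e f, L', σ.vs, es'⟩ y = false ∧ σ.enval y = toKey v) :
    Inv ⟨σ.mem.setE e f, L', σ.vs, es'⟩ := by
  have hval : State.enval ⟨σ.mem.setE e f, L', σ.vs, es'⟩ = σ.enval := by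
    funext x
    rcases eq_or_ne x e with rfl | hx
    · simp [enval, Mem.setE, hf]
    · simp [enval, Mem.setE, hx]
  constructor
  · exact valid
  · exact I.vfree
  · exact fun x => (hfree x).trans (I.efree x)
  · exact howner
  · exact I.vkey
  · intro x k hx
    rw [hevs]
    exact I.vsrc x k hx
  · exact I.vlist
  · rw [hval]; exact elist
  · intro z; rw [hverts]; exact I.verts z
  · intro A hA z hz
    obtain ⟨A', hA', h⟩ := hsuff A hA
    exact I.ever A' hA' z (h ▸ hz)
  · rw [hval]; exact edge_ever
  · rw [hval]; exact edge_mem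

end State

end ConcGraph

namespace ConcGraph

variable {T : Type*} [DecidableEq T]

namespace State

variable {t t' : T} {m m' : Method} {σ σ' σ'' : State T}

/-! ## The effect of the atomic steps -/

theorem toKey_injective : Function.Injective toKey := fun _ _ h =>
  WithTop.coe_injective (WithBot.coe_injective h)

theorem Inv.guar_refl (I : σ.Inv) : Guar t m σ σ := ⟨I, rfl, fun _ _ _ _ => .refl⟩

theorem Inv.log (I : σ.Inv) {L' : Log T} (valid : ValidLog L') (hevs : evs L' = evs σ.log)
    (hg : graph L' = graph σ.log) (hever : ∀ p q, EdgeEver σ.log p q → EdgeEver L' p q)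
    (hsuff : ∀ A, A <:+ L' → ∃ A', A' <:+ σ.log ∧ (graph A).verts = (graph A').verts) :
    Inv ⟨σ.mem, L', σ.vs, σ.es⟩ where
  valid := valid
  vfree := I.vfree
  efree := I.efree
  eowner := I.eowner
  vkey := I.vkey
  vsrc x k hx hk := hevs ▸ I.vsrc x k hx hk
  vlist := I.vlist
  elist := I.elist
  verts z := by rw [hg]; exact I.verts z
  ever A hA z hz := by
    obtain ⟨A', hA', h⟩ := hsuff A hA
    exact I.ever A' hA' z (h ▸ hz)
  edge_ever x e u v he hm hx hv := hever u v (I.edge_ever x e u v he hm hx hv)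
  edge_mem u v h := I.edge_mem u v (hg ▸ h)

/-- Serves every call that returns without changing the abstract graph: the log is rewritten in the
past, the memory is untouched. -/
theorem Inv.exists_guar_lin (I : σ.Inv) {b : Bool} (hc : σ.Call t (.pend m))
    (hC : Cand σ.log t fun G => Spec G m b G ∧ m.effect b G = G)
    (hm₁ : ∀ z, m ≠ .addVertex z) (hm₂ : ∀ u v, m = .addEdge u v → u ≠ v) :
    ∃ L', Guar t m σ ⟨σ.mem, L', σ.vs, σ.es⟩ ∧ callState t L' = .done m b := by
  obtain ⟨L', hL, hg, hever, hsuff⟩ := exists_logStep_of_cand I.valid hc hC hm₁ hm₂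
  exact ⟨L', ⟨I.log hL.valid hL.evs hg hever hsuff, hL.evs, fun t' m' ht _ =>
    Rely.log (hL.call t' ht) fun P Q => hL.cand₂ t' P Q ht⟩, hL.done⟩

/-- A change that concerns neither keys, marks nor the references of linked nodes. -/
theorem Inv.guar_setV (I : σ.Inv) {v : VRef} {f : VNode T → VNode T}
    (hf : ∀ n, (f n).val = n.val ∧ (f n).edgeHead = n.edgeHead ∧ (f n).marked = n.marked)
    (hv : σ.vs v = .linked ∧ (σ.vlk v = none ∨ σ.vlk v = some t) ∧ (∀ n, (f n).vnext = n.vnext) ∨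
      σ.vs v = .priv t) :
    Guar t m σ ⟨σ.mem.setV v f, σ.log, σ.vs, σ.es⟩ := by
  have hmk : ∀ x, State.vmk ⟨σ.mem.setV v f, σ.log, σ.vs, σ.es⟩ x = σ.vmk x := by
    intro x
    rcases eq_or_ne x v with rfl | hx
    · simp [vmk, Mem.setV, hf]
    · simp [vmk, Mem.setV, hx]
  have hl := I.vlist.marked (val' := σ.vval) (S' := fun x => σ.vs x = .linked)
    (next' := State.vnxt ⟨σ.mem.setV v f, σ.log, σ.vs, σ.es⟩)
    (mk' := State.vmk ⟨σ.mem.setV v f, σ.log, σ.vs, σ.es⟩)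
    (fun _ _ => rfl) (fun x hx => by
      rcases eq_or_ne x v with rfl | hxv
      · rcases hv with ⟨-, -, hv⟩ | hv
        · simp [vnxt, Mem.setV, hv]
        · rw [hv] at hx; cases hx
      · simp [vnxt, Mem.setV, hxv]) (fun _ => Iff.rfl) (fun x _ => by rw [hmk]; exact id)
  refine ⟨I.setV (fun n => ⟨(hf n).1, (hf n).2.1⟩) (fun _ => Iff.rfl) (fun _ h => h) I.valid rfl
    (fun _ _ h => h) subset_rfl hl.1 (by simpa only [hmk] using I.verts) I.ever, rfl,
    fun t' m' ht _ => Rely.setV (fun n => (hf n).1) (fun _ => .inl rfl) ?_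
      fun x z _ _ h => hl.2 x z h⟩
  rcases hv with ⟨h1, h2, -⟩ | h
  · refine .inl ⟨h1, ?_, fun h => (hf _).2.2.trans h⟩
    rcases h2 with h2 | h2 <;> rw [h2] <;> simp [Ne.symm ht]
  · exact .inr ⟨t, Ne.symm ht, h⟩

/-- A change that concerns neither keys, marks nor the references of linked nodes. -/
theorem Inv.guar_setE (I : σ.Inv) {e : ERef} {f : ENode T → ENode T}
    (hf : ∀ n, (f n).val = n.val ∧ (f n).marked = n.marked)
    (he : (∃ w, σ.es e = .linked w) ∧ (σ.elk e = none ∨ σ.elk e = some t) ∧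
      (∀ n, (f n).enext = n.enext) ∨ σ.es e = .priv t) :
    Guar t m σ ⟨σ.mem.setE e f, σ.log, σ.vs, σ.es⟩ := by
  have hmk : ∀ x, State.emk ⟨σ.mem.setE e f, σ.log, σ.vs, σ.es⟩ x = σ.emk x := by
    intro x
    rcases eq_or_ne x e with rfl | hx
    · simp [emk, Mem.setE, hf]
    · simp [emk, Mem.setE, hx]
  have hnx : ∀ w x, σ.es x = .linked w →
      State.enxt ⟨σ.mem.setE e f, σ.log, σ.vs, σ.es⟩ x = σ.enxt x := by
    intro w x hx
    rcases eq_or_ne x e with rfl | hxe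
    · rcases he with ⟨-, -, he⟩ | he
      · simp [enxt, Mem.setE, he]
      · rw [he] at hx; cases hx
    · simp [enxt, Mem.setE, hxe]
  have hl := fun w (hw : σ.vs w ≠ .free) => (I.elist w hw).marked (val' := σ.enval)
    (S' := fun x => σ.es x = .linked w)
    (next' := State.enxt ⟨σ.mem.setE e f, σ.log, σ.vs, σ.es⟩)
    (mk' := State.emk ⟨σ.mem.setE e f, σ.log, σ.vs, σ.es⟩)
    (fun _ _ => rfl) (hnx w) (fun _ => Iff.rfl) (fun x _ => by rw [hmk]; exact id)
  refine ⟨I.setE (fun n => (hf n).1) (fun _ => Iff.rfl) I.eowner I.valid rfl rfl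
    (fun A hA => ⟨A, hA, rfl⟩) (fun w hw => (hl w hw).1) (by simpa only [hmk] using I.edge_ever)
    (by simpa only [hmk] using I.edge_mem), rfl,
    fun t' m' ht _ => Rely.setE (fun n => (hf n).1) (fun _ => .inl rfl) ?_
      fun w x z hz _ h => (hl w (I.eowner z w hz)).2 x z h⟩
  rcases he with ⟨h1, h2, -⟩ | h
  · refine .inl ⟨h1, ?_, fun h => (hf _).2.trans h⟩
    rcases h2 with h2 | h2 <;> rw [h2] <;> simp [Ne.symm ht]
  · exact .inr ⟨t, Ne.symm ht, h⟩

/-- The thread `t` creates a vertex node with key `k`. -/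
def allocV (σ : State T) (t : T) (k : ℤ) : State T :=
  ⟨σ.mem.allocV k, σ.log, Function.update σ.vs σ.mem.vcount (.priv t),
    Function.update (Function.update σ.es σ.mem.ecount (.linked σ.mem.vcount))
      (σ.mem.ecount + 1) (.linked σ.mem.vcount)⟩

/-- The thread `t` creates an edge node with key `k`. -/
def allocE (σ : State T) (t : T) (k : ℤ) : State T :=
  ⟨σ.mem.allocE k, σ.log, σ.vs, Function.update σ.es σ.mem.ecount (.priv t)⟩

/-- The node itself is private, while its two sentinels count as linked into its edge list at once.
Other threads can be affected only through the freshness of their own key. -/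
theorem Inv.guar_allocV (I : σ.Inv) {k : ℤ} (hm : m = .addVertex k)
    (hfresh : ∀ x, σ.vs x ≠ .free → σ.vval x ≠ toKey k)
    (hsrc : .inv t (.addVertex k) ∈ evs σ.log) : Guar t m σ (σ.allocV t k) := by
  have hvc : σ.vs σ.mem.vcount = .free := (I.vfree _).2 le_rfl
  have hec : σ.es σ.mem.ecount = .free := (I.efree _).2 le_rfl
  have hec' : σ.es (σ.mem.ecount + 1) = .free := (I.efree _).2 (Nat.le_succ _)
  have hvs : ∀ x, x ≠ σ.mem.vcount → (σ.allocV t k).vs x = σ.vs x ∧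
      (σ.allocV t k).mem.vnode x = σ.mem.vnode x := fun x hx => by simp [allocV, Mem.allocV, hx]
  have hes : ∀ e, e ≠ σ.mem.ecount → e ≠ σ.mem.ecount + 1 → (σ.allocV t k).es e = σ.es e ∧
      (σ.allocV t k).mem.enode e = σ.mem.enode e := fun e h1 h2 => by
    simp [allocV, Mem.allocV, h1, h2]
  have hvs' : (σ.allocV t k).vs σ.mem.vcount = .priv t ∧
      (σ.allocV t k).vval σ.mem.vcount = toKey k ∧
      (σ.allocV t k).vhd σ.mem.vcount = σ.mem.ecount := by simp [allocV, Mem.allocV, vval, vhd]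
  have hne : σ.mem.ecount ≠ σ.mem.ecount + 1 := by simp
  have hes₁ : (σ.allocV t k).es σ.mem.ecount = .linked σ.mem.vcount ∧
      (σ.allocV t k).mem.enode σ.mem.ecount = newENode ⊥ (some (σ.mem.ecount + 1)) := by
    simp [allocV, Mem.allocV]
  have hes₂ : (σ.allocV t k).es (σ.mem.ecount + 1) = .linked σ.mem.vcount ∧
      (σ.allocV t k).mem.enode (σ.mem.ecount + 1) = newENode ⊤ none := by
    simp [allocV, Mem.allocV]
  have hlk : ∀ x, (σ.allocV t k).vs x = .linked ↔ σ.vs x = .linked := by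
    intro x
    rcases eq_or_ne x σ.mem.vcount with rfl | hx
    · simp [hvs', hvc]
    · rw [(hvs x hx).1]
  have hlk' : ∀ x, σ.vs x = .linked → (σ.allocV t k).mem.vnode x = σ.mem.vnode x := by
    intro x hx
    refine (hvs x ?_).2
    rintro rfl
    rw [hvc] at hx; cases hx
  have hel : ∀ e w, w ≠ σ.mem.vcount →
      ((σ.allocV t k).es e = .linked w ↔ σ.es e = .linked w) := by
    intro e w hw
    rcases eq_or_ne e σ.mem.ecount with rfl | h1
    · simp [hes₁, hec, Ne.symm hw]
    rcases eq_or_ne e (σ.mem.ecount + 1) with rfl | h2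
    · simp [hes₂, hec', Ne.symm hw]
    rw [(hes e h1 h2).1]
  have hel' : ∀ e, σ.es e ≠ .free → (σ.allocV t k).es e = σ.es e ∧
      (σ.allocV t k).mem.enode e = σ.mem.enode e := by
    intro e he
    refine hes e ?_ ?_ <;> rintro rfl
    · exact he hec
    · exact he hec'
  have hel₀ : ∀ e, (σ.allocV t k).es e = .linked σ.mem.vcount →
      e = σ.mem.ecount ∨ e = σ.mem.ecount + 1 := by
    intro e he
    by_contra hc
    rw [not_or] at hc
    rw [(hes e hc.1 hc.2).1] at he
    exact I.eowner e _ he hvc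
  have hnf : ∀ x, σ.vs x ≠ .free → x ≠ σ.mem.vcount := by
    rintro x hx rfl
    exact hx hvc
  have hsl := I.vlist.marked (val' := (σ.allocV t k).vval)
    (S' := fun x => (σ.allocV t k).vs x = .linked)
    (next' := (σ.allocV t k).vnxt) (mk' := (σ.allocV t k).vmk)
    (fun x hx => by rw [vval, hlk' x hx]) (fun x hx => by rw [vnxt, hlk' x hx])
    hlk (fun x hx => by rw [vmk, hlk' x hx]; exact id)
  have hsle := fun w (hw : σ.vs w ≠ .free) =>
    (I.elist w hw).marked (val' := (σ.allocV t k).enval)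
    (S' := fun x => (σ.allocV t k).es x = .linked w)
    (next' := (σ.allocV t k).enxt) (mk' := (σ.allocV t k).emk)
    (fun x hx => by rw [enval, (hel' x (by simp [hx])).2])
    (fun x hx => by rw [enxt, (hel' x (by simp [hx])).2])
    (fun x => hel x w (hnf w hw)) (fun x hx => by rw [emk, (hel' x (by simp [hx])).2]; exact id)
  refine ⟨⟨I.valid, ?_, ?_, ?_, ?_, ?_, hsl.1, ?_, ?_, ?_, ?_, ?_⟩, rfl, fun t' m' ht hmm => ?_⟩
  · intro x
    change _ ↔ σ.mem.vcount + 1 ≤ x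
    rcases eq_or_ne x σ.mem.vcount with rfl | hx
    · simp [hvs']
    · rw [(hvs x hx).1, I.vfree]
      exact ⟨fun h => lt_of_le_of_ne h (Ne.symm hx), fun h => Nat.le_of_lt h⟩
  · intro e
    change _ ↔ σ.mem.ecount + 2 ≤ e
    rcases eq_or_ne e σ.mem.ecount with rfl | h1
    · simp [hes₁]
    rcases eq_or_ne e (σ.mem.ecount + 1) with rfl | h2
    · simp [hes₂]
    rw [(hes e h1 h2).1, I.efree]
    exact ⟨fun h => lt_of_le_of_ne (lt_of_le_of_ne h (Ne.symm h1)) (Ne.symm h2),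
      fun h => (Nat.le_add_right _ 2).trans h⟩
  · intro e w he
    rcases eq_or_ne w σ.mem.vcount with rfl | hw
    · simp [hvs']
    · rw [(hvs w hw).1]
      exact I.eowner e w ((hel e w hw).1 he)
  · intro x y hx hy hxy
    have hk₀ : ((σ.allocV t k).mem.vnode σ.mem.vcount).val = toKey k := hvs'.2.1
    simp only [vval] at hxy
    rcases eq_or_ne x σ.mem.vcount with rfl | hx' <;> rcases eq_or_ne y σ.mem.vcount with rfl | hy'
    · rfl
    · rw [(hvs y hy').2, hk₀] at hxy
      rw [(hvs y hy').1] at hy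
      exact absurd hxy.symm (hfresh y hy)
    · rw [(hvs x hx').2, hk₀] at hxy
      rw [(hvs x hx').1] at hx
      exact absurd hxy (hfresh x hx)
    · rw [(hvs x hx').2, (hvs y hy').2] at hxy
      rw [(hvs x hx').1] at hx
      rw [(hvs y hy').1] at hy
      exact I.vkey x y hx hy hxy
  · intro x k' hx hk'
    rcases eq_or_ne x σ.mem.vcount with rfl | hx'
    · rw [hvs'.2.1] at hk'
      obtain rfl := toKey_injective hk'
      exact ⟨t, hsrc⟩
    · rw [vval, (hvs x hx').2] at hk'
      rw [(hvs x hx').1] at hx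
      exact I.vsrc x k' hx hk'
  · intro w hw
    rcases eq_or_ne w σ.mem.vcount with rfl | hw'
    · rw [hvs'.2.2]
      have hne' : ∀ x, (σ.allocV t k).es x = .linked σ.mem.vcount →
        Reach (fun e => (σ.allocV t k).es e = .linked σ.mem.vcount) (σ.allocV t k).enxt
          σ.mem.ecount x := by
        intro x hx
        rcases hel₀ x hx with rfl | rfl
        · exact .refl
        · exact .single ⟨hes₁.1, by simp [enxt, hes₁, newENode]⟩
      refine ⟨hes₁.1, by simp [enval, hes₁, newENode], fun x y hx hxy => ?_,
        fun z hz _ => hne' z hz⟩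
      rcases hel₀ x hx with rfl | rfl
      · simp only [enxt, hes₁.2, newENode, Option.some.injEq] at hxy
        subst hxy
        simp [enval, hes₁, hes₂, newENode]
      · simp [enxt, hes₂, newENode] at hxy
    · rw [(hvs w hw').1] at hw
      rw [vhd, (hvs w hw').2]
      exact (hsle w hw).1
  · intro z
    refine (I.verts z).trans (exists_congr fun x => ?_)
    rw [hlk]
    refine and_congr_right fun hx => ?_
    simp only [vmk, vval, hlk' x hx]
  · intro A hA z hz
    obtain ⟨x, hx, h⟩ := I.ever A hA z hz
    exact ⟨x, (hlk x).2 hx, by rwa [vval, hlk' x hx]⟩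
  · intro x e u v he hm hx hv
    rcases eq_or_ne x σ.mem.vcount with rfl | hx'
    -- The new edge list contains sentinels only, and their infinite keys represent no vertex.
    · rcases hel₀ e he with rfl | rfl
      · simp [enval, hes₁, newENode, toKey] at hv
      · simp only [enval, hes₂, newENode, toKey] at hv
        exact absurd (WithBot.coe_injective hv.symm) (by simp)
    · rw [hel e x hx'] at he
      rw [emk, (hel' e (by simp [he])).2] at hm
      rw [enval, (hel' e (by simp [he])).2] at hv
      rw [vval, (hvs x hx').2] at hx
      exact I.edge_ever x e u v he hm hx hv
  · intro u v huv
    obtain ⟨x, e, h1, h2, h3, h4, h5⟩ := I.edge_mem u v huv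
    have h6 := hel' e (by simp [h3])
    exact ⟨x, e, (hlk x).2 h1, by rwa [vval, hlk' x h1], h6.1.trans h3, by rwa [emk, h6.2],
      by rwa [enval, h6.2]⟩
  · constructor
    · rfl
    · exact fun _ _ h => h
    · intro x hx
      have := hlk' x hx
      refine ⟨(hlk x).2 hx, ?_⟩
      simp only [vval, vmk, vlk, vnxt, this]
      exact ⟨trivial, id, fun h => ⟨h, trivial, trivial⟩⟩
    · intro e w he
      have := hel' e (by simp [he])
      refine ⟨this.1.trans he, ?_⟩
      simp only [enval, emk, elk, enxt, this.2]
      exact ⟨trivial, id, fun h => ⟨h, trivial, trivial⟩⟩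
    · intro x hx
      have := hvs x (hnf x (by simp [hx]))
      exact ⟨this.1.trans hx, this.2⟩
    · intro e he
      have := hel' e (by simp [he])
      exact ⟨this.1.trans he, this.2⟩
    · intro k' hk' h x hx
      rcases eq_or_ne x σ.mem.vcount with rfl | hx'
      · rw [hvs'.2.1]
        intro h'
        obtain rfl := toKey_injective h'
        -- The other thread would be adding the same key, which the side condition of `Guar`
        -- excludes.
        exact hmm k hm hk'
      · rw [(hvs x hx').1] at hx
        rw [vval, (hvs x hx').2]
        exact h x hx
    · intro k' x hx h
      refine h.imp_right fun h z hz hmz hvz => ?_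
      rw [hlk] at hz
      rw [vmk, hlk' z hz] at hmz
      rw [vval, hlk' z hz] at hvz
      exact hsl.2 x z (h z hz hmz hvz)
    · intro w u k' e hw hu he h
      refine h.imp_right fun h z hz hmz hvz => ?_
      rw [hel z w (hnf w (by simp [hw]))] at hz
      have h6 := hel' z (by simp [hz])
      rw [emk, h6.2] at hmz
      rw [enval, h6.2] at hvz
      exact (hsle w (by simp [hw])).2 e z (h z hz hmz hvz)

theorem Inv.guar_allocE (I : σ.Inv) {k : ℤ} : Guar t m σ (σ.allocE t k) := by
  have hec : σ.es σ.mem.ecount = .free := (I.efree _).2 le_rfl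
  have hes : ∀ e, e ≠ σ.mem.ecount → (σ.allocE t k).es e = σ.es e ∧
      (σ.allocE t k).mem.enode e = σ.mem.enode e := fun e h1 => by
    simp [allocE, Mem.allocE, h1]
  have hes₁ : (σ.allocE t k).es σ.mem.ecount = .priv t := by simp [allocE]
  have hel' : ∀ e, σ.es e ≠ .free → (σ.allocE t k).es e = σ.es e ∧
      (σ.allocE t k).mem.enode e = σ.mem.enode e := by
    intro e he
    refine hes e ?_
    rintro rfl
    exact he hec
  have hel : ∀ e w, (σ.allocE t k).es e = .linked w ↔ σ.es e = .linked w := by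
    intro e w
    rcases eq_or_ne e σ.mem.ecount with rfl | h1
    · simp [hes₁, hec]
    · rw [(hes e h1).1]
  have hsle := fun w (hw : σ.vs w ≠ .free) =>
    (I.elist w hw).marked (val' := (σ.allocE t k).enval)
    (S' := fun x => (σ.allocE t k).es x = .linked w)
    (next' := (σ.allocE t k).enxt) (mk' := (σ.allocE t k).emk)
    (fun x hx => by rw [enval, (hel' x (by simp [hx])).2])
    (fun x hx => by rw [enxt, (hel' x (by simp [hx])).2])
    (fun x => hel x w) (fun x hx => by rw [emk, (hel' x (by simp [hx])).2]; exact id)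
  refine ⟨⟨I.valid, I.vfree, ?_, ?_, I.vkey, I.vsrc, I.vlist, fun w hw => (hsle w hw).1, I.verts,
    I.ever, ?_, ?_⟩, rfl, fun t' m' ht hmm => ?_⟩
  · intro e
    change _ ↔ σ.mem.ecount + 1 ≤ e
    rcases eq_or_ne e σ.mem.ecount with rfl | h1
    · simp [hes₁]
    rw [(hes e h1).1, I.efree]
    exact ⟨fun h => lt_of_le_of_ne h (Ne.symm h1), fun h => Nat.le_of_lt h⟩
  · exact fun e w he => I.eowner e w ((hel e w).1 he)
  · intro x e u v he hm hx hv
    rw [hel e x] at he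
    rw [emk, (hel' e (by simp [he])).2] at hm
    rw [enval, (hel' e (by simp [he])).2] at hv
    exact I.edge_ever x e u v he hm hx hv
  · intro u v huv
    obtain ⟨x, e, h1, h2, h3, h4, h5⟩ := I.edge_mem u v huv
    have h6 := hel' e (by simp [h3])
    exact ⟨x, e, h1, h2, h6.1.trans h3, by rwa [emk, h6.2], by rwa [enval, h6.2]⟩
  · constructor
    · rfl
    · exact fun _ _ h => h
    · exact fun x hx => ⟨hx, rfl, id, fun h => ⟨h, rfl, rfl⟩⟩
    · intro e w he
      have := hel' e (by simp [he])
      refine ⟨this.1.trans he, ?_⟩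
      simp only [enval, emk, elk, enxt, this.2]
      exact ⟨trivial, id, fun h => ⟨h, trivial, trivial⟩⟩
    · exact fun x hx => ⟨hx, rfl⟩
    · intro e he
      have := hel' e (by simp [he])
      exact ⟨this.1.trans he, this.2⟩
    · exact fun _ _ h => h
    · exact fun _ _ _ h => h
    · intro w u k' e hw hu he h
      refine h.imp_right fun h z hz hmz hvz => ?_
      rw [hel z w] at hz
      have h6 := hel' z (by simp [hz])
      rw [emk, h6.2] at hmz
      rw [enval, h6.2] at hvz
      exact (hsle w (by simp [hw])).2 e z (h z hz hmz hvz)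

/-- The link write is the linearization point of `AddVertex`: it is the write that makes the node
reachable, and the locked window guarantees that the node fits in there. -/
theorem Inv.exists_guar_linkV (I : σ.Inv) {k : ℤ} {v₁ v₂ v₃ : VRef} (hm : m = .addVertex k)
    (hc : σ.Call t (.pend m)) (h₁ : σ.V v₁ (· < toKey k)) (h₂ : σ.V v₂ (toKey k < ·))
    (hl : σ.VL t v₁ (fun mk nx => mk = false ∧ nx = some v₂))
    (h₃ : σ.VP t v₃ (fun a mk nx => a = toKey k ∧ mk = false ∧ nx = some v₂)) :
    Guar t m σ ⟨σ.mem.setV v₁ (fun n => { n with vnext := some v₃ }), .lin t m true :: σ.log,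
        Function.update σ.vs v₃ .linked, σ.es⟩ ∧
      callState t (.lin t m true :: σ.log) = .done m true := by
  subst hm
  obtain ⟨hv₁, hk₁⟩ := h₁
  obtain ⟨hv₂, hk₂⟩ := h₂
  obtain ⟨-, hlk, hmk₁, hnx₁⟩ := hl
  obtain ⟨hv₃, hk₃, hmk₃, hnx₃⟩ := h₃
  have h31 : v₃ ≠ v₁ := by rintro rfl; rw [hv₁] at hv₃; cases hv₃
  -- Had the key ever been present, some linked node would carry it; uniqueness of keys would
  -- identify that node with `v₃`, which is still private.
  have hnew : ∀ A, A <:+ σ.log → k ∉ (graph A).verts := by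
    intro A hA hkA
    obtain ⟨x, hx, hxk⟩ := I.ever A hA k hkA
    obtain rfl := I.vkey x v₃ (by simp [hx]) (by simp [hv₃]) (hxk.trans hk₃.symm)
    rw [hx] at hv₃; cases hv₃
  have hlog : LogStep t (.addVertex k) true σ.log (.lin t (.addVertex k) true :: σ.log) := by
    refine LogStep.append I.valid ⟨hc, ⟨hnew _ List.suffix_rfl, rfl⟩, ?_, by simp⟩
    rintro z hz
    cases hz
    exact hnew
  have hmk : ∀ x, State.vmk ⟨σ.mem.setV v₁ (fun n => { n with vnext := some v₃ }),
      .lin t (.addVertex k) true :: σ.log, Function.update σ.vs v₃ .linked, σ.es⟩ x = σ.vmk x := by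
    intro x
    rcases eq_or_ne x v₁ with rfl | hx <;> simp [vmk, Mem.setV, *]
  have hS : ∀ x, Function.update σ.vs v₃ .linked x = .linked ↔ σ.vs x = .linked ∨ x = v₃ := by
    intro x
    rcases eq_or_ne x v₃ with rfl | hx <;> simp [*]
  have hsl := I.vlist.linked (n := v₃) (val' := σ.vval)
    (S' := fun x => Function.update σ.vs v₃ .linked x = .linked)
    (next' := State.vnxt ⟨σ.mem.setV v₁ (fun n => { n with vnext := some v₃ }),
      .lin t (.addVertex k) true :: σ.log, Function.update σ.vs v₃ .linked, σ.es⟩)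
    (mk' := State.vmk ⟨σ.mem.setV v₁ (fun n => { n with vnext := some v₃ }),
      .lin t (.addVertex k) true :: σ.log, Function.update σ.vs v₃ .linked, σ.es⟩)
    (fun _ _ => rfl) hS hv₁ hmk₁ hnx₁ (by simp [hv₃])
    (fun x _ hx => by simp [vnxt, Mem.setV, hx]) (by simp [vnxt, Mem.setV])
    (by simpa [vnxt, Mem.setV, h31] using hnx₃) (by rw [hk₃]; exact hk₁) (by rw [hk₃]; exact hk₂)
    (fun x _ => hmk x)
  have hlk' : ∀ x, σ.vs x = .linked → Function.update σ.vs v₃ .linked x = .linked :=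
    fun x hx => (hS x).2 (.inl hx)
  refine ⟨⟨I.setV (by simp) ?_ hlk' hlog.valid hlog.evs ?_ ?_ hsl.1 ?_ ?_, hlog.evs,
    fun t' m' ht _ => ?_⟩, hlog.done⟩
  · intro x
    rcases eq_or_ne x v₃ with rfl | hx <;> simp [*]
  · exact fun p q => EdgeEver.insert (B := []) (.inl rfl) fun he => .inl he
  · exact subset_rfl
  · intro z
    simp only [hmk]
    constructor
    · rintro (rfl | hz)
      · exact ⟨v₃, by simp, hmk₃, hk₃⟩
      · obtain ⟨x, hx, h⟩ := (I.verts z).1 hz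
        exact ⟨x, hlk' x hx, h⟩
    · rintro ⟨x, hx, hxm, hxz⟩
      rcases (hS x).1 hx with hx | rfl
      · exact .inr ((I.verts z).2 ⟨x, hx, hxm, hxz⟩)
      · exact .inl (toKey_injective (hxz.symm.trans hk₃))
  · intro A hA z hz
    rcases List.suffix_cons_iff.1 hA with rfl | hA
    · rcases hz with rfl | hz
      · exact ⟨v₃, by simp, hk₃⟩
      · obtain ⟨x, hx, h⟩ := I.ever _ List.suffix_rfl z hz
        exact ⟨x, hlk' x hx, h⟩
    · obtain ⟨x, hx, h⟩ := I.ever A hA z hz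
      exact ⟨x, hlk' x hx, h⟩
  -- For the other threads the step is split into a memory change under the old log followed by a
  -- log change under the new memory.
  · refine Rely.trans (Rely.setV (f := fun n => { n with vnext := some v₃ }) (v := v₁)
      (vs' := Function.update σ.vs v₃ .linked) (by simp) ?_ (.inl ⟨hv₁, ?_, id⟩)
      fun x z _ _ h => hsl.2 x z h) (Rely.log (hlog.call t' ht) fun P Q => hlog.cand₂ t' P Q ht)
    · intro x
      rcases eq_or_ne x v₃ with rfl | hx
      · refine .inr ⟨⟨t, Ne.symm ht, hv₃⟩, by simp, fun k' hk' => ?_⟩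
        obtain rfl := toKey_injective (hk'.symm.trans hk₃)
        exact hnew _ List.suffix_rfl
      · exact .inl (by simp [hx])
    · rw [hlk]; simp [Ne.symm ht]

/-- Marking is the linearization point of `RemoveVertex`. The incident edges leave the abstract
graph at the same instant, although their nodes stay unmarked for the time being. -/
theorem Inv.guar_markV (I : σ.Inv) {k : ℤ} {v : VRef} (hm : m = .removeVertex k)
    (hc : σ.Call t (.pend m)) (h : σ.V v (· = toKey k)) (hl : σ.VL t v (fun mk _ => mk = false)) :
    Guar t m σ ⟨σ.mem.setV v (fun n => { n with marked := true }), .lin t m true :: σ.log,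
        σ.vs, σ.es⟩ ∧
      callState t (.lin t m true :: σ.log) = .done m true := by
  subst hm
  obtain ⟨hv, hk⟩ := h
  obtain ⟨-, hlk, hmk⟩ := hl
  have hlog : LogStep t (.removeVertex k) true σ.log
      (.lin t (.removeVertex k) true :: σ.log) :=
    LogStep.append I.valid ⟨hc, ⟨(I.verts k).2 ⟨v, hv, hmk, hk⟩, rfl⟩, by simp, by simp⟩
  have hmk' : ∀ x, State.vmk ⟨σ.mem.setV v (fun n => { n with marked := true }),
      .lin t (.removeVertex k) true :: σ.log, σ.vs, σ.es⟩ x = false ↔ x ≠ v ∧ σ.vmk x = false := by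
    intro x
    rcases eq_or_ne x v with rfl | hx <;> simp [vmk, Mem.setV, *]
  have hsl := I.vlist.marked (val' := σ.vval) (S' := fun x => σ.vs x = .linked)
    (next' := State.vnxt ⟨σ.mem.setV v (fun n => { n with marked := true }),
      .lin t (.removeVertex k) true :: σ.log, σ.vs, σ.es⟩)
    (mk' := State.vmk ⟨σ.mem.setV v (fun n => { n with marked := true }),
      .lin t (.removeVertex k) true :: σ.log, σ.vs, σ.es⟩)
    (fun _ _ => rfl) (fun x _ => by
      rcases eq_or_ne x v with rfl | hx <;> simp [vnxt, Mem.setV, *])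
    (fun _ => Iff.rfl) (fun x _ h => ((hmk' x).1 h).2)
  refine ⟨⟨I.setV (by simp) (fun _ => Iff.rfl) (fun _ h => h) hlog.valid hlog.evs ?_ ?_ hsl.1 ?_
    ?_, hlog.evs, fun t' m' ht _ => ?_⟩, hlog.done⟩
  -- Edges at `k` disappear here, and this very entry is recorded as the removal that ended them.
  · refine fun p q => EdgeEver.insert (B := []) (.inl rfl) fun he => ?_
    by_cases h : k = p ∨ k = q
    · exact .inr ⟨rfl, t, k, rfl, h⟩
    · rw [not_or] at h
      exact .inl ⟨he, Ne.symm h.1, Ne.symm h.2⟩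
  · exact fun e he => he.1
  · intro z
    simp only [hmk']
    constructor
    · rintro ⟨hz, hzk⟩
      obtain ⟨x, hx, hxm, hxz⟩ := (I.verts z).1 hz
      refine ⟨x, hx, ⟨?_, hxm⟩, hxz⟩
      rintro rfl
      exact hzk (toKey_injective (hxz.symm.trans hk))
    · rintro ⟨x, hx, ⟨hxv, hxm⟩, hxz⟩
      refine ⟨(I.verts z).2 ⟨x, hx, hxm, hxz⟩, ?_⟩
      rintro rfl
      exact hxv (I.vkey x v (by simp [hx]) (by simp [hv]) (hxz.trans hk.symm))
  · intro A hA z hz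
    rcases List.suffix_cons_iff.1 hA with rfl | hA
    · exact I.ever _ List.suffix_rfl z hz.1
    · exact I.ever A hA z hz
  · refine Rely.trans (Rely.setV (f := fun n => { n with marked := true }) (v := v)
      (vs' := σ.vs) (by simp) (fun _ => .inl rfl) (.inl ⟨hv, ?_, fun _ => rfl⟩)
      fun x z _ _ h => hsl.2 x z h) (Rely.log (hlog.call t' ht) fun P Q => hlog.cand₂ t' P Q ht)
    rw [hlk]; simp [Ne.symm ht]

/-- The node being bypassed is already marked, so neither the abstract graph nor any path to an
unmarked node is affected. -/
theorem Inv.guar_unlinkV (I : σ.Inv) {v₁ v₂ : VRef} {w : Option VRef}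
    (hl : σ.VL t v₁ (fun mk nx => mk = false ∧ nx = some v₂))
    (hl' : σ.VL t v₂ (fun mk nx => mk = true ∧ nx = w)) :
    Guar t m σ ⟨σ.mem.setV v₁ (fun n => { n with vnext := w }), σ.log, σ.vs, σ.es⟩ := by
  obtain ⟨hv₁, hlk, hmk₁, hnx₁⟩ := hl
  obtain ⟨-, -, hmk₂, rfl⟩ := hl'
  have hmk : ∀ x, State.vmk ⟨σ.mem.setV v₁ (fun n => { n with vnext := σ.vnxt v₂ }),
      σ.log, σ.vs, σ.es⟩ x = σ.vmk x := by
    intro x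
    rcases eq_or_ne x v₁ with rfl | hx <;> simp [vmk, Mem.setV, *]
  have hsl := I.vlist.unlinked (val' := σ.vval) (S' := fun x => σ.vs x = .linked)
    (next' := State.vnxt ⟨σ.mem.setV v₁ (fun n => { n with vnext := σ.vnxt v₂ }),
      σ.log, σ.vs, σ.es⟩)
    (mk' := State.vmk ⟨σ.mem.setV v₁ (fun n => { n with vnext := σ.vnxt v₂ }),
      σ.log, σ.vs, σ.es⟩)
    (fun _ _ => rfl) (fun _ => Iff.rfl) hv₁ hnx₁ hmk₂ (fun x _ hx => by simp [vnxt, Mem.setV, hx])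
    (by simp [vnxt, Mem.setV]) (fun x _ => hmk x)
  refine ⟨I.setV (by simp) (fun _ => Iff.rfl) (fun _ h => h) I.valid rfl (fun _ _ h => h)
    subset_rfl hsl.1 (by simpa only [hmk] using I.verts) I.ever, rfl, fun t' m' ht _ =>
    Rely.setV (by simp) (fun _ => .inl rfl) (.inl ⟨hv₁, ?_, id⟩) fun x z _ hz h => ?_⟩
  · rw [hlk]; simp [Ne.symm ht]
  · exact hsl.2 x z (by rwa [← hmk]) h

/-- The update of the abstract graph by `AddEdge(u, v)` or `RemoveEdge(u, v)`, together with the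
update of the edge lists. -/
theorem Inv.edge_update (I : σ.Inv) {u v : ℤ} {e : ERef} {f : ENode T → ENode T}
    {es' : ERef → EStat T} {w : VRef}
    (hc : σ.Call t (.pend m)) (hm : m = .addEdge u v ∨ m = .removeEdge u v) (huv : u ≠ v)
    (hC : Cand σ.log t fun G => u ∈ G.verts ∧ v ∈ G.verts)
    (hf : ∀ n, (f n).val = n.val)
    (hfree : ∀ x, es' x = .free ↔ σ.es x = .free)
    (hw : σ.vs w = .linked) (hwu : σ.vval w = toKey u)
    (hlk : ∀ x y, σ.es x = .linked y → es' x = .linked y)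
    (hlk' : ∀ x y, es' x = .linked y → σ.es x = .linked y ∨ y = w ∧ σ.enval x = toKey v)
    (hmk : ∀ x, State.emk ⟨σ.mem.setE e f, σ.log, σ.vs, es'⟩ x = false → σ.emk x = false)
    (hmk' : ∀ x, σ.emk x = false → State.emk ⟨σ.mem.setE e f, σ.log, σ.vs, es'⟩ x = false ∨
      σ.es x = .linked w ∧ σ.enval x = toKey v)
    (hadd : m = .addEdge u v → ∃ y, es' y = .linked w ∧ σ.enval y = toKey v ∧
      State.emk ⟨σ.mem.setE e f, σ.log, σ.vs, es'⟩ y = false)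
    (hrem : m = .removeEdge u v → ∀ y, es' y = .linked w →
      State.emk ⟨σ.mem.setE e f, σ.log, σ.vs, es'⟩ y = false → σ.enval y ≠ toKey v)
    (elist : ∀ w, σ.vs w ≠ .free → SortedList (fun x => es' x = .linked w) σ.enval
      (State.enxt ⟨σ.mem.setE e f, σ.log, σ.vs, es'⟩)
      (State.emk ⟨σ.mem.setE e f, σ.log, σ.vs, es'⟩) (σ.vhd w)) :
    ∃ L', LogStep t m true σ.log L' ∧ Inv ⟨σ.mem.setE e f, L', σ.vs, es'⟩ := by
  obtain ⟨L', hL, hverts, hever, hedges, hadd', hrem', hsuff⟩ :=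
    exists_logStep_edge I.valid hc hm huv hC
  have hpair : ∀ {x y : VRef} {p q : ℤ}, σ.vs y ≠ .free → σ.vval y = toKey p → p = u → y = w := by
    rintro x y p q hy hp rfl
    exact I.vkey y w hy (by simp [hw]) (hp.trans hwu.symm)
  refine ⟨L', hL, I.setE hf hfree ?_ hL.valid hL.evs hverts hsuff elist ?_ ?_⟩
  · intro x y hx
    rcases hlk' x y hx with h | ⟨rfl, -⟩
    · exact I.eowner x y h
    · simp [hw]
  · intro x y p q hy hm' hxp hyq
    by_cases hpq : (p, q) = (u, v)
    · obtain ⟨rfl, rfl⟩ := Prod.mk.inj hpq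
      rcases hm with hm | hm
      · exact hadd' hm
      · have hx : σ.vs x ≠ .free := by
          rcases hlk' y x hy with h | ⟨rfl, -⟩
          · exact I.eowner y x h
          · simp [hw]
        obtain rfl := I.vkey x w hx (by simp [hw]) (hxp.trans hwu.symm)
        exact absurd hyq (hrem hm y hy hm')
    · refine hever p q hpq (I.edge_ever x y p q ?_ (hmk y hm') hxp hyq)
      rcases hlk' y x hy with h | ⟨rfl, h⟩
      · exact h
      · exact absurd (Prod.ext (toKey_injective (hxp.symm.trans hwu))
          (toKey_injective (hyq.symm.trans h))) hpq
  · intro p q hpq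
    by_cases hpq' : (p, q) = (u, v)
    · obtain ⟨rfl, rfl⟩ := Prod.mk.inj hpq'
      rcases hm with hm | hm
      · obtain ⟨y, h1, h2, h3⟩ := hadd hm
        exact ⟨w, y, hw, hwu, h1, h3, h2⟩
      · exact absurd hpq (hrem' hm)
    · obtain ⟨x, y, h1, h2, h3, h4, h5⟩ := I.edge_mem p q (hedges p q hpq' hpq)
      refine ⟨x, y, h1, h2, hlk y x h3, (hmk' y h4).resolve_right ?_, h5⟩
      rintro ⟨h6, h7⟩
      rw [h3] at h6
      cases h6
      exact hpq' (Prod.ext (toKey_injective (h2.symm.trans hwu))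
        (toKey_injective (h5.symm.trans h7)))

theorem setE_id (μ : Mem T) (e : ERef) : μ.setE e id = μ := by
  simp [Mem.setE]

/-- `AddEdge` finds the edge, or `RemoveEdge` does not find it. -/
theorem Inv.exists_guar_edge (I : σ.Inv) {w : VRef} (h : σ.EPre t m w)
    (hadd : m = .addEdge m.key₁ m.ekey →
      ∃ y, σ.es y = .linked w ∧ σ.enval y = toKey m.ekey ∧ σ.emk y = false)
    (hrem : m = .removeEdge m.key₁ m.ekey →
      ∀ y, σ.es y = .linked w → σ.emk y = false → σ.enval y ≠ toKey m.ekey) :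
    ∃ L', Guar t m σ ⟨σ.mem, L', σ.vs, σ.es⟩ ∧ callState t L' = .done m true := by
  obtain ⟨hc, hm, huv, ⟨hw, hwu⟩, hC⟩ := h
  -- Nothing is written: the general update is used with the identity on an arbitrary node.
  have key := I.edge_update (e := 0) (f := id) (es' := σ.es) hc hm huv hC (fun _ => rfl)
    (fun _ => Iff.rfl) hw hwu (fun _ _ h => h) (fun _ _ h => .inl h)
  rw [setE_id] at key
  obtain ⟨L', hL, hI⟩ := key (fun _ h => h) (fun _ h => .inl h) hadd hrem I.elist
  exact ⟨L', ⟨hI, hL.evs, fun t' m' ht _ =>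
    Rely.log (hL.call t' ht) fun P Q => hL.cand₂ t' P Q ht⟩, hL.done⟩

/-- An endpoint may have been removed since the checks of the marks. The node is linked all the
same, and the linearization point is then placed in the past. -/
theorem Inv.exists_guar_linkE (I : σ.Inv) {w : VRef} {e₁ e₂ e₃ : ERef} (h : σ.EPre t m w)
    (hm : m = .addEdge m.key₁ m.ekey) (h₁ : σ.E w e₁ (· < toKey m.ekey))
    (h₂ : σ.E w e₂ (toKey m.ekey < ·))
    (hl : σ.EL t w e₁ (fun mk nx => mk = false ∧ nx = some e₂))
    (h₃ : σ.EP t e₃ (fun a mk nx => a = toKey m.ekey ∧ mk = false ∧ nx = some e₂)) :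
    ∃ L', Guar t m σ ⟨σ.mem.setE e₁ (fun n => { n with enext := some e₃ }), L',
        σ.vs, Function.update σ.es e₃ (.linked w)⟩ ∧
      callState t L' = .done m true := by
  obtain ⟨hc, -, huv, ⟨hw, hwu⟩, hC⟩ := h
  obtain ⟨he₁, hk₁⟩ := h₁
  obtain ⟨he₂, hk₂⟩ := h₂
  obtain ⟨-, hlk, hmk₁, hnx₁⟩ := hl
  obtain ⟨he₃, hk₃, hmk₃, hnx₃⟩ := h₃
  have h31 : e₃ ≠ e₁ := by rintro rfl; rw [he₁] at he₃; cases he₃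
  have hmk : ∀ x, State.emk ⟨σ.mem.setE e₁ (fun n => { n with enext := some e₃ }), σ.log,
      σ.vs, Function.update σ.es e₃ (.linked w)⟩ x = σ.emk x := by
    intro x
    rcases eq_or_ne x e₁ with rfl | hx <;> simp [emk, Mem.setE, *]
  have hS : ∀ x y, Function.update σ.es e₃ (.linked w) x = .linked y ↔
      σ.es x = .linked y ∨ x = e₃ ∧ y = w := by
    intro x y
    rcases eq_or_ne x e₃ with rfl | hx
    · simp [he₃, eq_comm]
    · simp [hx]
  have hsl : ∀ y, σ.vs y ≠ .free →
      SortedList (fun x => Function.update σ.es e₃ (.linked w) x = .linked y) σ.enval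
        (State.enxt ⟨σ.mem.setE e₁ (fun n => { n with enext := some e₃ }), σ.log,
          σ.vs, Function.update σ.es e₃ (.linked w)⟩)
        (State.emk ⟨σ.mem.setE e₁ (fun n => { n with enext := some e₃ }), σ.log,
          σ.vs, Function.update σ.es e₃ (.linked w)⟩) (σ.vhd y) ∧
      ∀ a z, σ.EReach y a z → State.EReach ⟨σ.mem.setE e₁ (fun n => { n with enext := some e₃ }),
        σ.log, σ.vs, Function.update σ.es e₃ (.linked w)⟩ y a z := by
    intro y hy
    rcases eq_or_ne y w with rfl | hyw
    -- Only the edge list of `w` gains a node; the other lists do not contain `e₁` and are not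
    -- changed.
    · exact (I.elist y hy).linked (n := e₃) (fun _ _ => rfl) (fun x => by simp [hS]) he₁ hmk₁ hnx₁
        (by simp [he₃]) (fun x _ hx => by simp [enxt, Mem.setE, hx]) (by simp [enxt, Mem.setE])
        (by simpa [enxt, Mem.setE, h31] using hnx₃) (by rw [hk₃]; exact hk₁)
        (by rw [hk₃]; exact hk₂) (fun x _ => hmk x)
    · refine (I.elist y hy).marked (fun _ _ => rfl) (fun x hx => ?_) (fun x => by simp [hS, hyw])
        (fun x _ => by rw [hmk]; exact id)
      have hx1 : x ≠ e₁ := by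
        rintro rfl
        rw [he₁] at hx
        cases hx
        exact hyw rfl
      simp [enxt, Mem.setE, hx1]
  obtain ⟨L', hL, hI⟩ := I.edge_update (e := e₁) (f := fun n => { n with enext := some e₃ })
    (es' := Function.update σ.es e₃ (.linked w)) hc (.inl hm) huv hC (fun _ => rfl)
    (fun x => by rcases eq_or_ne x e₃ with rfl | hx <;> simp [*]) hw hwu
    (fun x y h => (hS x y).2 (.inl h))
    (fun x y h => ((hS x y).1 h).imp_right (by rintro ⟨rfl, rfl⟩; exact ⟨rfl, hk₃⟩))
    (fun x h => by rwa [hmk] at h) (fun x h => .inl (by rwa [hmk]))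
    (fun _ => ⟨e₃, by simp, hk₃, by rwa [hmk]⟩) (fun h => by rw [hm] at h; cases h)
    (fun y hy => (hsl y hy).1)
  refine ⟨L', ⟨hI, hL.evs, fun t' m' ht _ => ?_⟩, hL.done⟩
  refine Rely.trans (Rely.setE (f := fun n => { n with enext := some e₃ }) (e := e₁)
    (es' := Function.update σ.es e₃ (.linked w)) (by simp) ?_ (.inl ⟨⟨w, he₁⟩, ?_, id⟩)
    fun y x z hz _ h => (hsl y (I.eowner z y hz)).2 x z h)
    (Rely.log (hL.call t' ht) fun P Q => hL.cand₂ t' P Q ht)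
  · intro x
    rcases eq_or_ne x e₃ with rfl | hx
    -- The edge cannot have been present before: its unmarked node would lie behind `e₁` and before
    -- `e₂`, where the sorted list has no room.
    · refine .inr ⟨⟨t, Ne.symm ht, he₃⟩, w, by simp, fun u k hu hk hmem => ?_⟩
      obtain ⟨w', y, h1, h2, h3, h4, h5⟩ := I.edge_mem u k hmem
      obtain rfl := I.vkey w' w (by simp [h1]) (by simp [hw]) (h2.trans hu.symm)
      have hyk : σ.enval y = toKey m.ekey := h5.trans (hk.symm.trans hk₃)
      have := (I.elist w' (by simp [h1])).eq_of_between he₁ hmk₁ hnx₁ h3 h4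
        (by rw [hyk]; exact hk₁) (by rw [hyk]; exact hk₂.le)
      subst this
      exact hk₂.ne hyk.symm
    · exact .inl (by simp [hx])
  · rw [hlk]; simp [Ne.symm ht]

theorem Inv.markE_list (I : σ.Inv) {e : ERef} (L' : Log T) (y : VRef) (hy : σ.vs y ≠ .free) :
    SortedList (fun x => σ.es x = .linked y) σ.enval
        (State.enxt ⟨σ.mem.setE e (fun n => { n with marked := true }), L', σ.vs, σ.es⟩)
        (State.emk ⟨σ.mem.setE e (fun n => { n with marked := true }), L', σ.vs, σ.es⟩)
        (σ.vhd y) ∧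
      ∀ a z, σ.EReach y a z →
        State.EReach ⟨σ.mem.setE e (fun n => { n with marked := true }), L', σ.vs, σ.es⟩ y a z := by
  refine (I.elist y hy).marked (fun _ _ => rfl) (fun x _ => ?_) (fun _ => Iff.rfl) (fun x _ => ?_)
  · rcases eq_or_ne x e with rfl | hx <;> simp [enxt, Mem.setE, *]
  · rcases eq_or_ne x e with rfl | hx <;> simp [emk, Mem.setE, *]

theorem Inv.exists_guar_markE (I : σ.Inv) {w : VRef} {e : ERef} (h : σ.EPre t m w)
    (hm : m = .removeEdge m.key₁ m.ekey) (he : σ.E w e (· = toKey m.ekey))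
    (hl : σ.EL t w e (fun mk _ => mk = false)) :
    ∃ L', Guar t m σ ⟨σ.mem.setE e (fun n => { n with marked := true }), L', σ.vs, σ.es⟩ ∧
      callState t L' = .done m true := by
  obtain ⟨hc, -, huv, ⟨hw, hwu⟩, hC⟩ := h
  obtain ⟨he, hk⟩ := he
  obtain ⟨-, hlk, hmk⟩ := hl
  have hmk' : ∀ x, State.emk ⟨σ.mem.setE e (fun n => { n with marked := true }), σ.log, σ.vs,
      σ.es⟩ x = false ↔ x ≠ e ∧ σ.emk x = false := by
    intro x
    rcases eq_or_ne x e with rfl | hx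
    · simp [emk, Mem.setE]
    · simp [emk, Mem.setE, hx]
  obtain ⟨L', hL, hI⟩ := I.edge_update (e := e) (f := fun n => { n with marked := true })
    (es' := σ.es) hc (.inr hm) huv hC (fun _ => rfl) (fun x => Iff.rfl) hw hwu (fun x y h => h)
    (fun x y h => .inl h) (fun x h => ((hmk' x).1 h).2)
    (fun x h => by
      rcases eq_or_ne x e with rfl | hx
      · exact .inr ⟨he, hk⟩
      · exact .inl ((hmk' x).2 ⟨hx, h⟩))
    (fun h => by rw [hm] at h; cases h)
    -- An edge list has at most one unmarked node for each key, so none is left after the marking.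
    (fun _ y hy hym hyk => ((hmk' y).1 hym).1 ((I.elist w (by simp [hw])).eq_of_val_eq hy he
      ((hmk' y).1 hym).2 hmk (hyk.trans hk.symm)))
    (fun y hy => (I.markE_list _ y hy).1)
  refine ⟨L', ⟨hI, hL.evs, fun t' m' ht _ => ?_⟩, hL.done⟩
  refine Rely.trans (Rely.setE (f := fun n => { n with marked := true }) (e := e)
    (es' := σ.es) (by simp) (fun _ => .inl rfl) (.inl ⟨⟨w, he⟩, ?_, fun _ => rfl⟩)
    fun y x z hz _ h => (I.markE_list _ y (I.eowner z y hz)).2 x z h)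
    (Rely.log (hL.call t' ht) fun P Q => hL.cand₂ t' P Q ht)
  rw [hlk]; simp [Ne.symm ht]

/-- The marked node is the only node that will ever carry this key. -/
theorem Inv.not_mem_of_dead (I : σ.Inv) {k : ℤ} (h : σ.Dead k) : k ∉ (graph σ.log).verts := by
  obtain ⟨v, hv, hmk, hk⟩ := h
  intro hmem
  obtain ⟨x, hx, hxm, hxk⟩ := (I.verts k).1 hmem
  obtain rfl := I.vkey x v (by simp [hx]) (by simp [hv]) (hxk.trans hk.symm)
  rw [hmk] at hxm; cases hxm

/-- `RemoveIncomingEdge` marks an edge node. -/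
theorem Inv.guar_scanE (I : σ.Inv) {k : ℤ} {w : VRef} {e : ERef} (hd : σ.Dead k)
    (he : σ.E w e (· = toKey k)) (hl : σ.EL t w e (fun mk _ => mk = false)) :
    Guar t m σ ⟨σ.mem.setE e (fun n => { n with marked := true }), σ.log, σ.vs, σ.es⟩ := by
  obtain ⟨he, hk⟩ := he
  obtain ⟨-, hlk, hmk⟩ := hl
  have hmk' : ∀ x, State.emk ⟨σ.mem.setE e (fun n => { n with marked := true }), σ.log, σ.vs,
      σ.es⟩ x = false ↔ x ≠ e ∧ σ.emk x = false := by
    intro x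
    rcases eq_or_ne x e with rfl | hx <;> simp [emk, Mem.setE, *]
  refine ⟨I.setE (fun _ => rfl) (fun _ => Iff.rfl) I.eowner I.valid rfl rfl
    (fun A hA => ⟨A, hA, rfl⟩) (fun y hy => (I.markE_list _ y hy).1)
    (fun x y u v hy hm hx hv => I.edge_ever x y u v hy ((hmk' y).1 hm).2 hx hv) ?_, rfl,
    fun t' m' ht _ => Rely.setE (fun _ => rfl) (fun _ => .inl rfl)
      (.inl ⟨⟨w, he⟩, ?_, fun _ => rfl⟩)
      fun y x z hz _ h => (I.markE_list _ y (I.eowner z y hz)).2 x z h⟩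
  -- An edge present in the abstract graph has live endpoints, so it is not represented by the node
  -- being marked, whose key is dead.
  · intro u v huv
    obtain ⟨x, y, h1, h2, h3, h4, h5⟩ := I.edge_mem u v huv
    refine ⟨x, y, h1, h2, h3, (hmk' y).2 ⟨?_, h4⟩, h5⟩
    rintro rfl
    obtain rfl := toKey_injective (h5.symm.trans hk)
    exact I.not_mem_of_dead hd (I.valid.edges huv).2.1
  · rw [hlk]; simp [Ne.symm ht]

theorem Inv.guar_unlinkE (I : σ.Inv) {w : VRef} {e₁ e₂ : ERef} {x : Option ERef}
    (hl : σ.EL t w e₁ (fun mk nx => mk = false ∧ nx = some e₂))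
    (hl' : σ.EL t w e₂ (fun mk nx => mk = true ∧ nx = x)) :
    Guar t m σ ⟨σ.mem.setE e₁ (fun n => { n with enext := x }), σ.log, σ.vs, σ.es⟩ := by
  obtain ⟨he₁, hlk, hmk₁, hnx₁⟩ := hl
  obtain ⟨-, -, hmk₂, rfl⟩ := hl'
  have hmk : ∀ x, State.emk ⟨σ.mem.setE e₁ (fun n => { n with enext := σ.enxt e₂ }),
      σ.log, σ.vs, σ.es⟩ x = σ.emk x := by
    intro x
    rcases eq_or_ne x e₁ with rfl | hx
    · simp [emk, Mem.setE]
    · simp [emk, Mem.setE, hx]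
  have hsl : ∀ y, σ.vs y ≠ .free →
      SortedList (fun x => σ.es x = .linked y) σ.enval
        (State.enxt ⟨σ.mem.setE e₁ (fun n => { n with enext := σ.enxt e₂ }), σ.log, σ.vs, σ.es⟩)
        (State.emk ⟨σ.mem.setE e₁ (fun n => { n with enext := σ.enxt e₂ }), σ.log, σ.vs, σ.es⟩)
        (σ.vhd y) ∧
      ∀ a z, σ.emk z = false → σ.EReach y a z → State.EReach
        ⟨σ.mem.setE e₁ (fun n => { n with enext := σ.enxt e₂ }), σ.log, σ.vs, σ.es⟩ y a z := by
    intro y hy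
    rcases eq_or_ne y w with rfl | hyw
    · exact (I.elist y hy).unlinked (fun _ _ => rfl) (fun x => Iff.rfl) he₁ hnx₁ hmk₂
        (fun x _ hx => by simp [enxt, Mem.setE, hx]) (by simp [enxt, Mem.setE]) (fun x _ => hmk x)
    · have := (I.elist y hy).marked (val' := σ.enval) (S' := fun x => σ.es x = .linked y)
        (next' := State.enxt ⟨σ.mem.setE e₁ (fun n => { n with enext := σ.enxt e₂ }), σ.log,
          σ.vs, σ.es⟩)
        (mk' := State.emk ⟨σ.mem.setE e₁ (fun n => { n with enext := σ.enxt e₂ }), σ.log,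
          σ.vs, σ.es⟩) (fun _ _ => rfl) (fun x hx => ?_) (fun x => Iff.rfl)
        (fun x _ => by rw [hmk]; exact id)
      · exact ⟨this.1, fun a z _ h => this.2 a z h⟩
      · have hx1 : x ≠ e₁ := by
          rintro rfl
          rw [he₁] at hx
          cases hx
          exact hyw rfl
        simp [enxt, Mem.setE, hx1]
  refine ⟨I.setE (fun _ => rfl) (fun _ => Iff.rfl) I.eowner I.valid rfl rfl
    (fun A hA => ⟨A, hA, rfl⟩) (fun y hy => (hsl y hy).1) (by simpa only [hmk] using I.edge_ever)
    (by simpa only [hmk] using I.edge_mem), rfl,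
    fun t' m' ht _ => Rely.setE (fun _ => rfl) (fun _ => .inl rfl) (.inl ⟨⟨w, he₁⟩, ?_, id⟩)
      fun y x z hz hm h => (hsl y (I.eowner z y hz)).2 x z (by rwa [← hmk]) h⟩
  rw [hlk]; simp [Ne.symm ht]

end State

end ConcGraph

namespace ConcGraph

variable {T : Type*} [DecidableEq T]

namespace State

variable {t t' : T} {m m' : Method} {σ σ' σ'' : State T}

/-! ## Assertions after a change of the memory -/

section Transfer

variable {v x : VRef} {f : VNode T → VNode T} {vs' : VRef → VStat T} {es' : ERef → EStat T}
  {L' : Log T} {e y : ERef} {g : ENode T → ENode T} {w : VRef}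

theorem V.setV {P : NodeKey → Prop} (h : σ.V x P) (hf : ∀ n, (f n).val = n.val)
    (hx : vs' x = .linked) : State.V ⟨σ.mem.setV v f, L', vs', es'⟩ x P := by
  refine ⟨hx, ?_⟩
  rcases eq_or_ne x v with rfl | hxv
  · simpa [vval, Mem.setV, hf] using h.2
  · simpa [vval, Mem.setV, hxv] using h.2

theorem VL.setV_ne {Q : Bool → Option VRef → Prop} (h : σ.VL t x Q) (hxv : x ≠ v)
    (hx : vs' x = .linked) : State.VL ⟨σ.mem.setV v f, L', vs', es'⟩ t x Q :=
  ⟨hx, by simpa [vlk, Mem.setV, hxv] using h.2.1,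
    by simpa [vmk, vnxt, Mem.setV, hxv] using h.2.2⟩

theorem VL.setV_self {Q : Bool → Option VRef → Prop} (hx : vs' v = .linked)
    (hl : (f (σ.mem.vnode v)).lock = some t)
    (hQ : Q (f (σ.mem.vnode v)).marked (f (σ.mem.vnode v)).vnext) :
    State.VL ⟨σ.mem.setV v f, L', vs', es'⟩ t v Q :=
  ⟨hx, by simpa [vlk, Mem.setV] using hl, by simpa [vmk, vnxt, Mem.setV] using hQ⟩

theorem VP.setV_self {Q : NodeKey → Bool → Option VRef → Prop} (hx : vs' v = .priv t)
    (hQ : Q (f (σ.mem.vnode v)).val (f (σ.mem.vnode v)).marked (f (σ.mem.vnode v)).vnext) :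
    State.VP ⟨σ.mem.setV v f, L', vs', es'⟩ t v Q :=
  ⟨hx, by simpa [vval, vmk, vnxt, Mem.setV] using hQ⟩

theorem Fresh.setV (h : σ.Fresh m) (hf : ∀ n, (f n).val = n.val) :
    State.Fresh ⟨σ.mem.setV v f, L', σ.vs, es'⟩ m := by
  intro k hk y hy
  rcases eq_or_ne y v with rfl | hyv
  · simpa [vval, Mem.setV, hf] using h k hk y hy
  · simpa [vval, Mem.setV, hyv] using h k hk y hy

theorem VPre.setV (h : σ.VPre t m) (hf : ∀ n, (f n).val = n.val) :
    State.VPre ⟨σ.mem.setV v f, σ.log, σ.vs, es'⟩ t m :=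
  ⟨h.1, h.2.1.setV hf, h.2.2⟩

theorem Dead.setV {k : ℤ} (h : σ.Dead k) (hf : ∀ n, (f n).val = n.val)
    (hf' : ∀ n, n.marked = true → (f n).marked = true) :
    State.Dead ⟨σ.mem.setV v f, L', σ.vs, es'⟩ k := by
  obtain ⟨x, hx, hm, hk⟩ := h
  refine ⟨x, hx, ?_⟩
  rcases eq_or_ne x v with rfl | hxv
  · simp [vmk, vval, Mem.setV, hf, hf' _ hm, hk]
  · simp [vmk, vval, Mem.setV, hxv, hm, hk]

theorem XA.setV {b : VExit} (h : σ.XA t m b) (hf : ∀ n, (f n).val = n.val)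
    (hf' : ∀ n, n.marked = true → (f n).marked = true) :
    State.XA ⟨σ.mem.setV v f, σ.log, σ.vs, es'⟩ t m b := by
  cases b
  · exact VPre.setV h hf
  · exact h
  · exact ⟨h.1, h.2.1, h.2.2.setV hf hf'⟩

theorem E.setE {P : NodeKey → Prop} (h : σ.E w y P) (hf : ∀ n, (g n).val = n.val)
    (hx : es' y = .linked w) : State.E ⟨σ.mem.setE e g, L', vs', es'⟩ w y P := by
  refine ⟨hx, ?_⟩
  rcases eq_or_ne y e with rfl | hxv
  · simpa [enval, Mem.setE, hf] using h.2
  · simpa [enval, Mem.setE, hxv] using h.2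

theorem EL.setE_ne {Q : Bool → Option ERef → Prop} (h : σ.EL t w y Q) (hxv : y ≠ e)
    (hx : es' y = .linked w) : State.EL ⟨σ.mem.setE e g, L', vs', es'⟩ t w y Q :=
  ⟨hx, by simpa [elk, Mem.setE, hxv] using h.2.1,
    by simpa [emk, enxt, Mem.setE, hxv] using h.2.2⟩

theorem EL.setE_self {Q : Bool → Option ERef → Prop} (hx : es' e = .linked w)
    (hl : (g (σ.mem.enode e)).lock = some t)
    (hQ : Q (g (σ.mem.enode e)).marked (g (σ.mem.enode e)).enext) :
    State.EL ⟨σ.mem.setE e g, L', vs', es'⟩ t w e Q :=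
  ⟨hx, by simpa [elk, Mem.setE] using hl, by simpa [emk, enxt, Mem.setE] using hQ⟩

theorem EP.setE_self {Q : NodeKey → Bool → Option ERef → Prop} (hx : es' e = .priv t)
    (hQ : Q (g (σ.mem.enode e)).val (g (σ.mem.enode e)).marked (g (σ.mem.enode e)).enext) :
    State.EP ⟨σ.mem.setE e g, L', vs', es'⟩ t e Q :=
  ⟨hx, by simpa [enval, emk, enxt, Mem.setE] using hQ⟩

theorem V.mono {P Q : NodeKey → Prop} (h : σ.V x P) (hPQ : ∀ k, P k → Q k) : σ.V x Q :=
  ⟨h.1, hPQ _ h.2⟩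

theorem VL.mono {P Q : Bool → Option VRef → Prop} (h : σ.VL t x P) (hPQ : ∀ a b, P a b → Q a b) :
    σ.VL t x Q :=
  ⟨h.1, h.2.1, hPQ _ _ h.2.2⟩

theorem E.mono {P Q : NodeKey → Prop} (h : σ.E w y P) (hPQ : ∀ k, P k → Q k) : σ.E w y Q :=
  ⟨h.1, hPQ _ h.2⟩

theorem EL.mono {P Q : Bool → Option ERef → Prop} (h : σ.EL t w y P)
    (hPQ : ∀ a b, P a b → Q a b) : σ.EL t w y Q :=
  ⟨h.1, h.2.1, hPQ _ _ h.2.2⟩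

theorem Inv.allocV_vnode (I : σ.Inv) {k : ℤ} (hx : σ.vs x = .linked) :
    (σ.allocV t k).vs x = .linked ∧ (σ.allocV t k).mem.vnode x = σ.mem.vnode x := by
  have hne : x ≠ σ.mem.vcount := by
    rintro rfl
    rw [(I.vfree _).2 le_rfl] at hx
    cases hx
  simp [allocV, Mem.allocV, hne, hx]

theorem Inv.allocE_enode (I : σ.Inv) {k : ℤ} (hy : σ.es y = .linked w) :
    (σ.allocE t k).es y = .linked w ∧ (σ.allocE t k).mem.enode y = σ.mem.enode y := by
  have hne : y ≠ σ.mem.ecount := by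
    rintro rfl
    rw [(I.efree _).2 le_rfl] at hy
    cases hy
  simp [allocE, Mem.allocE, hne, hy]

theorem V.allocV (I : σ.Inv) {k : ℤ} {P : NodeKey → Prop} (h : σ.V x P) :
    (σ.allocV t k).V x P := by
  have := I.allocV_vnode (t := t) (k := k) h.1
  exact ⟨this.1, by rw [vval, this.2]; exact h.2⟩

theorem VL.allocV (I : σ.Inv) {k : ℤ} {Q : Bool → Option VRef → Prop} (h : σ.VL t' x Q) :
    (σ.allocV t k).VL t' x Q := by
  have := I.allocV_vnode (t := t) (k := k) h.1
  refine ⟨this.1, ?_⟩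
  rw [vlk, vmk, vnxt, this.2]
  exact h.2

theorem E.allocE (I : σ.Inv) {k : ℤ} {P : NodeKey → Prop} (h : σ.E w y P) :
    (σ.allocE t k).E w y P := by
  have := I.allocE_enode (t := t) (k := k) h.1
  exact ⟨this.1, by rw [enval, this.2]; exact h.2⟩

theorem EL.allocE (I : σ.Inv) {k : ℤ} {Q : Bool → Option ERef → Prop} (h : σ.EL t' w y Q) :
    (σ.allocE t k).EL t' w y Q := by
  have := I.allocE_enode (t := t) (k := k) h.1
  refine ⟨this.1, ?_⟩
  rw [elk, emk, enxt, this.2]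
  exact h.2

end Transfer

/-! ## The steps of a thread -/

/-- The step to the memory `μ'` and the program point `p'` is sound. -/
def Next (σ : State T) (t : T) (m : Method) (μ' : Mem T) (p' : Pc) : Prop :=
  ∃ σ', σ'.mem = μ' ∧ Guar t m σ σ' ∧ σ'.At t m p'

variable {μ' : Mem T} {p p' : Pc}

theorem Inv.next (I : σ.Inv) (h : σ.At t m p') : σ.Next t m σ.mem p' := ⟨σ, rfl, I.guar_refl, h⟩

theorem Guar.next (hG : Guar t m σ σ') (h : σ'.At t m p') : σ.Next t m σ'.mem p' :=
  ⟨σ', rfl, hG, h⟩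

theorem Inv.next_lin (I : σ.Inv) {b : Bool} (hc : σ.Call t (.pend m))
    (hC : Cand σ.log t fun G => Spec G m b G ∧ m.effect b G = G)
    (hm₁ : ∀ z, m ≠ .addVertex z) (hm₂ : ∀ u v, m = .addEdge u v → u ≠ v) :
    σ.Next t m σ.mem (.ret b) := by
  obtain ⟨L', hG, hd⟩ := I.exists_guar_lin hc hC hm₁ hm₂
  exact hG.next hd

theorem bot_lt_toKey (k : ℤ) : (⊥ : NodeKey) < toKey k := WithBot.bot_lt_coe _

theorem Inv.V_head (I : σ.Inv) (k : ℤ) : σ.V vertexHead (· < toKey k) :=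
  ⟨I.vlist.head_mem, by rw [I.vlist.head_val]; exact bot_lt_toKey k⟩

theorem Inv.E_head (I : σ.Inv) {w : VRef} (hw : σ.vs w = .linked) (k : ℤ) :
    σ.E w (σ.vhd w) (· < toKey k) :=
  have := I.elist w (by simp [hw])
  ⟨this.head_mem, by rw [this.head_val]; exact bot_lt_toKey k⟩

theorem Inv.V_next (I : σ.Inv) {v v' : VRef} {P : NodeKey → Prop} (h : σ.V v P)
    (hn : σ.vnxt v = some v') : σ.V v' (σ.vval v < ·) :=
  I.vlist.next_mem v v' h.1 hn

theorem Inv.E_next (I : σ.Inv) {w : VRef} {e e' : ERef} {P : NodeKey → Prop} (h : σ.E w e P)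
    (hn : σ.enxt e = some e') : σ.E w e' (σ.enval e < ·) :=
  (I.elist w (I.eowner e w h.1)).next_mem e e' h.1 hn

theorem V.ne {a b : VRef} {k : ℤ} (h₁ : σ.V a (· < toKey k)) (h₂ : σ.V b (toKey k ≤ ·)) :
    a ≠ b := by
  rintro rfl
  exact absurd h₂.2 h₁.2.not_ge

theorem E.ne {w : VRef} {a b : ERef} {k : ℤ} (h₁ : σ.E w a (· < toKey k))
    (h₂ : σ.E w b (toKey k ≤ ·)) : a ≠ b := by
  rintro rfl
  exact absurd h₂.2 h₁.2.not_ge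

/-! ### Steps of the vertex list updates. -/

section LocateVertex

variable {v₁ v₂ v₃ : VRef} {x : VExit}

theorem Inv.step_lvHead (I : σ.Inv) (h : σ.At t m .lvHead)
    (hs : step t m σ.mem .lvHead = some (μ', p')) : σ.Next t m μ' p' := by
  simp only [step, Option.some.injEq, Prod.mk.injEq] at hs
  obtain ⟨rfl, rfl⟩ := hs
  exact I.next ⟨h, I.V_head _⟩

theorem Inv.step_lvNext (I : σ.Inv) (h : σ.At t m (.lvNext v₁))
    (hs : step t m σ.mem (.lvNext v₁) = some (μ', p')) : σ.Next t m μ' p' := by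
  simp only [step] at hs
  split at hs
  · next v₂ hv =>
    simp only [Option.some.injEq, Prod.mk.injEq] at hs
    obtain ⟨rfl, rfl⟩ := hs
    exact I.next ⟨h.1, h.2, (I.V_next h.2 hv).mono fun _ _ => trivial⟩
  · cases hs

theorem Inv.step_lvTest (I : σ.Inv) (h : σ.At t m (.lvTest v₁ v₂))
    (hs : step t m σ.mem (.lvTest v₁ v₂) = some (μ', p')) : σ.Next t m μ' p' := by
  simp only [step, Option.some.injEq, Prod.mk.injEq] at hs
  obtain ⟨rfl, rfl⟩ := hs
  obtain ⟨h1, h2, h3⟩ := h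
  split_ifs with hc
  · exact I.next ⟨h1, h3.1, hc⟩
  · exact I.next ⟨h1, h2, h3.1, not_lt.1 hc⟩

theorem Inv.step_lvLock1 (I : σ.Inv) (h : σ.At t m (.lvLock1 v₁ v₂))
    (hs : step t m σ.mem (.lvLock1 v₁ v₂) = some (μ', p')) : σ.Next t m μ' p' := by
  simp only [step] at hs
  split at hs
  · cases hs
  · next hv =>
    simp only [Option.some.injEq, Prod.mk.injEq] at hs
    obtain ⟨rfl, rfl⟩ := hs
    obtain ⟨h1, h2, h3⟩ := h
    exact Guar.next (I.guar_setV (f := fun n => { n with lock := some t })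
      (fun _ => ⟨rfl, rfl, rfl⟩) (.inl ⟨h2.1, .inl hv, fun _ => rfl⟩)) ⟨
      h1.setV fun _ => rfl, h2.setV (fun _ => rfl) h2.1, h3.setV (fun _ => rfl) h3.1,
      VL.setV_self h2.1 rfl trivial⟩

theorem Inv.step_lvLock2 (I : σ.Inv) (h : σ.At t m (.lvLock2 v₁ v₂))
    (hs : step t m σ.mem (.lvLock2 v₁ v₂) = some (μ', p')) : σ.Next t m μ' p' := by
  simp only [step] at hs
  split at hs
  · cases hs
  · next hv =>
    simp only [Option.some.injEq, Prod.mk.injEq] at hs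
    obtain ⟨rfl, rfl⟩ := hs
    obtain ⟨h1, h2, h3, h4⟩ := h
    exact Guar.next (I.guar_setV (f := fun n => { n with lock := some t })
      (fun _ => ⟨rfl, rfl, rfl⟩) (.inl ⟨h3.1, .inl hv, fun _ => rfl⟩)) ⟨
      h1.setV fun _ => rfl, h2.setV (fun _ => rfl) h2.1, h3.setV (fun _ => rfl) h3.1,
      h4.setV_ne (h2.ne h3) h2.1, VL.setV_self h3.1 rfl trivial⟩

theorem Inv.step_lvValid1 (I : σ.Inv) (h : σ.At t m (.lvValid1 v₁ v₂))
    (hs : step t m σ.mem (.lvValid1 v₁ v₂) = some (μ', p')) : σ.Next t m μ' p' := by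
  simp only [step, Option.some.injEq, Prod.mk.injEq] at hs
  obtain ⟨rfl, rfl⟩ := hs
  obtain ⟨h1, h2, h3, h4, h5⟩ := h
  split_ifs with hc
  · exact I.next ⟨h1, h2, h3, ⟨h4.1, h4.2.1, hc⟩, h5⟩
  · exact I.next ⟨h1, h2.ne h3, h4, h5⟩

theorem Inv.step_lvValid2 (I : σ.Inv) (h : σ.At t m (.lvValid2 v₁ v₂))
    (hs : step t m σ.mem (.lvValid2 v₁ v₂) = some (μ', p')) : σ.Next t m μ' p' := by
  simp only [step, Option.some.injEq, Prod.mk.injEq] at hs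
  obtain ⟨rfl, rfl⟩ := hs
  obtain ⟨h1, h2, h3, h4, h5⟩ := h
  split_ifs with hc
  · exact I.next ⟨h1, h2, h3, h4, h5.1, h5.2.1, hc⟩
  · exact I.next ⟨h1, h2.ne h3, h4.mono fun _ _ _ => trivial, h5⟩

theorem Inv.step_lvValid3 (I : σ.Inv) (h : σ.At t m (.lvValid3 v₁ v₂))
    (hs : step t m σ.mem (.lvValid3 v₁ v₂) = some (μ', p')) : σ.Next t m μ' p' := by
  simp only [step, Option.some.injEq, Prod.mk.injEq] at hs
  obtain ⟨rfl, rfl⟩ := hs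
  obtain ⟨h1, h2, h3, h4, h5⟩ := h
  split_ifs with hc
  · exact I.next ⟨h1, h2, h3, ⟨h4.1, h4.2.1, h4.2.2, hc⟩, h5⟩
  · exact I.next ⟨h1, h2.ne h3, h4.mono fun _ _ _ => trivial, h5.mono fun _ _ _ => trivial⟩

/-- In a validated window the second node is the only candidate for the key. -/
theorem Inv.not_mem_of_VWin (I : σ.Inv) (h : σ.VWin t m v₁ v₂) (hk : σ.vval v₂ ≠ toKey m.key₁) :
    m.key₁ ∉ (graph σ.log).verts := by
  obtain ⟨h1, h2, h3, h4⟩ := h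
  intro hmem
  obtain ⟨x, hx, hxm, hxk⟩ := (I.verts _).1 hmem
  have := I.vlist.eq_of_between h1.1 h3.2.2.1 h3.2.2.2 hx hxm (by rw [hxk]; exact h1.2)
    (by rw [hxk]; exact h2.2)
  subst this
  exact hk hxk

theorem Inv.step_vTest (I : σ.Inv) (h : σ.At t m (.vTest v₁ v₂))
    (hs : step t m σ.mem (.vTest v₁ v₂) = some (μ', p')) : σ.Next t m μ' p' := by
  obtain ⟨h1, h2⟩ := h
  rcases h1.2.2 with hm | hm
  · rw [hm] at hs
    simp only [step, Option.some.injEq, Prod.mk.injEq] at hs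
    obtain ⟨rfl, rfl⟩ := hs
    split_ifs with hc
    · exact I.next ⟨h1, hm, h2⟩
    -- With unique keys, `AddVertex` never finds a node with its own key.
    · exact absurd (not_ne_iff.1 hc) (h1.2.1 _ hm v₂ (by simp [h2.2.1.1]))
  · rw [hm] at hs
    simp only [step, Option.some.injEq, Prod.mk.injEq] at hs
    obtain ⟨rfl, rfl⟩ := hs
    split_ifs with hc
    · exact I.next ⟨h1.1, hm, h2, h2.2.1.1, hc⟩
    -- The window is locked and validated, so the key is absent at this moment and the failing
    -- removal takes effect now.
    · have hn := I.not_mem_of_VWin h2 hc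
      obtain ⟨L', hG, hd⟩ := I.exists_guar_lin (b := false) h1.1
        (.now ⟨by rw [hm]; exact ⟨hn, rfl⟩, by rw [hm]; rfl⟩)
        (by intro z hz; rw [hm] at hz; cases hz) (by intro u v hz; rw [hm] at hz; cases hz)
      exact hG.next ⟨hd, h2.1.ne h2.2.1, h2.2.2.1.mono fun _ _ _ => trivial,
        h2.2.2.2.mono fun _ _ _ => trivial⟩

theorem Inv.step_avNew (I : σ.Inv) (h : σ.At t m (.avNew v₁ v₂))
    (hs : step t m σ.mem (.avNew v₁ v₂) = some (μ', p')) : σ.Next t m μ' p' := by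
  simp only [step, Option.some.injEq, Prod.mk.injEq] at hs
  obtain ⟨rfl, rfl⟩ := hs
  obtain ⟨h1, h2, h3, h4, h5, h6⟩ := h
  refine ⟨σ.allocV t m.key₁, rfl, I.guar_allocV h2 (h1.2.1 _ h2) ?_, h1.1, h2,
    ⟨h3.allocV I, h4.allocV I, h5.allocV I, h6.allocV I⟩, V.allocV I ⟨h4.1, ?_⟩, ?_⟩
  · rw [← h2]; exact callState_mem I.valid (.inl h1.1)
  · exact lt_of_le_of_ne h4.2 (Ne.symm (h1.2.1 _ h2 v₂ (by simp [h4.1])))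
  · refine ⟨by simp [State.allocV], ?_⟩
    simp [State.allocV, Mem.allocV, vval, vmk]

theorem Inv.step_avSet (I : σ.Inv) (h : σ.At t m (.avSet v₁ v₂ v₃))
    (hs : step t m σ.mem (.avSet v₁ v₂ v₃) = some (μ', p')) : σ.Next t m μ' p' := by
  simp only [step, Option.some.injEq, Prod.mk.injEq] at hs
  obtain ⟨rfl, rfl⟩ := hs
  obtain ⟨h1, h2, ⟨h3, h4, h5, h6⟩, h7, h8⟩ := h
  have hne : ∀ v, σ.vs v = .linked → v ≠ v₃ := by
    rintro v hv rfl
    rw [h8.1] at hv; cases hv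
  exact Guar.next (I.guar_setV (f := fun n => { n with vnext := some v₂ })
    (fun _ => ⟨rfl, rfl, rfl⟩) (.inr h8.1)) ⟨h1, h2,
    ⟨h3.setV (fun _ => rfl) h3.1, h4.setV (fun _ => rfl) h4.1, h5.setV_ne (hne _ h5.1) h5.1,
      h6.setV_ne (hne _ h6.1) h6.1⟩, h7.setV (fun _ => rfl) h7.1,
    VP.setV_self h8.1 ⟨h8.2.1, h8.2.2, rfl⟩⟩

theorem Inv.step_avLink (I : σ.Inv) (h : σ.At t m (.avLink v₁ v₂ v₃))
    (hs : step t m σ.mem (.avLink v₁ v₂ v₃) = some (μ', p')) : σ.Next t m μ' p' := by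
  simp only [step, Option.some.injEq, Prod.mk.injEq] at hs
  obtain ⟨rfl, rfl⟩ := hs
  obtain ⟨h1, h2, ⟨h3, h4, h5, h6⟩, h7, h8⟩ := h
  obtain ⟨hG, hd⟩ := I.exists_guar_linkV h2 h1 h3 h7 h5 h8
  have hne : ∀ v, σ.vs v = .linked → Function.update σ.vs v₃ .linked v = .linked := by
    intro v hv
    rcases eq_or_ne v v₃ with rfl | h <;> simp [*]
  exact hG.next ⟨hd, h3.ne h4, VL.setV_self (hne _ h5.1) h5.2.1 trivial,
    VL.setV_ne (h6.mono fun _ _ _ => trivial) (h3.ne h4).symm (hne _ h6.1)⟩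

theorem Inv.step_rvMark (I : σ.Inv) (h : σ.At t m (.rvMark v₁ v₂))
    (hs : step t m σ.mem (.rvMark v₁ v₂) = some (μ', p')) : σ.Next t m μ' p' := by
  simp only [step, Option.some.injEq, Prod.mk.injEq] at hs
  obtain ⟨rfl, rfl⟩ := hs
  obtain ⟨h1, h2, ⟨h3, h4, h5, h6⟩, h7⟩ := h
  obtain ⟨hG, hd⟩ := I.guar_markV h2 h1 h7 h6
  have hk : m.ekey = m.key₁ := by rw [h2]; rfl
  refine ⟨_, rfl, hG, ⟨hd, by rw [hk]; exact h2, ?_⟩, h3.ne h4, h5.setV_ne (h3.ne h4) h5.1,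
    VL.setV_self h6.1 h6.2.1 rfl⟩
  exact ⟨v₂, h6.1, by simp [vmk, Mem.setV], by rw [hk]; simpa [vval, Mem.setV] using h7.2⟩

theorem Inv.step_rvRead (I : σ.Inv) (h : σ.At t m (.rvRead v₁ v₂))
    (hs : step t m σ.mem (.rvRead v₁ v₂) = some (μ', p')) : σ.Next t m μ' p' := by
  simp only [step, Option.some.injEq, Prod.mk.injEq] at hs
  obtain ⟨rfl, rfl⟩ := hs
  obtain ⟨h1, h2, h3, h4⟩ := h
  exact I.next ⟨h1, h2, h3, h4.1, h4.2.1, h4.2.2, rfl⟩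

theorem Inv.step_rvUnlink (I : σ.Inv) {w : Option VRef} (h : σ.At t m (.rvUnlink v₁ v₂ w))
    (hs : step t m σ.mem (.rvUnlink v₁ v₂ w) = some (μ', p')) : σ.Next t m μ' p' := by
  simp only [step, Option.some.injEq, Prod.mk.injEq] at hs
  obtain ⟨rfl, rfl⟩ := hs
  obtain ⟨h1, h2, h3, h4⟩ := h
  exact ⟨_, rfl, I.guar_unlinkV h3 h4, XA.setV (b := .scan) h1 (fun _ => rfl) (fun _ => id), h2,
    VL.setV_self h3.1 h3.2.1 trivial, VL.setV_ne (h4.mono fun _ _ _ => trivial) h2.symm h4.1⟩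

theorem Inv.step_vRel1 (I : σ.Inv) (h : σ.At t m (.vRel1 v₁ v₂ x))
    (hs : step t m σ.mem (.vRel1 v₁ v₂ x) = some (μ', p')) : σ.Next t m μ' p' := by
  simp only [step, Option.some.injEq, Prod.mk.injEq] at hs
  obtain ⟨rfl, rfl⟩ := hs
  obtain ⟨h1, h2, h3, h4⟩ := h
  exact Guar.next (I.guar_setV (f := fun n => { n with lock := none }) (fun _ => ⟨rfl, rfl, rfl⟩)
    (.inl ⟨h3.1, .inr h3.2.1, fun _ => rfl⟩)) ⟨h1.setV (fun _ => rfl) (fun _ => id),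
    h4.setV_ne h2.symm h4.1⟩

theorem Inv.step_vRel2 (I : σ.Inv) (h : σ.At t m (.vRel2 v₂ x))
    (hs : step t m σ.mem (.vRel2 v₂ x) = some (μ', p')) : σ.Next t m μ' p' := by
  simp only [step, Option.some.injEq, Prod.mk.injEq] at hs
  obtain ⟨rfl, rfl⟩ := hs
  obtain ⟨h1, h2⟩ := h
  refine Guar.next (I.guar_setV (f := fun n => { n with lock := none }) (fun _ => ⟨rfl, rfl, rfl⟩)
    (.inl ⟨h2.1, .inr h2.2.1, fun _ => rfl⟩)) ?_
  have := h1.setV (v := v₂) (f := fun n => { n with lock := none }) (es' := σ.es)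
    (fun _ => rfl) (fun _ => id)
  cases x <;> exact this

theorem Inv.step_riHead (I : σ.Inv) (h : σ.At t m .riHead)
    (hs : step t m σ.mem .riHead = some (μ', p')) : σ.Next t m μ' p' := by
  simp only [step, Option.some.injEq, Prod.mk.injEq] at hs
  obtain ⟨rfl, rfl⟩ := hs
  exact I.next ⟨h, I.vlist.head_mem, trivial⟩

theorem Inv.step_riTest (I : σ.Inv) (h : σ.At t m (.riTest v₁))
    (hs : step t m σ.mem (.riTest v₁) = some (μ', p')) : σ.Next t m μ' p' := by
  simp only [step, Option.some.injEq, Prod.mk.injEq] at hs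
  obtain ⟨rfl, rfl⟩ := hs
  split_ifs with hc
  -- The call took effect when the vertex was marked, so nothing has to be known about how thorough
  -- the scan was.
  · exact I.next h.1.1
  · exact I.next (.inr h)

theorem Inv.step_riNext (I : σ.Inv) (h : σ.At t m (.riNext v₁))
    (hs : step t m σ.mem (.riNext v₁) = some (μ', p')) : σ.Next t m μ' p' := by
  simp only [step] at hs
  split at hs
  · next v₂ hv =>
    simp only [Option.some.injEq, Prod.mk.injEq] at hs
    obtain ⟨rfl, rfl⟩ := hs
    exact I.next ⟨h.1, (I.V_next h.2 hv).mono fun _ _ => trivial⟩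
  · cases hs

end LocateVertex

end State

end ConcGraph

namespace ConcGraph

variable {T : Type*} [DecidableEq T]

namespace State

variable {t t' : T} {m m' : Method} {σ σ' σ'' : State T} {μ' : Mem T} {p p' : Pc}

/-! ### Steps of the edge list updates. -/

section LocateEdge

variable {w : VRef} {e₁ e₂ e₃ : ERef} {d : Bool}

theorem EOp.V (h : σ.EOp t m w) : σ.V w fun _ => True := by
  rcases h with h | h
  · exact h.2.2.2.1.mono fun _ _ => trivial
  · exact h.2

theorem Inv.step_leHead (I : σ.Inv) (h : σ.At t m (.leHead w))
    (hs : step t m σ.mem (.leHead w) = some (μ', p')) : σ.Next t m μ' p' := by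
  simp only [step, Option.some.injEq, Prod.mk.injEq] at hs
  obtain ⟨rfl, rfl⟩ := hs
  exact I.next ⟨h, I.E_head (EOp.V h).1 _⟩

theorem Inv.step_leNext (I : σ.Inv) (h : σ.At t m (.leNext w e₁))
    (hs : step t m σ.mem (.leNext w e₁) = some (μ', p')) : σ.Next t m μ' p' := by
  simp only [step] at hs
  split at hs
  · next v₂ hv =>
    simp only [Option.some.injEq, Prod.mk.injEq] at hs
    obtain ⟨rfl, rfl⟩ := hs
    exact I.next ⟨h.1, h.2, (I.E_next h.2 hv).mono fun _ _ => trivial⟩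
  · cases hs

theorem Inv.step_leTest (I : σ.Inv) (h : σ.At t m (.leTest w e₁ e₂))
    (hs : step t m σ.mem (.leTest w e₁ e₂) = some (μ', p')) : σ.Next t m μ' p' := by
  simp only [step, Option.some.injEq, Prod.mk.injEq] at hs
  obtain ⟨rfl, rfl⟩ := hs
  obtain ⟨h1, h2, h3⟩ := h
  split_ifs with hc
  · exact I.next ⟨h1, h3.1, hc⟩
  · exact I.next ⟨h1, h2, h3.1, not_lt.1 hc⟩

theorem Inv.step_leLock1 (I : σ.Inv) (h : σ.At t m (.leLock1 w e₁ e₂))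
    (hs : step t m σ.mem (.leLock1 w e₁ e₂) = some (μ', p')) : σ.Next t m μ' p' := by
  simp only [step] at hs
  split at hs
  · cases hs
  · next hv =>
    simp only [Option.some.injEq, Prod.mk.injEq] at hs
    obtain ⟨rfl, rfl⟩ := hs
    obtain ⟨h1, h2, h3⟩ := h
    exact Guar.next (I.guar_setE (f := fun n => { n with lock := some t })
      (fun _ => ⟨rfl, rfl⟩) (.inl ⟨⟨w, h2.1⟩, .inl hv, fun _ => rfl⟩)) ⟨h1,
      h2.setE (fun _ => rfl) h2.1, h3.setE (fun _ => rfl) h3.1, EL.setE_self h2.1 rfl trivial⟩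

theorem Inv.step_leLock2 (I : σ.Inv) (h : σ.At t m (.leLock2 w e₁ e₂))
    (hs : step t m σ.mem (.leLock2 w e₁ e₂) = some (μ', p')) : σ.Next t m μ' p' := by
  simp only [step] at hs
  split at hs
  · cases hs
  · next hv =>
    simp only [Option.some.injEq, Prod.mk.injEq] at hs
    obtain ⟨rfl, rfl⟩ := hs
    obtain ⟨h1, h2, h3, h4⟩ := h
    exact Guar.next (I.guar_setE (f := fun n => { n with lock := some t })
      (fun _ => ⟨rfl, rfl⟩) (.inl ⟨⟨w, h3.1⟩, .inl hv, fun _ => rfl⟩)) ⟨h1,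
      h2.setE (fun _ => rfl) h2.1, h3.setE (fun _ => rfl) h3.1, h4.setE_ne (h2.ne h3) h2.1,
      EL.setE_self h3.1 rfl trivial⟩

theorem Inv.step_leValid1 (I : σ.Inv) (h : σ.At t m (.leValid1 w e₁ e₂))
    (hs : step t m σ.mem (.leValid1 w e₁ e₂) = some (μ', p')) : σ.Next t m μ' p' := by
  simp only [step, Option.some.injEq, Prod.mk.injEq] at hs
  obtain ⟨rfl, rfl⟩ := hs
  obtain ⟨h1, h2, h3, h4, h5⟩ := h
  split_ifs with hc
  · exact I.next ⟨h1, h2, h3, ⟨h4.1, h4.2.1, hc⟩, h5⟩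
  · exact I.next ⟨fun _ => h1, nofun, h2.ne h3, h4, h5⟩

theorem Inv.step_leValid2 (I : σ.Inv) (h : σ.At t m (.leValid2 w e₁ e₂))
    (hs : step t m σ.mem (.leValid2 w e₁ e₂) = some (μ', p')) : σ.Next t m μ' p' := by
  simp only [step, Option.some.injEq, Prod.mk.injEq] at hs
  obtain ⟨rfl, rfl⟩ := hs
  obtain ⟨h1, h2, h3, h4, h5⟩ := h
  split_ifs with hc
  · exact I.next ⟨h1, h2, h3, h4, h5.1, h5.2.1, hc⟩
  · exact I.next ⟨fun _ => h1, nofun, h2.ne h3, h4.mono fun _ _ _ => trivial, h5⟩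

theorem Inv.step_leValid3 (I : σ.Inv) (h : σ.At t m (.leValid3 w e₁ e₂))
    (hs : step t m σ.mem (.leValid3 w e₁ e₂) = some (μ', p')) : σ.Next t m μ' p' := by
  simp only [step, Option.some.injEq, Prod.mk.injEq] at hs
  obtain ⟨rfl, rfl⟩ := hs
  obtain ⟨h1, h2, h3, h4, h5⟩ := h
  split_ifs with hc
  · exact I.next ⟨h1, h2, h3, ⟨h4.1, h4.2.1, h4.2.2, hc⟩, h5⟩
  · exact I.next ⟨fun _ => h1, nofun, h2.ne h3, h4.mono fun _ _ _ => trivial,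
      h5.mono fun _ _ _ => trivial⟩

/-- In a validated window the second node is the only candidate for the key. -/
theorem Inv.ne_of_EWin (I : σ.Inv) (h : σ.EWin t m w e₁ e₂) (hk : σ.enval e₂ ≠ toKey m.ekey)
    (y : ERef) (hy : σ.es y = .linked w) (hym : σ.emk y = false) :
    σ.enval y ≠ toKey m.ekey := by
  obtain ⟨h1, h2, h3, h4⟩ := h
  intro hyk
  have := (I.elist w (I.eowner y w hy)).eq_of_between h1.1 h3.2.2.1 h3.2.2.2 hy hym
    (by rw [hyk]; exact h1.2) (by rw [hyk]; exact h2.2)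
  subst this
  exact hk hyk

theorem EWin.eRel1 (h : σ.EWin t m w e₁ e₂) : e₁ ≠ e₂ ∧ σ.EL t w e₁ (fun _ _ => True) ∧
    σ.EL t w e₂ (fun _ _ => True) :=
  ⟨h.1.ne h.2.1, h.2.2.1.mono fun _ _ _ => trivial, h.2.2.2.mono fun _ _ _ => trivial⟩

theorem Scan.eDone (h : σ.Scan t m) (hw : σ.V w fun _ => True) : σ.EDone t m w :=
  ⟨h.1, hw, .inr h⟩

theorem Inv.step_eTest (I : σ.Inv) (h : σ.At t m (.eTest w e₁ e₂))
    (hs : step t m σ.mem (.eTest w e₁ e₂) = some (μ', p')) : σ.Next t m μ' p' := by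
  obtain ⟨h1, h2⟩ := h
  rcases h1 with h1 | ⟨h1, hw⟩
  · have hV := (EOp.V (.inl h1 : σ.EOp t m w))
    rcases h1.2.1 with hm | hm
    · rw [hm] at hs
      simp only [step, Option.some.injEq, Prod.mk.injEq] at hs
      obtain ⟨rfl, rfl⟩ := hs
      split_ifs with hc
      · exact I.next ⟨h1, hm, h2, h2.2.1.1, lt_of_le_of_ne h2.2.1.2 (Ne.symm hc)⟩
      · obtain ⟨L', hG, hd⟩ := I.exists_guar_edge h1
          (fun _ => ⟨e₂, h2.2.1.1, not_ne_iff.1 hc, h2.2.2.2.2.2⟩)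
          (fun h => by rw [hm] at h; cases h)
        exact hG.next ⟨nofun, fun _ => ⟨hd, hV, .inl (.inl hm)⟩, h2.eRel1⟩
    · rw [hm] at hs
      simp only [step, Option.some.injEq, Prod.mk.injEq] at hs
      obtain ⟨rfl, rfl⟩ := hs
      split_ifs with hc
      · exact I.next ⟨.inl h1, by rw [hm]; simp, h2, h2.2.1.1, hc⟩
      · obtain ⟨L', hG, hd⟩ := I.exists_guar_edge h1
          (fun h => by rw [hm] at h; cases h) (fun _ => I.ne_of_EWin h2 hc)
        exact hG.next ⟨nofun, fun _ => ⟨hd, hV, .inl (.inr hm)⟩, h2.eRel1⟩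
  · have hm := h1.2.1
    rw [hm] at hs
    simp only [step, Option.some.injEq, Prod.mk.injEq] at hs
    obtain ⟨rfl, rfl⟩ := hs
    split_ifs with hc
    · exact I.next ⟨.inr ⟨h1, hw⟩, by rw [hm]; simp, h2, h2.2.1.1, hc⟩
    -- A scanning `RemoveVertex` has its linearization point behind it, so the log is left alone.
    · exact I.next ⟨nofun, fun _ => h1.eDone hw, h2.eRel1⟩

theorem Inv.step_aeNew (I : σ.Inv) (h : σ.At t m (.aeNew w e₁ e₂))
    (hs : step t m σ.mem (.aeNew w e₁ e₂) = some (μ', p')) : σ.Next t m μ' p' := by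
  simp only [step, Option.some.injEq, Prod.mk.injEq] at hs
  obtain ⟨rfl, rfl⟩ := hs
  obtain ⟨h1, h2, h3, h4⟩ := h
  refine ⟨σ.allocE t m.ekey, rfl, I.guar_allocE, h1, h2,
    ⟨h3.1.allocE I, h3.2.1.allocE I, h3.2.2.1.allocE I, h3.2.2.2.allocE I⟩, h4.allocE I, ?_, ?_⟩
  · simp [State.allocE]
  · simp [State.allocE, Mem.allocE, enval, emk, newENode]

theorem Inv.step_aeSet (I : σ.Inv) (h : σ.At t m (.aeSet w e₁ e₂ e₃))
    (hs : step t m σ.mem (.aeSet w e₁ e₂ e₃) = some (μ', p')) : σ.Next t m μ' p' := by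
  simp only [step, Option.some.injEq, Prod.mk.injEq] at hs
  obtain ⟨rfl, rfl⟩ := hs
  obtain ⟨h1, h2, ⟨h3, h4, h5, h6⟩, h7, h8⟩ := h
  have hne : ∀ v, σ.es v = .linked w → v ≠ e₃ := by
    rintro v hv rfl
    rw [h8.1] at hv; cases hv
  exact Guar.next (I.guar_setE (f := fun n => { n with enext := some e₂ })
    (fun _ => ⟨rfl, rfl⟩) (.inr h8.1)) ⟨h1, h2,
    ⟨h3.setE (fun _ => rfl) h3.1, h4.setE (fun _ => rfl) h4.1, h5.setE_ne (hne _ h5.1) h5.1,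
      h6.setE_ne (hne _ h6.1) h6.1⟩, h7.setE (fun _ => rfl) h7.1,
    EP.setE_self h8.1 ⟨h8.2.1, h8.2.2, rfl⟩⟩

theorem Inv.step_aeLink (I : σ.Inv) (h : σ.At t m (.aeLink w e₁ e₂ e₃))
    (hs : step t m σ.mem (.aeLink w e₁ e₂ e₃) = some (μ', p')) : σ.Next t m μ' p' := by
  simp only [step, Option.some.injEq, Prod.mk.injEq] at hs
  obtain ⟨rfl, rfl⟩ := hs
  obtain ⟨h1, h2, ⟨h3, h4, h5, h6⟩, h7, h8⟩ := h
  obtain ⟨L', hG, hd⟩ := I.exists_guar_linkE h1 h2 h3 h7 h5 h8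
  have hV := EOp.V (.inl h1 : σ.EOp t m w)
  have hne : ∀ v, σ.es v = .linked w → Function.update σ.es e₃ (.linked w) v = .linked w := by
    intro v hv
    rcases eq_or_ne v e₃ with rfl | h <;> simp [*]
  exact hG.next ⟨nofun, fun _ => ⟨hd, hV, .inl (.inl h2)⟩, h3.ne h4,
    EL.setE_self (hne _ h5.1) h5.2.1 trivial,
    EL.setE_ne (h6.mono fun _ _ _ => trivial) (h3.ne h4).symm (hne _ h6.1)⟩

theorem Inv.step_reMark (I : σ.Inv) (h : σ.At t m (.reMark w e₁ e₂))
    (hs : step t m σ.mem (.reMark w e₁ e₂) = some (μ', p')) : σ.Next t m μ' p' := by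
  simp only [step, Option.some.injEq, Prod.mk.injEq] at hs
  obtain ⟨rfl, rfl⟩ := hs
  obtain ⟨h1, h2, ⟨h3, h4, h5, h6⟩, h7⟩ := h
  rcases h1 with h1 | ⟨h1, hw⟩
  · have hm := h1.2.1.resolve_left h2
    obtain ⟨L', hG, hd⟩ := I.exists_guar_markE h1 hm h7 h6
    have hV := EOp.V (.inl h1 : σ.EOp t m w)
    exact hG.next ⟨⟨hd, hV, .inl (.inr hm)⟩, h3.ne h4, h5.setE_ne (h3.ne h4) h5.1,
      EL.setE_self h6.1 h6.2.1 rfl⟩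
  · exact Guar.next (I.guar_scanE h1.2.2 h7 h6) ⟨h1.eDone hw, h3.ne h4,
      h5.setE_ne (h3.ne h4) h5.1, EL.setE_self h6.1 h6.2.1 rfl⟩

theorem Inv.step_reRead (I : σ.Inv) (h : σ.At t m (.reRead w e₁ e₂))
    (hs : step t m σ.mem (.reRead w e₁ e₂) = some (μ', p')) : σ.Next t m μ' p' := by
  simp only [step, Option.some.injEq, Prod.mk.injEq] at hs
  obtain ⟨rfl, rfl⟩ := hs
  obtain ⟨h1, h2, h3, h4⟩ := h
  exact I.next ⟨h1, h2, h3, h4.1, h4.2.1, h4.2.2, rfl⟩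

theorem Inv.step_reUnlink (I : σ.Inv) {x : Option ERef} (h : σ.At t m (.reUnlink w e₁ e₂ x))
    (hs : step t m σ.mem (.reUnlink w e₁ e₂ x) = some (μ', p')) : σ.Next t m μ' p' := by
  simp only [step, Option.some.injEq, Prod.mk.injEq] at hs
  obtain ⟨rfl, rfl⟩ := hs
  obtain ⟨h1, h2, h3, h4⟩ := h
  exact Guar.next (I.guar_unlinkE h3 h4) ⟨nofun, fun _ => h1, h2,
    EL.setE_self h3.1 h3.2.1 trivial, EL.setE_ne (h4.mono fun _ _ _ => trivial) h2.symm h4.1⟩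

theorem Inv.step_eRel1 (I : σ.Inv) (h : σ.At t m (.eRel1 w e₁ e₂ d))
    (hs : step t m σ.mem (.eRel1 w e₁ e₂ d) = some (μ', p')) : σ.Next t m μ' p' := by
  simp only [step, Option.some.injEq, Prod.mk.injEq] at hs
  obtain ⟨rfl, rfl⟩ := hs
  obtain ⟨h1, h2, h3, h4, h5⟩ := h
  exact Guar.next (I.guar_setE (f := fun n => { n with lock := none }) (fun _ => ⟨rfl, rfl⟩)
    (.inl ⟨⟨w, h4.1⟩, .inr h4.2.1, fun _ => rfl⟩)) ⟨h1, h2, h5.setE_ne h3.symm h5.1⟩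

theorem Inv.step_eRel2 (I : σ.Inv) (h : σ.At t m (.eRel2 w e₂ d))
    (hs : step t m σ.mem (.eRel2 w e₂ d) = some (μ', p')) : σ.Next t m μ' p' := by
  simp only [step, Option.some.injEq, Prod.mk.injEq] at hs
  obtain ⟨rfl, rfl⟩ := hs
  obtain ⟨h1, h2, h3⟩ := h
  refine Guar.next (I.guar_setE (f := fun n => { n with lock := none }) (fun _ => ⟨rfl, rfl⟩)
    (.inl ⟨⟨w, h3.1⟩, .inr h3.2.1, fun _ => rfl⟩)) ?_
  cases d
  · exact h1 rfl
  · obtain ⟨hd, hw, hm⟩ := h2 rfl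
    rcases hm with (hm | hm) | hm
    · rw [hm] at hd ⊢; exact hd
    · rw [hm] at hd ⊢; exact hd
    · have hm' := hm.2.1
      rw [hm'] at hm ⊢
      exact ⟨hm, hw⟩

end LocateEdge

end State

end ConcGraph

namespace ConcGraph

variable {T : Type*} [DecidableEq T]

namespace State

variable {t t' : T} {m m' : Method} {σ σ' σ'' : State T} {μ' : Mem T} {p p' : Pc}

/-! ### Steps of the traversals without locks. -/

section Traversals

variable {v v' x y : VRef} {k : ℤ} {P : NodeKey → Prop}

theorem Inv.VTrav_head (I : σ.Inv) : σ.VTrav t k vertexHead (fun _ => True) :=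
  ⟨⟨I.vlist.head_mem, trivial⟩, .inr fun z hz hm _ => I.vlist.reach z hz hm⟩

/-- The current node is not the target, so the path to the target passes through its successor. The
current node itself may be marked or already unlinked. -/
theorem TravV.next (h : σ.TravV t k v) (hk : σ.vval v ≠ toKey k) (hn : σ.vnxt v = some v') :
    σ.TravV t k v' :=
  h.imp_right fun h z hz hm hzk => SortedList.reach_next (h z hz hm hzk)
    (by rintro rfl; exact hk hzk) hn

theorem VTrav.next (I : σ.Inv) (h : σ.VTrav t k v (· < toKey k)) (hn : σ.vnxt v = some v') :
    σ.VTrav t k v' (fun _ => True) :=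
  ⟨(I.V_next h.1 hn).mono fun _ _ => trivial, h.2.next h.1.2.ne hn⟩

/-- A traversal that has passed the place of `k` shows that `k` has been absent. -/
theorem TravV.absent (I : σ.Inv) (h : σ.TravV t k v) (hv : σ.V v (toKey k ≤ ·))
    (hk : σ.vval v = toKey k → σ.vmk v = true) : Cand σ.log t fun G => k ∉ G.verts := by
  rcases h with h | h
  · exact h
  · refine .now fun hmem => ?_
    obtain ⟨z, hz, hzm, hzk⟩ := (I.verts k).1 hmem
    rcases (I.vlist.reach_val hv.1 (h z hz hzm hzk)).2 with rfl | hlt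
    · rw [hk hzk] at hzm; cases hzm
    · rw [hzk] at hlt
      exact absurd hv.2 hlt.not_ge

/-- All edge methods fail for a missing endpoint; for `ContainsEdge` a missing edge is a further
reason. -/
theorem HPre.next_fail (I : σ.Inv) (h : σ.HPre t m)
    (hC : Cand σ.log t fun G => (m.key₁ ∉ G.verts ∨ m.ekey ∉ G.verts) ∨
      m = .containsEdge m.key₁ m.ekey ∧ (m.key₁, m.ekey) ∉ G.edges) :
    σ.Next t m σ.mem (.ret false) := by
  obtain ⟨hc, hm⟩ := h
  refine I.next_lin hc (hC.mono fun G hG => ?_) ?_ ?_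
  · rcases hm with ⟨hm | hm, -⟩ | hm
    · rw [hm] at hG ⊢
      exact ⟨⟨hG.resolve_right (by simp), rfl⟩, rfl⟩
    · rw [hm] at hG ⊢
      exact ⟨⟨hG.resolve_right (by simp), rfl⟩, rfl⟩
    · rw [hm] at hG ⊢
      exact ⟨⟨by rcases hG with (h | h) | h; exacts [.inl h, .inr (.inl h), .inr (.inr h.2)], rfl⟩,
        rfl⟩
  · intro z hz
    rw [hz] at hm
    simp at hm
  · rintro u v rfl
    simpa [Method.key₁, Method.ekey] using hm

theorem fstKey_cases (m : Method) :
    m.key₁ < m.ekey ∧ m.fstKey = m.key₁ ∧ m.sndKey = m.ekey ∨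
      m.ekey ≤ m.key₁ ∧ m.fstKey = m.ekey ∧ m.sndKey = m.key₁ := by
  unfold Method.fstKey Method.sndKey
  split_ifs with h
  · exact .inl ⟨h, rfl, rfl⟩
  · exact .inr ⟨not_lt.1 h, rfl, rfl⟩

theorem HPre.next_fstKey (I : σ.Inv) (h : σ.HPre t m)
    (hC : Cand σ.log t fun G => m.fstKey ∉ G.verts) : σ.Next t m σ.mem (.ret false) := by
  refine h.next_fail I (hC.mono fun G hG => .inl ?_)
  rcases fstKey_cases m with ⟨-, h, -⟩ | ⟨-, h, -⟩ <;> rw [h] at hG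
  exacts [.inl hG, .inr hG]

theorem HPre.next_sndKey (I : σ.Inv) (h : σ.HPre t m)
    (hC : Cand σ.log t fun G => m.sndKey ∉ G.verts) : σ.Next t m σ.mem (.ret false) := by
  refine h.next_fail I (hC.mono fun G hG => .inl ?_)
  rcases fstKey_cases m with ⟨-, -, h⟩ | ⟨-, -, h⟩ <;> rw [h] at hG
  exacts [.inr hG, .inl hG]

theorem Inv.step_hsHead (I : σ.Inv) (h : σ.At t m .hsHead)
    (hs : step t m σ.mem .hsHead = some (μ', p')) : σ.Next t m μ' p' := by
  simp only [step, Option.some.injEq, Prod.mk.injEq] at hs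
  obtain ⟨rfl, rfl⟩ := hs
  exact I.next ⟨h, I.VTrav_head⟩

theorem Inv.step_hsTest1 (I : σ.Inv) (h : σ.At t m (.hsTest1 x))
    (hs : step t m σ.mem (.hsTest1 x) = some (μ', p')) : σ.Next t m μ' p' := by
  simp only [step, Option.some.injEq, Prod.mk.injEq] at hs
  obtain ⟨rfl, rfl⟩ := hs
  obtain ⟨h1, h2, h3⟩ := h
  split_ifs with hc
  · exact I.next ⟨h1, ⟨h2.1, hc⟩, h3⟩
  · exact I.next ⟨h1, ⟨h2.1, not_lt.1 hc⟩, h3⟩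

theorem Inv.step_hsNext1 (I : σ.Inv) (h : σ.At t m (.hsNext1 x))
    (hs : step t m σ.mem (.hsNext1 x) = some (μ', p')) : σ.Next t m μ' p' := by
  simp only [step] at hs
  split at hs
  · next v₂ hv =>
    simp only [Option.some.injEq, Prod.mk.injEq] at hs
    obtain ⟨rfl, rfl⟩ := hs
    exact I.next ⟨h.1, VTrav.next I h.2 hv⟩
  · cases hs

theorem Inv.step_hsVal1 (I : σ.Inv) (h : σ.At t m (.hsVal1 x))
    (hs : step t m σ.mem (.hsVal1 x) = some (μ', p')) : σ.Next t m μ' p' := by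
  simp only [step, Option.some.injEq, Prod.mk.injEq] at hs
  obtain ⟨rfl, rfl⟩ := hs
  obtain ⟨h1, h2, h3⟩ := h
  split_ifs with hc
  · exact h1.next_fstKey I (h3.absent I h2 fun h => absurd h hc)
  · exact I.next ⟨h1, ⟨h2.1, not_ne_iff.1 hc⟩, h3⟩

theorem Inv.mem_verts (I : σ.Inv) (h : σ.V x (· = toKey k)) (hm : σ.vmk x = false) :
    k ∈ (graph σ.log).verts := (I.verts k).2 ⟨x, h.1, hm, h.2⟩

theorem Inv.step_hsMark1 (I : σ.Inv) (h : σ.At t m (.hsMark1 x))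
    (hs : step t m σ.mem (.hsMark1 x) = some (μ', p')) : σ.Next t m μ' p' := by
  simp only [step, Option.some.injEq, Prod.mk.injEq] at hs
  obtain ⟨rfl, rfl⟩ := hs
  obtain ⟨h1, h2, h3⟩ := h
  split_ifs with hc
  · exact h1.next_fstKey I (h3.absent I (h2.mono fun _ h => h.ge) fun _ => hc)
  -- At the moment when `x` is seen unmarked, every unmarked node with a larger key is ahead of it,
  -- so the search for the second key may continue from `x` instead of the head.
  · have hm : σ.vmk x = false := by simpa using hc
    refine I.next ⟨⟨h1, h2, .now (I.mem_verts h2 hm)⟩,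
      ⟨h2.1, h2.2.ge, fun hlt => ?_⟩, fun hlt => .inr fun z hz hzm hzk => ?_⟩
    · rw [h2.2]
      exact WithBot.coe_lt_coe.2 (WithTop.coe_lt_coe.2 hlt)
    · refine I.vlist.reach_of_lt h2.1 hz hm hzm ?_
      rw [h2.2, hzk]
      exact WithBot.coe_lt_coe.2 (WithTop.coe_lt_coe.2 hlt)

theorem Inv.step_hsNext2 (I : σ.Inv) (h : σ.At t m (.hsNext2 x y))
    (hs : step t m σ.mem (.hsNext2 x y) = some (μ', p')) : σ.Next t m μ' p' := by
  simp only [step] at hs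
  split at hs
  · next y' hy =>
    simp only [Option.some.injEq, Prod.mk.injEq] at hs
    obtain ⟨rfl, rfl⟩ := hs
    obtain ⟨h1, h2, h3⟩ := h
    exact I.next ⟨h1, (I.V_next h2 hy).mono fun _ h => h2.2.1.trans_lt h,
      fun hlt => (h3 hlt).next (h2.2.2 hlt).ne hy⟩
  · cases hs

theorem Inv.step_hsTest2 (I : σ.Inv) (h : σ.At t m (.hsTest2 x y))
    (hs : step t m σ.mem (.hsTest2 x y) = some (μ', p')) : σ.Next t m μ' p' := by
  simp only [step, Option.some.injEq, Prod.mk.injEq] at hs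
  obtain ⟨rfl, rfl⟩ := hs
  obtain ⟨h1, h2, h3⟩ := h
  split_ifs with hc
  · exact I.next ⟨h1, ⟨h2.1, h2.2.le, fun _ => hc⟩, h3⟩
  · exact I.next ⟨h1, ⟨h2.1, h2.2, not_lt.1 hc⟩, h3⟩

theorem Inv.step_hsVal2 (I : σ.Inv) (h : σ.At t m (.hsVal2 x y))
    (hs : step t m σ.mem (.hsVal2 x y) = some (μ', p')) : σ.Next t m μ' p' := by
  simp only [step, Option.some.injEq, Prod.mk.injEq] at hs
  obtain ⟨rfl, rfl⟩ := hs
  obtain ⟨h1, h2, h3⟩ := h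
  split_ifs with hc
  · by_cases hlt : m.fstKey < m.sndKey
    · exact h1.1.next_sndKey I ((h3 hlt).absent I (h2.mono fun _ h => h.2) fun h => absurd h hc)
    -- Only `ContainsEdge(u, u)` gets here. Its answer `false` is always right, as the abstract
    -- graph has no self-loops.
    · have hk : m.key₁ = m.ekey := by
        rcases fstKey_cases m with ⟨h, h', h''⟩ | ⟨h, h', h''⟩ <;> rw [h', h''] at hlt <;> omega
      refine h1.1.next_fail I (.now ?_)
      rcases h1.1.2 with ⟨-, h⟩ | hm
      · exact absurd hk h
      · exact .inr ⟨hm, fun he => (I.valid.edges he).2.2 hk⟩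
  · have hk := not_ne_iff.1 hc
    refine I.next ⟨h1, ?_, ⟨h2.1, hk⟩, h3⟩
    -- The node lies strictly behind that of the first key, so finding the second key there proves
    -- the keys different.
    have := h2.2.1
    change toKey m.fstKey < (σ.mem.vnode y).val at this
    rw [hk] at this
    exact WithTop.coe_lt_coe.1 (WithBot.coe_lt_coe.1 this)

theorem Inv.step_hsMark2 (I : σ.Inv) (h : σ.At t m (.hsMark2 x y))
    (hs : step t m σ.mem (.hsMark2 x y) = some (μ', p')) : σ.Next t m μ' p' := by
  simp only [step] at hs
  obtain ⟨h1, hlt, h2, h3⟩ := h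
  split_ifs at hs with hc
  · simp only [Option.some.injEq, Prod.mk.injEq] at hs
    obtain ⟨rfl, rfl⟩ := hs
    exact h1.1.next_sndKey I ((h3 hlt).absent I (h2.mono fun _ h => h.ge) fun _ => hc)
  · have hm : σ.vmk y = false := by simpa using hc
    have hC := h1.2.2.and_now (Q := fun G => m.sndKey ∈ G.verts) (I.mem_verts h2 hm)
    obtain ⟨⟨hcall, hmeth⟩, hx, hCx⟩ := h1
    have hwin : m.key₁ < m.ekey ∧ σ.V x (· = toKey m.key₁) ∧ σ.V y (· = toKey m.ekey) ∨
        ¬ m.key₁ < m.ekey ∧ σ.V y (· = toKey m.key₁) ∧ σ.V x (· = toKey m.ekey) := by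
      rcases fstKey_cases m with ⟨h, h', h''⟩ | ⟨h, h', h''⟩
      · rw [h'] at hx; rw [h''] at h2; exact .inl ⟨h, hx, h2⟩
      · rw [h'] at hx; rw [h''] at h2; exact .inr ⟨not_lt.2 h, h2, hx⟩
    rcases hmeth with ⟨hm | hm, hne⟩ | hm
    · have hm' := hm
      generalize m.key₁ = u at *
      generalize m.ekey = v at *
      subst hm'
      simp only [Option.some.injEq, Prod.mk.injEq] at hs
      obtain ⟨rfl, rfl⟩ := hs
      rcases hwin with ⟨h, hw⟩ | ⟨h, hw⟩
      · rw [if_pos h]; exact I.next ⟨hcall, .inl rfl, hne, hw⟩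
      · rw [if_neg h]; exact I.next ⟨hcall, .inl rfl, hne, hw⟩
    · have hm' := hm
      generalize m.key₁ = u at *
      generalize m.ekey = v at *
      subst hm'
      simp only [Option.some.injEq, Prod.mk.injEq] at hs
      obtain ⟨rfl, rfl⟩ := hs
      rcases hwin with ⟨h, hw⟩ | ⟨h, hw⟩
      · rw [if_pos h]; exact I.next ⟨hcall, .inr rfl, hne, hw⟩
      · rw [if_neg h]; exact I.next ⟨hcall, .inr rfl, hne, hw⟩
    · have hm' := hm
      generalize m.key₁ = u at *
      generalize m.ekey = v at *
      subst hm'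
      simp only [Option.some.injEq, Prod.mk.injEq] at hs
      obtain ⟨rfl, rfl⟩ := hs
      rcases hwin with ⟨h, hw⟩ | ⟨h, hw⟩
      · rw [if_pos h]; exact I.next ⟨⟨hcall, rfl, hC⟩, hw.1⟩
      · rw [if_neg h]; exact I.next ⟨⟨hcall, rfl, hC⟩, hw.1⟩

theorem Inv.absent_of_marked (I : σ.Inv) (h : σ.V x (· = toKey k)) (hm : σ.vmk x = true) :
    k ∉ (graph σ.log).verts := I.not_mem_of_dead ⟨x, h.1, hm, h.2⟩

theorem Inv.step_leMark1 (I : σ.Inv) (h : σ.At t m (.leMark1 x y))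
    (hs : step t m σ.mem (.leMark1 x y) = some (μ', p')) : σ.Next t m μ' p' := by
  simp only [step, Option.some.injEq, Prod.mk.injEq] at hs
  obtain ⟨rfl, rfl⟩ := hs
  have h' := h
  obtain ⟨h1, h2, h3, h4, h5⟩ := h
  split_ifs with hc
  · exact HPre.next_fail I ⟨h1, .inl ⟨h2, h3⟩⟩ (.now (.inl (.inl (I.absent_of_marked h4 hc))))
  · refine I.next ⟨h', ?_⟩
    -- The mark of `y` is not read by the program at this point; the case distinction is on its
    -- actual value at the moment when `x` is read.
    rcases hy : σ.vmk y with _ | _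
    · exact .inr (.now ⟨I.mem_verts h4 (by simpa using hc), I.mem_verts h5 hy⟩)
    · exact .inl ⟨h5.1, hy⟩

theorem Inv.step_leMark2 (I : σ.Inv) (h : σ.At t m (.leMark2 x y))
    (hs : step t m σ.mem (.leMark2 x y) = some (μ', p')) : σ.Next t m μ' p' := by
  simp only [step, Option.some.injEq, Prod.mk.injEq] at hs
  obtain ⟨rfl, rfl⟩ := hs
  obtain ⟨⟨h1, h2, h3, h4, h5⟩, h6⟩ := h
  split_ifs with hc
  · exact HPre.next_fail I ⟨h1, .inl ⟨h2, h3⟩⟩ (.now (.inl (.inr (I.absent_of_marked h5 hc))))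
  -- An unset mark now rules out that it was set at the previous check, when therefore both
  -- endpoints were present.
  · exact I.next (.inl ⟨h1, h2, h3, h4, h6.resolve_left fun h => hc h.2⟩)

theorem CVPre.next_lin (I : σ.Inv) (h : σ.CVPre t m) {b : Bool}
    (hC : Cand σ.log t fun G => m.key₁ ∈ G.verts ↔ b = true) : σ.Next t m σ.mem (.ret b) := by
  obtain ⟨hc, hm⟩ := h
  refine I.next_lin hc (hC.mono fun G hG => ?_) (by intro z hz; rw [hz] at hm; cases hm)
    (by intro u v hz; rw [hz] at hm; cases hm)
  rw [hm]
  cases b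
  · exact ⟨⟨by simpa using hG, rfl⟩, rfl⟩
  · exact ⟨⟨by simpa using hG, rfl⟩, rfl⟩

theorem Inv.step_cvHead (I : σ.Inv) (h : σ.At t m .cvHead)
    (hs : step t m σ.mem .cvHead = some (μ', p')) : σ.Next t m μ' p' := by
  simp only [step, Option.some.injEq, Prod.mk.injEq] at hs
  obtain ⟨rfl, rfl⟩ := hs
  exact I.next ⟨h, I.VTrav_head⟩

theorem Inv.step_cvTest (I : σ.Inv) (h : σ.At t m (.cvTest x))
    (hs : step t m σ.mem (.cvTest x) = some (μ', p')) : σ.Next t m μ' p' := by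
  simp only [step, Option.some.injEq, Prod.mk.injEq] at hs
  obtain ⟨rfl, rfl⟩ := hs
  obtain ⟨h1, h2, h3⟩ := h
  split_ifs with hc
  · exact I.next ⟨h1, ⟨h2.1, hc⟩, h3⟩
  · exact I.next ⟨h1, ⟨h2.1, not_lt.1 hc⟩, h3⟩

theorem Inv.step_cvNext (I : σ.Inv) (h : σ.At t m (.cvNext x))
    (hs : step t m σ.mem (.cvNext x) = some (μ', p')) : σ.Next t m μ' p' := by
  simp only [step] at hs
  split at hs
  · next v₂ hv =>
    simp only [Option.some.injEq, Prod.mk.injEq] at hs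
    obtain ⟨rfl, rfl⟩ := hs
    exact I.next ⟨h.1, VTrav.next I h.2 hv⟩
  · cases hs

theorem Inv.step_cvVal (I : σ.Inv) (h : σ.At t m (.cvVal x))
    (hs : step t m σ.mem (.cvVal x) = some (μ', p')) : σ.Next t m μ' p' := by
  simp only [step, Option.some.injEq, Prod.mk.injEq] at hs
  obtain ⟨rfl, rfl⟩ := hs
  obtain ⟨h1, h2, h3⟩ := h
  split_ifs with hc
  · exact h1.next_lin I ((h3.absent I h2 fun h => absurd h hc).mono fun _ h => by simpa using h)
  · exact I.next ⟨h1, ⟨h2.1, not_ne_iff.1 hc⟩, h3⟩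

theorem Inv.step_cvMark (I : σ.Inv) (h : σ.At t m (.cvMark x))
    (hs : step t m σ.mem (.cvMark x) = some (μ', p')) : σ.Next t m μ' p' := by
  simp only [step, Option.some.injEq, Prod.mk.injEq] at hs
  obtain ⟨rfl, rfl⟩ := hs
  obtain ⟨h1, h2, h3⟩ := h
  split_ifs with hc
  · exact h1.next_lin I (.now (by simpa using I.absent_of_marked h2 hc))
  · exact h1.next_lin I (.now (by simpa using I.mem_verts h2 (by simpa using hc)))

variable {e e' : ERef}

/-- If the edge were present now, uniqueness of keys would place its unmarked node in the list being
traversed, and that node would still be ahead. -/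
theorem CTrav.absent (I : σ.Inv) (h : σ.CTrav t m e (toKey m.ekey ≤ ·))
    (hk : σ.enval e = toKey m.ekey → σ.emk e = true) :
    Cand σ.log t fun G => (m.key₁, m.ekey) ∉ G.edges := by
  obtain ⟨w, hw, he, h⟩ := h
  rcases h with h | h
  · exact h
  · refine .now fun hmem => ?_
    obtain ⟨x, z, hx, hxk, hz, hzm, hzk⟩ := I.edge_mem _ _ hmem
    obtain rfl := I.vkey x w (by simp [hx]) (by simp [hw.1]) (hxk.trans hw.2.symm)
    rcases ((I.elist x (by simp [hx])).reach_val he.1 (h z hz hzm hzk)).2 with rfl | hlt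
    · rw [hk hzk] at hzm; cases hzm
    · rw [hzk] at hlt
      exact absurd he.2 hlt.not_ge

theorem CEPre.next_fail (I : σ.Inv) (h : σ.CEPre t m)
    (hC : Cand σ.log t fun G => (m.key₁, m.ekey) ∉ G.edges) : σ.Next t m σ.mem (.ret false) :=
  HPre.next_fail I ⟨h.1, .inr h.2.1⟩ (hC.mono fun _ hG => .inr ⟨h.2.1, hG⟩)

theorem Inv.step_ceHead (I : σ.Inv) (h : σ.At t m (.ceHead v))
    (hs : step t m σ.mem (.ceHead v) = some (μ', p')) : σ.Next t m μ' p' := by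
  simp only [step, Option.some.injEq, Prod.mk.injEq] at hs
  obtain ⟨rfl, rfl⟩ := hs
  have := I.elist v (by simp [h.2.1])
  exact I.next ⟨h.1, v, h.2, ⟨this.head_mem, trivial⟩, .inr fun z hz hm _ => this.reach z hz hm⟩

theorem Inv.step_ceTest (I : σ.Inv) (h : σ.At t m (.ceTest e))
    (hs : step t m σ.mem (.ceTest e) = some (μ', p')) : σ.Next t m μ' p' := by
  simp only [step, Option.some.injEq, Prod.mk.injEq] at hs
  obtain ⟨rfl, rfl⟩ := hs
  obtain ⟨h1, w, h2, h3, h4⟩ := h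
  split_ifs with hc
  · exact I.next ⟨h1, w, h2, ⟨h3.1, hc⟩, h4⟩
  · exact I.next ⟨h1, w, h2, ⟨h3.1, not_lt.1 hc⟩, h4⟩

theorem Inv.step_ceNext (I : σ.Inv) (h : σ.At t m (.ceNext e))
    (hs : step t m σ.mem (.ceNext e) = some (μ', p')) : σ.Next t m μ' p' := by
  simp only [step] at hs
  split at hs
  · next e' he =>
    simp only [Option.some.injEq, Prod.mk.injEq] at hs
    obtain ⟨rfl, rfl⟩ := hs
    obtain ⟨h1, w, h2, h3, h4⟩ := h
    exact I.next ⟨h1, w, h2, (I.E_next h3 he).mono fun _ _ => trivial,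
      h4.imp_right fun h z hz hm hzk => SortedList.reach_next (h z hz hm hzk)
        (by rintro rfl; exact h3.2.ne hzk) he⟩
  · cases hs

theorem Inv.step_ceVal (I : σ.Inv) (h : σ.At t m (.ceVal e))
    (hs : step t m σ.mem (.ceVal e) = some (μ', p')) : σ.Next t m μ' p' := by
  simp only [step, Option.some.injEq, Prod.mk.injEq] at hs
  obtain ⟨rfl, rfl⟩ := hs
  have h' := h
  obtain ⟨h1, w, h2, h3, h4⟩ := h
  split_ifs with hc
  · exact h1.next_fail I (h'.2.absent I fun h => absurd h hc)
  · exact I.next ⟨h1, w, h2, ⟨h3.1, not_ne_iff.1 hc⟩, h4⟩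

theorem Inv.step_ceMark (I : σ.Inv) (h : σ.At t m (.ceMark e))
    (hs : step t m σ.mem (.ceMark e) = some (μ', p')) : σ.Next t m μ' p' := by
  simp only [step, Option.some.injEq, Prod.mk.injEq] at hs
  obtain ⟨rfl, rfl⟩ := hs
  obtain ⟨h1, w, h2, h3, h4⟩ := h
  split_ifs with hc
  · exact h1.next_fail I (CTrav.absent I ⟨w, h2, h3.mono fun _ h => h.ge, h4⟩ fun _ => hc)
  · have hab : m.fstKey = m.key₁ ∧ m.sndKey = m.ekey ∨ m.fstKey = m.ekey ∧ m.sndKey = m.key₁ :=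
      (fstKey_cases m).imp And.right And.right
    -- The unmarked edge node shows only that the edge existed at some time; the two sightings of
    -- the endpoints move this time into the call.
    obtain ⟨B, A, hL, hq, he⟩ := h1.2.2.edge I.valid hab
      (I.edge_ever w e _ _ h3.1 (by simpa using hc) h2.2 h3.2)
    have hv := (I.valid.of_suffix ⟨B, hL.symm⟩).edges he
    have hm := h1.2.1
    refine I.next_lin h1.1 ⟨B, A, hL, hq, ?_⟩ (by intro z hz; rw [hz] at hm; cases hm)
      (by intro u v hz; rw [hz] at hm; cases hm)
    rw [hm]
    exact ⟨⟨⟨hv.1, hv.2.1, he⟩, rfl⟩, rfl⟩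

end Traversals

/-- Every atomic step preserves the invariant and establishes the next assertion. -/
theorem Inv.step (I : σ.Inv) (h : σ.At t m p) (hs : step t m σ.mem p = some (μ', p')) :
    σ.Next t m μ' p' := by
  cases p with
  | lvHead => exact I.step_lvHead h hs
  | lvNext => exact I.step_lvNext h hs
  | lvTest => exact I.step_lvTest h hs
  | lvLock1 => exact I.step_lvLock1 h hs
  | lvLock2 => exact I.step_lvLock2 h hs
  | lvValid1 => exact I.step_lvValid1 h hs
  | lvValid2 => exact I.step_lvValid2 h hs
  | lvValid3 => exact I.step_lvValid3 h hs
  | vTest => exact I.step_vTest h hs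
  | avNew => exact I.step_avNew h hs
  | avSet => exact I.step_avSet h hs
  | avLink => exact I.step_avLink h hs
  | rvMark => exact I.step_rvMark h hs
  | rvRead => exact I.step_rvRead h hs
  | rvUnlink => exact I.step_rvUnlink h hs
  | vRel1 => exact I.step_vRel1 h hs
  | vRel2 => exact I.step_vRel2 h hs
  | riHead => exact I.step_riHead h hs
  | riTest => exact I.step_riTest h hs
  | riNext => exact I.step_riNext h hs
  | hsHead => exact I.step_hsHead h hs
  | hsTest1 => exact I.step_hsTest1 h hs
  | hsNext1 => exact I.step_hsNext1 h hs
  | hsVal1 => exact I.step_hsVal1 h hs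
  | hsMark1 => exact I.step_hsMark1 h hs
  | hsTest2 => exact I.step_hsTest2 h hs
  | hsNext2 => exact I.step_hsNext2 h hs
  | hsVal2 => exact I.step_hsVal2 h hs
  | hsMark2 => exact I.step_hsMark2 h hs
  | leMark1 => exact I.step_leMark1 h hs
  | leMark2 => exact I.step_leMark2 h hs
  | leHead => exact I.step_leHead h hs
  | leNext => exact I.step_leNext h hs
  | leTest => exact I.step_leTest h hs
  | leLock1 => exact I.step_leLock1 h hs
  | leLock2 => exact I.step_leLock2 h hs
  | leValid1 => exact I.step_leValid1 h hs
  | leValid2 => exact I.step_leValid2 h hs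
  | leValid3 => exact I.step_leValid3 h hs
  | eTest => exact I.step_eTest h hs
  | aeNew => exact I.step_aeNew h hs
  | aeSet => exact I.step_aeSet h hs
  | aeLink => exact I.step_aeLink h hs
  | reMark => exact I.step_reMark h hs
  | reRead => exact I.step_reRead h hs
  | reUnlink => exact I.step_reUnlink h hs
  | eRel1 => exact I.step_eRel1 h hs
  | eRel2 => exact I.step_eRel2 h hs
  | cvHead => exact I.step_cvHead h hs
  | cvTest => exact I.step_cvTest h hs
  | cvNext => exact I.step_cvNext h hs
  | cvVal => exact I.step_cvVal h hs
  | cvMark => exact I.step_cvMark h hs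
  | ceHead => exact I.step_ceHead h hs
  | ceTest => exact I.step_ceTest h hs
  | ceNext => exact I.step_ceNext h hs
  | ceVal => exact I.step_ceVal h hs
  | ceMark => exact I.step_ceMark h hs
  | ret => simp [ConcGraph.step] at hs

end State

end ConcGraph

namespace ConcGraph

variable {T : Type*} [DecidableEq T]

/-! ## Valid logs have linearizable histories -/

/-- The sequential history of the linearization points of a log. -/
def linHist : Log T → History T
  | [] => []
  | .ev _ :: L => linHist L
  | .lin t m b :: L => linHist L ++ [.inv t m, .rsp t m b]

theorem restrict_append (t : T) (H K : History T) :
    restrict t (H ++ K) = restrict t H ++ restrict t K := List.filter_append ..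

theorem restrict_cons (t : T) (e : Event T) (H : History T) :
    restrict t (e :: H) = if e.thread = t then e :: restrict t H else restrict t H := by
  simp [restrict, List.filter_cons]

theorem restrict_nil (t : T) : restrict t ([] : History T) = [] := rfl

theorem countP_restrict (t : T) (H : History T) (b : Bool) :
    H.countP (fun e => e.thread = t ∧ e.isInv = b) =
      (restrict t H).countP fun e => e.isInv = b := by
  rw [restrict, List.countP_filter]
  congr 1
  funext e
  simp [and_comm]

/-- The events of a thread in the history and in the sequential history of a log. -/
def Agrees (t : T) (L : Log T) : CallState → Prop
  | .idle => restrict t (evs L) = restrict t (linHist L)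
  | .pend m => restrict t (evs L) = restrict t (linHist L) ++ [.inv t m]
  | .done m b => restrict t (linHist L) = restrict t (evs L) ++ [.rsp t m b]

/-- For each thread the two histories differ by at most one event: an invocation not yet linearized,
or a response not yet given. -/
theorem ValidLog.agrees {L : Log T} (hL : ValidLog L) (t : T) : Agrees t L (callState t L) := by
  induction L with
  | nil => rfl
  | cons x L ih =>
    have ih := ih hL.2
    have h1 := hL.1.1
    by_cases hx : x.thread = t
    · subst hx
      rw [h1] at ih
      simp only [callState, if_true]
      rcases x with (⟨s, m⟩ | ⟨s, m, b⟩) | ⟨s, m, b⟩ <;>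
        simp only [Entry.pre, Entry.post, Agrees, evs, linHist, restrict_append, restrict_cons,
          restrict_nil, Entry.thread, Event.thread, if_true] at ih ⊢ <;> simp [ih]
    · simp only [callState, hx, if_false]
      rcases hc : callState t L with _ | m' | ⟨m', b'⟩ <;> rw [hc] at ih <;>
        rcases x with (⟨s, m⟩ | ⟨s, m, b⟩) | ⟨s, m, b⟩ <;>
        simp only [Entry.thread, Event.thread] at hx <;>
        simpa [Agrees, evs, linHist, restrict_append, restrict_cons, restrict_nil, Event.thread,
          hx] using ih

theorem IsSequential.linHist_append (L : Log T) {S : History T} (hS : IsSequential S) :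
    IsSequential (linHist L ++ S) := by
  induction L generalizing S with
  | nil => exact hS
  | cons x L ih =>
    rcases x with e | ⟨t, m, b⟩
    · exact ih hS
    · rw [linHist, List.append_assoc]
      exact ih ⟨rfl, rfl, hS⟩

theorem IsSequential.restrict_linHist_append (t : T) (L : Log T) {S : History T}
    (hS : IsSequential S) : IsSequential (restrict t (linHist L) ++ S) := by
  induction L generalizing S with
  | nil => exact hS
  | cons x L ih =>
    rcases x with e | ⟨s, m, b⟩
    · exact ih hS
    · rw [linHist, restrict_append, List.append_assoc]
      refine ih ?_
      by_cases hs : s = t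
      · simp only [restrict_cons, Event.thread, hs, if_true]
        exact ⟨rfl, rfl, hS⟩
      · simpa [restrict_cons, restrict_nil, Event.thread, hs] using hS

theorem ValidLog.legalFrom {L : Log T} (hL : ValidLog L) {S : History T}
    (hS : LegalFrom (graph L) S) : LegalFrom ⟨∅, ∅⟩ (linHist L ++ S) := by
  induction L generalizing S with
  | nil => exact hS
  | cons x L ih =>
    rcases x with e | ⟨t, m, b⟩
    · exact ih hL.2 hS
    · rw [linHist, List.append_assoc]
      exact ih hL.2 ⟨_, hL.1.2.1, hS⟩

theorem ValidLog.wellFormed {L : Log T} (hL : ValidLog L)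
    (hd : ∀ t m b, callState t L ≠ .done m b) : WellFormed (evs L) := by
  intro t
  have h := hL.agrees t
  rcases hc : callState t L with _ | m | ⟨m, b⟩
  · rw [hc] at h
    rw [show restrict t (evs L) = restrict t (linHist L) ++ [] by simpa [Agrees] using h]
    exact IsSequential.restrict_linHist_append t L trivial
  · rw [hc] at h
    rw [show restrict t (evs L) = restrict t (linHist L) ++ [.inv t m] from h]
    exact IsSequential.restrict_linHist_append t L trivial
  · exact absurd hc (hd t m b)

/-- Every invocation of `t` is followed by another event of `t`. -/
def NoPending (t : T) (H : History T) : Prop :=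
  ∀ P m Q, H = P ++ .inv t m :: Q → ∃ e ∈ Q, e.thread = t

/-- Linearization points contribute invocation and response together, so no thread ends with an open
call. -/
theorem restrict_linHist_ne (t : T) (L : Log T) (P : History T) (m : Method) :
    restrict t (linHist L) ≠ P ++ [.inv t m] := by
  induction L with
  | nil => simp [linHist, restrict]
  | cons x L ih =>
    rcases x with e | ⟨s, m', b⟩
    · exact ih
    · rw [linHist, restrict_append]
      by_cases hs : s = t
      · subst hs
        intro h
        have := congrArg List.getLast? h
        simp [restrict_cons, restrict_nil, Event.thread] at this
      · simpa [restrict_cons, restrict_nil, Event.thread, hs] using ih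

theorem ValidLog.noPending {L : Log T} (hL : ValidLog L) {t : T} (h : callState t L = .idle) :
    NoPending t (evs L) := by
  intro P m Q hPQ
  by_contra hQ
  push Not at hQ
  have hA := hL.agrees t
  rw [h] at hA
  refine restrict_linHist_ne t L (restrict t P) m ?_
  have hQ' : restrict t Q = [] := List.filter_eq_nil_iff.2 (by simpa using hQ)
  rw [← show restrict t (evs L) = restrict t (linHist L) from hA, hPQ, restrict_append,
    restrict_cons, hQ']
  simp [Event.thread]

theorem dropPending_eq_self {H : History T} (h : ∀ t, NoPending t H) : dropPending H = H := by
  induction H with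
  | nil => rfl
  | cons e H ih =>
    rw [dropPending, ih fun t P m Q hPQ => h t (e :: P) m Q (by simp [hPQ]), if_neg]
    rintro ⟨he, hn⟩
    rcases e with ⟨t, m⟩ | ⟨t, m, b⟩
    · obtain ⟨e', he', ht⟩ := h t [] m H rfl
      exact hn e' he' ht
    · cases he

/-- The erased invocation was pending, hence dropped anyway. It was not needed to keep an earlier
event of `t`, because each earlier invocation of `t` already has a successor inside `P`. -/
theorem dropPending_erase {P Q : History T} {t : T} (m : Method) (hP : NoPending t P)
    (hQ : ∀ e ∈ Q, e.thread ≠ t) : dropPending (P ++ .inv t m :: Q) = dropPending (P ++ Q) := by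
  induction P with
  | nil => simpa [dropPending, Event.isInv, Event.thread] using fun e he ht => absurd ht (hQ e he)
  | cons e P ih =>
    have ih := ih fun P' m' Q' hPQ => hP (e :: P') m' Q' (by simp [hPQ])
    rw [List.cons_append, List.cons_append, dropPending, dropPending, ih]
    congr 1
    rw [eq_iff_iff, and_congr_right_iff]
    intro he
    rcases e with ⟨s, m'⟩ | ⟨s, m', b⟩
    · by_cases hs : s = t
      · subst hs
        obtain ⟨e', he', ht⟩ := hP [] m' P rfl
        exact iff_of_false (fun h => h e' (by simp [he']) ht) fun h => h e' (by simp [he']) ht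
      · simp [Event.thread, or_imp, forall_and, Ne.symm hs]
    · cases he

theorem graph_erase (t : T) (m : Method) (B A : Log T) :
    graph (B ++ .ev (.inv t m) :: A) = graph (B ++ A) :=
  graph_append_congr B rfl

theorem evs_append (B A : Log T) : evs (B ++ A) = evs A ++ evs B := by
  induction B with
  | nil => simp [evs]
  | cons x B ih => cases x <;> simp [evs, ih]

/-- Invocations do not affect the abstract graph, and no later entry of `t` depends on this one. -/
theorem ValidLog.erase {B A : Log T} {t : T} {m : Method}
    (h : ValidLog (B ++ .ev (.inv t m) :: A)) (hB : Quiet t B) : ValidLog (B ++ A) := by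
  induction B with
  | nil => exact h.2
  | cons y B ih =>
    rw [Quiet.cons] at hB
    refine ⟨?_, ih h.2 hB.2⟩
    obtain ⟨h1, h2⟩ := h.1
    change callState _ (B ++ _) = _ at h1
    rw [callState_insert (Ne.symm hB.1)] at h1
    refine ⟨h1, ?_⟩
    rcases y with e | ⟨s, m', b⟩
    · trivial
    · simp only at h2 ⊢
      change Spec (graph (B ++ _)) _ _ (Method.effect _ _ (graph (B ++ _))) ∧
        (∀ z, _ → ∀ D, D <:+ B ++ _ → _) ∧ _ at h2
      rw [graph_erase] at h2
      refine ⟨h2.1, fun z hz D hD => ?_, h2.2.2⟩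
      obtain ⟨E, hE⟩ := hD
      rcases append_eq_cases hE.symm with ⟨C, rfl, hA⟩ | ⟨C, -, rfl, rfl⟩
      · exact h2.2.1 z hz D ⟨B ++ .ev (.inv t m) :: C, by simp [hA]⟩
      · rw [← graph_erase t m]
        exact h2.2.1 z hz _ ⟨E, by simp⟩

theorem exists_eq_of_pend {L : Log T} {t : T} {m : Method} (h : callState t L = .pend m) :
    ∃ B A, L = B ++ .ev (.inv t m) :: A ∧ Quiet t B := by
  induction L with
  | nil => cases h
  | cons x L ih =>
    by_cases hx : x.thread = t
    · simp only [callState, hx, if_true] at h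
      rcases x with (⟨s, m'⟩ | ⟨s, m', b⟩) | ⟨s, m', b⟩ <;> cases h
      cases hx
      exact ⟨[], L, rfl, Quiet.nil _⟩
    · simp only [callState, hx, if_false] at h
      obtain ⟨B, A, rfl, hB⟩ := ih h
      exact ⟨x :: B, A, rfl, Quiet.cons.2 ⟨hx, hB⟩⟩

theorem Quiet.thread_ne {t : T} {B : Log T} (h : Quiet t B) : ∀ e ∈ evs B, e.thread ≠ t := by
  induction B with
  | nil => simp [evs]
  | cons x B ih =>
    rw [Quiet.cons] at h
    have := ih h.2
    cases x with
    | ev e =>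
      have := h.1
      simp only [evs, List.mem_append, List.mem_singleton]
      rintro e' (he | rfl)
      exacts [ih h.2 e' he, h.1]
    | lin s m b => exact this

theorem callState_eq_idle {t : T} {L : Log T} (h : Quiet t L) : callState t L = .idle := by
  rw [← List.append_nil L, callState_append h]
  rfl

/-- Calls that have taken effect may respond. -/
theorem ValidLog.exists_respond {L : Log T} (hL : ValidLog L) (ts : List T) :
    ∃ (L' : Log T) (R : History T), ValidLog L' ∧ evs L' = evs L ++ R ∧
      (∀ e ∈ R, e.isInv = false) ∧
      ∀ t m b, callState t L' = .done m b → callState t L = .done m b ∧ t ∉ ts := by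
  induction ts with
  | nil => exact ⟨L, [], hL, by simp, by simp, by simp⟩
  | cons t ts ih =>
    obtain ⟨L', R, h1, h2, h3, h4⟩ := ih
    by_cases hd : ∃ m b, callState t L' = .done m b
    · obtain ⟨m, b, hd⟩ := hd
      refine ⟨.ev (.rsp t m b) :: L', R ++ [.rsp t m b], ⟨⟨hd, trivial⟩, h1⟩,
        by simp [evs, h2], ?_, fun s m' b' hs => ?_⟩
      · simp only [List.mem_append, List.mem_singleton]
        rintro e (he | rfl)
        exacts [h3 e he, rfl]
      · by_cases hst : t = s
        · simp [callState, Entry.thread, Event.thread, hst, Entry.post] at hs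
        · simp only [callState, Entry.thread, Event.thread, hst, if_false] at hs
          simpa [Ne.symm hst] using h4 s m' b' hs
    · refine ⟨L', R, h1, h2, h3, fun s m' b' hs => ?_⟩
      have hst : s ≠ t := by
        rintro rfl
        exact hd ⟨m', b', hs⟩
      simpa [hst] using h4 s m' b' hs

/-- Calls that have not taken effect may be discarded. -/
theorem ValidLog.exists_dropPending {ts : List T} {L : Log T} (hL : ValidLog L)
    (hd : ∀ t m b, callState t L ≠ .done m b) (hts : ∀ t, callState t L ≠ .idle → t ∈ ts) :
    ∃ L', ValidLog L' ∧ (∀ t, callState t L' = .idle) ∧ evs L' = dropPending (evs L) := by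
  induction ts generalizing L with
  | nil =>
    have hi : ∀ t, callState t L = .idle := by simpa using hts
    exact ⟨L, hL, hi, (dropPending_eq_self fun t => hL.noPending (hi t)).symm⟩
  | cons t ts ih =>
    rcases hc : callState t L with _ | m | ⟨m, b⟩
    · refine ih hL hd fun s hs => (List.mem_cons.1 (hts s hs)).resolve_left ?_
      rintro rfl
      exact hs hc
    -- A pending call has left only its invocation in the log, which is therefore the newest entry
    -- of its thread and can be erased.
    · obtain ⟨B, A, rfl, hB⟩ := exists_eq_of_pend hc
      have hA : callState t A = .idle := hL.of_append.1.1
      have hs : ∀ s, s ≠ t → callState s (B ++ .ev (.inv t m) :: A) = callState s (B ++ A) :=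
        fun s hst => callState_insert (x := .ev (.inv t m)) (Ne.symm hst) B A
      have ht : callState t (B ++ A) = .idle := by rw [callState_append hB, hA]
      obtain ⟨L', h1, h2, h3⟩ := ih (L := B ++ A) (hL.erase hB) (fun s m' b' h => by
        rcases eq_or_ne s t with rfl | hst
        · rw [ht] at h; cases h
        · exact hd s m' b' (by rw [hs s hst, h])) fun s h => by
        have hst : s ≠ t := by
          rintro rfl
          exact h ht
        exact (List.mem_cons.1 (hts s (by rwa [hs s hst]))).resolve_left hst
      refine ⟨L', h1, h2, h3.trans ?_⟩
      rw [evs_append, evs_append, evs, List.append_assoc]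
      exact (dropPending_erase m (ValidLog.noPending hL.of_append.2 hA) hB.thread_ne).symm
    · exact absurd hc (hd t m b)

theorem exists_take_evs (L : Log T) (n : ℕ) : ∃ A, A <:+ L ∧ (evs L).take n = evs A := by
  induction L with
  | nil => exact ⟨[], List.suffix_rfl, by simp [evs]⟩
  | cons x L ih =>
    obtain ⟨A, hA, h⟩ := ih
    rcases x with e | ⟨t, m, b⟩
    · by_cases hn : n ≤ (evs L).length
      · exact ⟨A, hA.trans (List.suffix_cons _ _), by
          rw [evs, List.take_append_of_le_length hn, h]⟩
      · exact ⟨_, List.suffix_rfl, List.take_of_length_le (by simp [evs]; omega)⟩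
    · exact ⟨A, hA.trans (List.suffix_cons _ _), h⟩

theorem linHist_append (B A : Log T) : linHist (B ++ A) = linHist A ++ linHist B := by
  induction B with
  | nil => simp [linHist]
  | cons x B ih => cases x <;> simp [linHist, ih]

/-- Each linearization point lies between the invocation and the response of its call. Cutting the
log at one place thus separates `a` from `b` in both histories. -/
theorem ValidLog.precedes {L : Log T} (hL : ValidLog L) (hi : ∀ t, callState t L = .idle)
    {a b : T × ℕ} (h : Precedes (evs L) a b) : Precedes (linHist L) a b := by
  obtain ⟨n, h1, h2, h3⟩ := h
  obtain ⟨A, hA, hn⟩ := exists_take_evs L n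
  have hvA := hL.of_suffix hA
  rw [hn] at h1 h2
  obtain ⟨B, rfl⟩ := hA
  -- Before the cut, every response in the history has its linearization point, and every
  -- linearization point has its invocation in the history; this gives the two inequalities between
  -- the counts.
  refine ⟨(linHist A).length, ?_⟩
  rw [linHist_append, List.take_left', ← linHist_append]
  · rw [countP_restrict] at h1 h2 h3
    simp only [countP_restrict]
    refine ⟨h1.trans_le ?_, le_trans ?_ h2, ?_⟩
    · have h := hvA.agrees a.1
      generalize callState a.1 A = c at h
      rcases c with _ | m | ⟨m, c⟩ <;> simp only [Agrees] at h <;> rw [h] <;>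
        simp [Event.isInv]
    · have h := hvA.agrees b.1
      generalize callState b.1 A = c at h
      rcases c with _ | m | ⟨m, c⟩ <;> simp only [Agrees] at h <;> rw [h] <;>
        simp [Event.isInv]
    · have h := hL.agrees b.1
      rw [hi] at h
      rwa [← show restrict b.1 (evs (B ++ A)) = restrict b.1 (linHist (B ++ A)) from h]
  · rfl

theorem ValidLog.linearizable {L : Log T} (hL : ValidLog L) : Linearizable (evs L) := by
  have hts : ∀ t, callState t L ≠ .idle → t ∈ L.map Entry.thread := by
    intro t h
    by_contra ht
    refine h (callState_eq_idle fun x hx hxt => ht ?_)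
    exact List.mem_map.2 ⟨x, hx, hxt⟩
  -- There may be infinitely many threads, but only those that occur in the log can have an open
  -- call.
  obtain ⟨L₁, R, h1, h2, h3, h4⟩ := hL.exists_respond (L.map Entry.thread)
  have hd : ∀ t m b, callState t L₁ ≠ .done m b := by
    intro t m b h
    have := h4 t m b h
    exact this.2 (hts t (by simp [this.1]))
  obtain ⟨L₂, g1, g2, g3⟩ := h1.exists_dropPending (ts := L₁.map Entry.thread) hd (by
    intro t h
    by_contra ht
    refine h (callState_eq_idle fun x hx hxt => ht ?_)
    exact List.mem_map.2 ⟨x, hx, hxt⟩)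
  refine ⟨evs L₂, linHist L₂, ⟨R, h3, ?_, ?_⟩, fun t => ?_, fun a b => g1.precedes g2, ?_, ?_⟩
  · rw [← h2]; exact h1.wellFormed hd
  · rw [← h2]; exact g3
  · have := g1.agrees t
    rwa [g2 t] at this
  · simpa using IsSequential.linHist_append L₂ (S := []) trivial
  · simpa using g1.legalFrom (S := []) trivial

end ConcGraph

namespace ConcGraph

variable {T : Type*} [DecidableEq T]

/-! ## Executions -/

theorem UniqueVertexKeys.of_append {H K : History T} (h : UniqueVertexKeys (H ++ K)) :
    UniqueVertexKeys H := by
  intro i j t t' u hi hj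
  have hlen : H.length ≤ (H ++ K).length := by simp
  have := h (Fin.castLE hlen i) (Fin.castLE hlen j) t t' u (by simpa using hi) (by simpa using hj)
  exact Fin.castLE_injective hlen this

theorem UniqueVertexKeys.not_mem {H : History T} {t t' : T} {u : ℤ}
    (h : UniqueVertexKeys (H ++ [.inv t (.addVertex u)])) : .inv t' (.addVertex u) ∉ H := by
  intro hm
  obtain ⟨i, hi, he⟩ := List.mem_iff_getElem.1 hm
  have := h ⟨i, by simp; omega⟩ ⟨H.length, by simp⟩ t' t u (by simp [hi, he]) (by simp)
  simp only [Fin.mk.injEq] at this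
  omega

theorem UniqueVertexKeys.thread_eq {H : History T} {t t' : T} {u : ℤ} (h : UniqueVertexKeys H)
    (ht : .inv t (.addVertex u) ∈ H) (ht' : .inv t' (.addVertex u) ∈ H) : t = t' := by
  obtain ⟨i, hi, he⟩ := List.mem_iff_getElem.1 ht
  obtain ⟨j, hj, he'⟩ := List.mem_iff_getElem.1 ht'
  have := h ⟨i, hi⟩ ⟨j, hj⟩ t t' u he he'
  simp only [Fin.mk.injEq] at this
  subst this
  simpa using he.symm.trans he'

theorem NoSelfLoops.of_append {H K : History T} (h : NoSelfLoops (H ++ K)) : NoSelfLoops H :=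
  fun t u v huv => h t u v (huv.imp (List.mem_append_left _) (List.mem_append_left _))

/-! ### The initial state, and the recording of invocations and responses. -/

namespace State

variable {t t' : T} {m m' : Method} {σ σ' : State T}

/-- The initial state. -/
def init : State T where
  mem := initMem
  log := []
  vs v := if v < 2 then .linked else .free
  es e := if e < 2 then .linked 0 else if e < 4 then .linked 1 else .free

theorem init_free (v : ℕ) : (init : State T).vs v = .free ↔ 2 ≤ v := by
  by_cases h : v < 2
  · simp only [init, h, if_true, reduceCtorEq, false_iff]
    omega
  · simpa only [init, h, if_false, true_iff] using not_lt.1 h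

theorem init_linked (v : ℕ) : (init : State T).vs v = .linked ↔ v = 0 ∨ v = 1 := by
  rw [show v = 0 ∨ v = 1 ↔ v < 2 by omega]
  by_cases h : v < 2 <;> simp only [init, h, if_true, if_false, reduceCtorEq]

theorem init_allocated (v : ℕ) : (init : State T).vs v ≠ .free ↔ v = 0 ∨ v = 1 := by
  rw [ne_eq, init_free]
  omega

theorem init_efree (e : ℕ) : (init : State T).es e = .free ↔ 4 ≤ e := by
  by_cases h : e < 2
  · simp only [init, h, if_true, reduceCtorEq, false_iff]
    omega
  · by_cases h' : e < 4
    · simp only [init, h, h', if_true, if_false, reduceCtorEq, false_iff]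
      omega
    · simpa only [init, h, h', if_false, true_iff] using not_lt.1 h'

theorem init_elinked (e w : ℕ) :
    (init : State T).es e = .linked w ↔ w = 0 ∧ (e = 0 ∨ e = 1) ∨ w = 1 ∧ (e = 2 ∨ e = 3) := by
  by_cases h : e < 2
  · simp only [init, h, if_true, EStat.linked.injEq]
    change 0 = w ↔ _
    omega
  · by_cases h' : e < 4
    · simp only [init, h, h', if_true, if_false, EStat.linked.injEq]
      change 1 = w ↔ _
      omega
    · simp only [init, h, h', if_false, reduceCtorEq, false_iff]
      omega

theorem init_inv : (init : State T).Inv := by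
  have hv0 : (init : State T).mem.vnode 0 = ⟨⊥, some 1, 0, 1, false, none⟩ := rfl
  have hv1 : (init : State T).mem.vnode 1 = ⟨⊤, none, 2, 3, false, none⟩ := rfl
  have he0 : (init : State T).mem.enode 0 = newENode ⊥ (some 1) := rfl
  have he1 : (init : State T).mem.enode 1 = newENode ⊤ none := rfl
  have he2 : (init : State T).mem.enode 2 = newENode ⊥ (some 3) := rfl
  have he3 : (init : State T).mem.enode 3 = newENode ⊤ none := rfl
  have hkey : ∀ x, (init : State T).vs x ≠ .free → ∀ k, (init : State T).vval x ≠ toKey k := by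
    intro x hx k
    rcases (init_allocated x).1 hx with rfl | rfl
    · simp [vval, hv0, toKey]
    · simp only [vval, hv1, toKey]
      exact fun h => WithTop.top_ne_coe (WithBot.coe_injective h)
  have hfree : ∀ x, (init : State T).vs x = .linked → (init : State T).vs x ≠ .free := by
    intro x hx h
    rw [hx] at h
    cases h
  refine ⟨trivial, fun v => ?_, fun e => ?_, fun e w he => ?_, fun x y hx hy h => ?_,
    fun x k hx h => absurd h (hkey x hx k), ⟨?_, ?_, fun x y hx h => ?_, fun z hz _ => ?_⟩,
    fun w hw => ?_, fun z => ?_, fun A hA z hz => ?_, fun x e u v he _ hu => ?_, fun u v h => ?_⟩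
  · exact init_free v
  · exact init_efree e
  · rw [init_allocated]
    rcases (init_elinked e w).1 he with h | h
    exacts [.inl h.1, .inr h.1]
  · rcases (init_allocated x).1 hx with rfl | rfl <;> rcases (init_allocated y).1 hy with rfl | rfl <;>
      simp_all [vval]
  · exact (init_linked _).2 (.inl rfl)
  · rfl
  · rcases (init_linked x).1 hx with rfl | rfl
    · obtain rfl : 1 = y := by simpa [vnxt, hv0] using h
      exact ⟨(init_linked _).2 (.inr rfl), by simp [vval, hv0, hv1]⟩
    · simp [vnxt, hv1] at h
  · rcases (init_linked z).1 hz with rfl | rfl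
    · exact .refl
    · exact .single ⟨(init_linked _).2 (.inl rfl), rfl⟩
  · rcases (init_allocated w).1 hw with rfl | rfl
    · refine ⟨(init_elinked _ _).2 (.inl ⟨rfl, .inl rfl⟩), rfl, fun x y hx h => ?_,
        fun z hz _ => ?_⟩
      · obtain hx : x = 0 ∨ x = 1 := by simpa using (init_elinked x 0).1 hx
        rcases hx with rfl | rfl
        · obtain rfl : 1 = y := by simpa [enxt, he0, newENode] using h
          exact ⟨(init_elinked _ _).2 (.inl ⟨rfl, .inr rfl⟩),
            by simp [enval, he0, he1, newENode]⟩
        · simp [enxt, he1, newENode] at h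
      · obtain hz : z = 0 ∨ z = 1 := by simpa using (init_elinked z 0).1 hz
        rcases hz with rfl | rfl
        · exact .refl
        · exact .single ⟨(init_elinked _ _).2 (.inl ⟨rfl, .inl rfl⟩), rfl⟩
    · refine ⟨(init_elinked _ _).2 (.inr ⟨rfl, .inl rfl⟩), rfl, fun x y hx h => ?_,
        fun z hz _ => ?_⟩
      · obtain hx : x = 2 ∨ x = 3 := by simpa using (init_elinked x 1).1 hx
        rcases hx with rfl | rfl
        · obtain rfl : 3 = y := by simpa [enxt, he2, newENode] using h
          exact ⟨(init_elinked _ _).2 (.inr ⟨rfl, .inr rfl⟩),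
            by simp [enval, he2, he3, newENode]⟩
        · simp [enxt, he3, newENode] at h
      · obtain hz : z = 2 ∨ z = 3 := by simpa using (init_elinked z 1).1 hz
        rcases hz with rfl | rfl
        · exact .refl
        · exact .single ⟨(init_elinked _ _).2 (.inr ⟨rfl, .inl rfl⟩), rfl⟩
  · refine iff_of_false (by simp [init, graph]) ?_
    rintro ⟨x, hx, -, h⟩
    exact hkey x (hfree x hx) z h
  · obtain rfl : A = [] := List.suffix_nil.1 hA
    simp [graph] at hz
  · refine absurd hu (hkey x ?_ u)
    rw [init_allocated]
    rcases (init_elinked e x).1 he with h | h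
    exacts [.inl h.1, .inr h.1]
  · simp [init, graph] at h

/-- An invocation or a response is recorded. -/
def event (σ : State T) (e : Event T) : State T := { σ with log := .ev e :: σ.log }

theorem Inv.event (I : σ.Inv) {e : Event T} (he : (Entry.ev e).Legal σ.log) : (σ.event e).Inv where
  valid := ⟨he, I.valid⟩
  vfree := I.vfree
  efree := I.efree
  eowner := I.eowner
  vkey := I.vkey
  vsrc x k hx hk := by
    obtain ⟨t, ht⟩ := I.vsrc x k hx hk
    exact ⟨t, List.mem_append_left _ ht⟩
  vlist := I.vlist
  elist := I.elist
  verts := I.verts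
  ever A hA z hz := by
    rcases List.suffix_cons_iff.1 hA with rfl | hA
    · exact I.ever σ.log List.suffix_rfl z hz
    · exact I.ever A hA z hz
  edge_ever x y u v h1 h2 h3 h4 :=
    EdgeEver.insert (B := []) (.inl rfl) .inl (I.edge_ever x y u v h1 h2 h3 h4)
  edge_mem := I.edge_mem

theorem rely_event {e : Event T} (h : e.thread ≠ t) : Rely t m σ (σ.event e) :=
  Rely.log (by simp [callState, Entry.thread, h]) fun _ _ hc =>
    Cand₂.insert (B := []) (x := .ev e) (.inl rfl) h hc

/-- The hypotheses on the history enter here: unique keys make the key of a new `AddVertex` fresh,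
because each allocated node with that key would stem from an earlier invocation, and the absence of
self-loops gives the updates distinct keys. -/
theorem Inv.at_start (I : σ.Inv) {t : T} {m : Method}
    (hk : UniqueVertexKeys (evs σ.log ++ [.inv t m]))
    (hl : NoSelfLoops (evs σ.log ++ [.inv t m])) : (σ.event (.inv t m)).At t m m.start := by
  have hc : (σ.event (.inv t m)).Call t (.pend m) := by
    simp [Call, State.event, callState, Entry.thread, Event.thread, Entry.post]
  have hf : ∀ k, m = .addVertex k → ∀ x, σ.vs x ≠ .free → σ.vval x ≠ toKey k := by
    rintro k rfl x hx hxk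
    obtain ⟨s, hs⟩ := I.vsrc x k hx hxk
    exact hk.not_mem hs
  cases m with
  | addVertex u => exact ⟨hc, hf, .inl rfl⟩
  | removeVertex u => exact ⟨hc, hf, .inr rfl⟩
  | addEdge u v => exact ⟨hc, .inl ⟨.inl rfl, hl t u v (.inl (by simp))⟩⟩
  | removeEdge u v => exact ⟨hc, .inl ⟨.inr rfl, hl t u v (.inr (by simp))⟩⟩
  | containsVertex u => exact ⟨hc, rfl⟩
  | containsEdge u v => exact ⟨hc, .inr rfl⟩

end State

/-- The instrumented state describes the global state and the history. -/
structure Simulates (σ : State T) (c : Config T) (H : History T) : Prop where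
  mem : σ.mem = c.mem
  inv : σ.Inv
  evs : evs σ.log = H
  idle : ∀ t, c.loc t = none → callState t σ.log = .idle
  active : ∀ t m p, c.loc t = some (m, p) → σ.At t m p ∧ .inv t m ∈ H

/-- Induction over the execution. That the invocation of every active call is in the history is
carried along so that uniqueness of keys can be applied to two concurrent calls. -/
theorem Run.exists_simulates {c : Config T} {H : History T} (h : Run c H)
    (hk : UniqueVertexKeys H) (hl : NoSelfLoops H) : ∃ σ, Simulates σ c H := by
  induction h with
  | init => exact ⟨State.init, rfl, State.init_inv, rfl, fun _ _ => rfl, by simp [initConfig]⟩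
  | @invoke c H t m _ ht ih =>
    obtain ⟨σ, h⟩ := ih hk.of_append hl.of_append
    have hE := h.evs
    refine ⟨σ.event (.inv t m), h.mem, h.inv.event ⟨h.idle t ht, trivial⟩,
      by simp [State.event, evs, hE], fun s hs => ?_, fun s m' p hs => ?_⟩
    · have hst : s ≠ t := by
        rintro rfl
        simp at hs
      exact (State.rely_event (m := m) (Ne.symm hst)).call.trans
        (h.idle s (by simpa [hst] using hs))
    · by_cases hst : s = t
      · subst hst
        obtain ⟨rfl, rfl⟩ : m = m' ∧ m.start = p := by simpa using hs
        exact ⟨h.inv.at_start (hE ▸ hk) (hE ▸ hl), by simp⟩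
      · have := h.active s m' p (by simpa [hst] using hs)
        exact ⟨this.1.rely (State.rely_event (Ne.symm hst)), List.mem_append_left _ this.2⟩
  | @internal c H t m p p' μ' _ ht hs ih =>
    obtain ⟨σ, h⟩ := ih hk hl
    obtain ⟨hat, hmem⟩ := h.active t m p ht
    obtain ⟨σ', h1, hG, h2⟩ := h.inv.step hat (h.mem ▸ hs)
    refine ⟨σ', h1, hG.inv, hG.evs.trans h.evs, fun s hs => ?_, fun s m' q hs => ?_⟩
    · have hst : s ≠ t := by
        rintro rfl
        simp at hs
      -- An idle thread has no method; any method other than `AddVertex` will do, as only the call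
      -- state is used.
      exact (hG.rely s (.containsVertex 0) hst (by simp)).call.trans
        (h.idle s (by simpa [hst] using hs))
    · by_cases hst : s = t
      · subst hst
        obtain ⟨rfl, rfl⟩ : m = m' ∧ p' = q := by simpa using hs
        exact ⟨h2, hmem⟩
      · have := h.active s m' q (by simpa [hst] using hs)
        refine ⟨this.1.rely (hG.rely s m' hst ?_), this.2⟩
        -- Two threads adding the same key would have two invocations of `AddVertex` with that key
        -- in the history.
        rintro k rfl rfl
        exact hst (hk.thread_eq this.2 hmem)
  | @respond c H t m b _ ht ih =>
    obtain ⟨σ, h⟩ := ih hk.of_append hl.of_append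
    have hE := h.evs
    refine ⟨σ.event (.rsp t m b), h.mem, h.inv.event ⟨(h.active t m _ ht).1, trivial⟩,
      by simp [State.event, evs, hE], fun s hs => ?_, fun s m' p hs => ?_⟩
    · by_cases hst : s = t
      · simp [State.event, callState, Entry.thread, Event.thread, Entry.post, hst]
      · exact (State.rely_event (m := m) (Ne.symm hst)).call.trans
          (h.idle s (by simpa [hst] using hs))
    · have hst : s ≠ t := by
        rintro rfl
        simp at hs
      have := h.active s m' p (by simpa [hst] using hs)
      exact ⟨this.1.rely (State.rely_event (Ne.symm hst)), List.mem_append_left _ this.2⟩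

end ConcGraph

theorem mainTheorem1 {T : Type*} [DecidableEq T] (H : ConcGraph.History T)
    (hgen : ConcGraph.Generated H) (hkeys : ConcGraph.UniqueVertexKeys H)
    (hloops : ConcGraph.NoSelfLoops H) :
    ConcGraph.Linearizable H := by
  obtain ⟨c, hc⟩ := hgen
  obtain ⟨σ, h⟩ := hc.exists_simulates hkeys hloops
  exact h.evs ▸ h.inv.valid.linearizable
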